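/- All lattices are finite. A geometric lattice is a finite lattice that is ranked, atomic and semimodular; $\hat 0,\hat 1$ denote its bounds, and it is non-trivial if $\hat 0\ne\hat 1$. An embedding of geometric lattices is an injective join-preserving map sending atoms to atoms. An element $F$ is modular if $F\wedge(A\vee B)=A\vee(F\wedge B)$ for all $A\le F$ and all $B$. Let $L$ be a non-trivial geometric lattice. A modular extension of $L$ is a geometric lattice $E$ with an embedding $\iota:L\to E$ whose image is an interval $[\hat 0,F_\iota]$ with $F_\iota$ modular in $E$; it is trivial if $\iota$ is an isomorphism. The pushout $E_1\cup_L E_2$ of two modular extensions is the subposet of $E_1\times E_2$ of the pairs $(F_1,F_2)$ with $\iota_1^{-1}(F_1\wedge F_{\iota_1})=\iota_2^{-1}(F_2\wedge F_{\iota_2})$, with the embedding $\iota_{12}=(\iota_1,\iota_2)$ of $L$; it is again a modular extension. A modular extension is irreducible if it is non-trivial and not isomorphic (under $L$) to a pushout of two non-trivial modular extensions. A modular diagram is a triple $\Gamma=(E,\iota,J)$ with $(E,\iota)$ a modular extension of $L$ and $J$ a finite word in the atoms of $E$; its degree is $|J|-2\bigl(\mathrm{rk}\bigvee J-\mathrm{rk}((\bigvee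 J)\wedge F_\iota)\bigr)$. Let $\mathcal{MD}(L)$ be the graded $\mathbb Q$-vector space spanned by the modular diagrams of $L$ modulo the relations: (1) exchanging two letters of $J$ changes the sign; (2) $(E,\iota,J)=(E',\varphi\circ\iota,\varphi(J))$ for every embedding $\varphi:E\to E'$ with $\mathrm{rk}\,E=\mathrm{rk}\,E'$; (3) $(E,\iota,J)=0$ if $F_\iota\vee\bigvee J<\hat 1$; (4) $(E,\iota,J)=0$ if $E\cong A\times B$ with $A,B$ non-trivial and $F_\iota\in A\times\{\hat 0\}$; (5) $(E,\iota,J)=0$ if there is a modular $F\ge F_\iota$ in $E$ such that exactly two letters of $J$ are not below $F$. The rule $(E_1,\iota_1,J_1)\bullet(E_2,\iota_2,J_2)=(E_1\cup_LE_2,\iota_{12},J_1J_2)$ (concatenation of words, the atoms of $E_1$ and $E_2$ being viewed as atoms of the pushout) makes $\mathcal{MD}(L)$ a unital associative algebra, with unit $(L,\mathrm{id},\emptyset)$. Proposition. For every non-trivial geometric lattice $L$, the algebra $\mathcal{MD}(L)$ is free as a graded commutative algebra. More precisely, call a modular diagram $(E,\iota,J)$ a generator if either $(E,\iota)$ is trivial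 and $J$ consists of one letter, or $(E,\iota)$ is irreducible, no letter of $J$ is below $F_\iota$, and every atom of $E$ not below $F_\iota$ occurs in $J$. There exist sets $X$ of generators with non-zero classes that contain, for every generator $\Gamma$ with $[\Gamma]\ne0$, exactly one $\Gamma'$ with $[\Gamma]=\pm[\Gamma']$; and for every such $X$ the map sending each $\Gamma\in X$ to its class extends to an isomorphism of graded algebras from the free graded commutative $\mathbb Q$-algebra on $X$ (with $\Gamma\in X$ in degree $\deg\Gamma$) onto $\mathcal{MD}(L)$. Moreover, every modular extension of $L$ is isomorphic to an iterated pushout over $L$ of a finite list (possibly empty, giving the trivial extension) of irreducible modular extensions, and this list is unique up to order and isomorphism of modular extensions of $L$. -/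

import Mathlib

universe u v w

namespace GeomLattice

/-- The rank of an element: the length of a longest chain below it. -/
noncomputable def rk {α : Type u} [Preorder α] (a : α) : ℕ := (Order.height a).toNat

/-- Geometric lattices: finite lattices that are ranked (the rank increases by exactly one along
covering relations, that is, all maximal chains below an element have the same cardinality), atomic
and semimodular. -/
class IsGeometric (α : Type u) [Lattice α] [BoundedOrder α] : Prop where
  finite : Finite α
  rk_covBy : ∀ a b : α, a ⋖ b → rk b = rk a + 1
  atomistic : IsAtomistic α
  semimodular : ∀ a b : α, rk (a ⊓ b) + rk (a ⊔ b) ≤ rk a + rk b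

section Rank

variable {α : Type u}

theorem height_ne_top [PartialOrder α] [Finite α] (a : α) : Order.height a ≠ ⊤ := by
  have := Fintype.ofFinite α
  refine ne_top_of_le_ne_top (ENat.natCast_ne_top (Fintype.card α)) (Order.height_le fun p _ => ?_)
  exact_mod_cast p.length_lt_card.le

theorem coe_rk [PartialOrder α] [Finite α] (a : α) : ((rk a : ℕ) : ℕ∞) = Order.height a :=
  ENat.natCast_toNat (height_ne_top a)

theorem rk_strictMono [PartialOrder α] [Finite α] {a b : α} (h : a < b) : rk a < rk b := by
  have := Order.height_strictMono h (height_ne_top a).lt_top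
  rw [← coe_rk, ← coe_rk] at this
  exact_mod_cast this

theorem rk_mono [PartialOrder α] [Finite α] {a b : α} (h : a ≤ b) : rk a ≤ rk b := by
  rcases h.eq_or_lt with rfl | h
  · exact le_rfl
  · exact (rk_strictMono h).le

theorem rk_bot [PartialOrder α] [OrderBot α] : rk (⊥ : α) = 0 := by
  simp [rk]

theorem rk_atom [PartialOrder α] [OrderBot α] [Finite α] {a : α} (ha : IsAtom a) : rk a = 1 := by
  have h : Order.height a ≤ (1 : ℕ) := by
    rw [Order.height_le_coe_iff]
    intro y hy
    rw [ha.2 y hy]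
    simp
  rw [← coe_rk] at h
  have h1 : rk a ≤ 1 := by exact_mod_cast h
  have := rk_strictMono ha.bot_lt
  omega

/-- The covering property of geometric lattices. -/
theorem covBy_sup_atom [Lattice α] [BoundedOrder α] [IsGeometric α] {x h : α}
    (hh : IsAtom h) (hx : ¬ h ≤ x) : x ⋖ x ⊔ h := by
  have := IsGeometric.finite (α := α)
  refine ⟨lt_of_le_of_ne le_sup_left fun e => hx (e ▸ le_sup_right), fun y hy1 hy2 => ?_⟩
  have h1 := IsGeometric.semimodular x h
  have h2 := rk_strictMono hy1
  have h3 := rk_strictMono hy2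
  have h4 := rk_atom hh
  omega

/-- Saturated chains, by length and end points. -/
inductive Sat [PartialOrder α] : ℕ → α → α → Prop
  | nil (x : α) : Sat 0 x x
  | cons {n : ℕ} {x y z : α} : x ⋖ y → Sat n y z → Sat (n + 1) x z

theorem Sat.le [PartialOrder α] {n : ℕ} {x y : α} (h : Sat n x y) : x ≤ y := by
  induction h with
  | nil => exact le_rfl
  | cons h _ ih => exact h.le.trans ih

theorem Sat.snoc [PartialOrder α] {n : ℕ} {x y z : α} (h : Sat n x y) (hz : y ⋖ z) :
    Sat (n + 1) x z := by
  induction h with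
  | nil => exact .cons hz (.nil _)
  | cons h _ ih => exact .cons h (ih hz)

theorem Sat.exists_of_le [PartialOrder α] [Finite α] {x y : α} (h : x ≤ y) : ∃ n, Sat n x y := by
  induction y using WellFoundedLT.induction with
  | ind y ih =>
    rcases h.eq_or_lt with rfl | h
    · exact ⟨0, .nil _⟩
    · obtain ⟨z, hxz, hz⟩ := exists_le_covBy_of_lt h
      obtain ⟨n, hn⟩ := ih z hz.lt hxz
      exact ⟨n + 1, hn.snoc hz⟩

theorem Sat.unique [Lattice α] [Finite α] [IsUpperModularLattice α] {m : ℕ} :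
    ∀ {n : ℕ} {x y : α}, Sat m x y → Sat n x y → m = n := by
  induction m with
  | zero =>
    intro n x y h h'
    cases h
    cases h' with
    | nil => rfl
    | cons h h' => exact absurd (h.lt.trans_le h'.le) (lt_irrefl _)
  | succ m ih =>
    intro n x y h h'
    cases h with
    | @cons _ _ a _ hxa ha =>
    cases h' with
    | nil => exact absurd (hxa.lt.trans_le ha.le) (lt_irrefl _)
    | @cons n _ b _ hxb hb =>
    by_cases hab : a = b
    · subst hab
      rw [ih ha hb]
    · have hinf : a ⊓ b = x := by
        rcases (hxa.eq_or_eq (le_inf hxa.le hxb.le) inf_le_left) with h | h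
        · exact h
        · rcases (hxb.eq_or_eq hxa.le (inf_eq_left.1 h)) with h' | h'
          · exact absurd h' hxa.lt.ne'
          · exact absurd h' hab
      obtain ⟨k, hk⟩ := Sat.exists_of_le (sup_le ha.le hb.le)
      have h1 : a ⋖ a ⊔ b := by
        have := IsUpperModularLattice.covBy_sup_of_inf_covBy (a := b) (b := a)
          (by rw [inf_comm, hinf]; exact hxb)
        rwa [sup_comm]
      have h2 : b ⋖ a ⊔ b :=
        IsUpperModularLattice.covBy_sup_of_inf_covBy (by rw [hinf]; exact hxa)
      have h3 := ih ha (.cons h1 hk)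
      have h4 : Sat m b y := h3 ▸ .cons h2 hk
      rw [ih h4 hb]

theorem sat_rk [PartialOrder α] [OrderBot α] [Finite α] : ∀ (n : ℕ) (x : α), rk x = n → Sat n ⊥ x := by
  intro n
  induction n with
  | zero =>
    intro x hx
    by_cases h : x = ⊥
    · exact h ▸ .nil _
    · have := rk_strictMono (bot_lt_iff_ne_bot.2 h)
      omega
  | succ n ih =>
    intro x hx
    have h : Order.height x = ((n + 1 : ℕ) : ℕ∞) := by rw [← coe_rk, hx]
    obtain ⟨-, ⟨y, hy, hyn⟩, -⟩ := Order.height_eq_coe_add_one_iff.1 (by exact_mod_cast h)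
    rw [← coe_rk] at hyn
    have hyn : rk y = n := by exact_mod_cast hyn
    refine (ih y hyn).snoc ⟨hy, fun z h1 h2 => ?_⟩
    have := rk_strictMono h1
    have := rk_strictMono h2
    omega

/-- A finite atomistic lattice with the covering property is geometric. -/
theorem isGeometric_of_covering [Lattice α] [BoundedOrder α] [Finite α] [IsAtomistic α]
    (H : ∀ x h : α, IsAtom h → ¬ h ≤ x → x ⋖ x ⊔ h) : IsGeometric α := by
  have hU : IsUpperModularLattice α := by
    constructor
    intro a b hab
    have : ¬ a ≤ b := fun h => hab.lt.ne (inf_eq_left.2 h)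
    rw [le_iff_atom_le_imp] at this
    push Not at this
    obtain ⟨h, hh, hha, hhb⟩ := this
    have e : a ⊓ b ⊔ h = a := by
      rcases hab.eq_or_eq (c := a ⊓ b ⊔ h) le_sup_left (sup_le inf_le_left hha) with h' | h'
      · exact absurd ((le_sup_right.trans_eq h').trans inf_le_right) hhb
      · exact h'
    have e2 : a ⊔ b = b ⊔ h := by
      apply le_antisymm
      · refine sup_le ?_ le_sup_left
        rw [← e]
        exact sup_le (inf_le_right.trans le_sup_left) le_sup_right
      · exact sup_le le_sup_right (hha.trans le_sup_left)
    rw [e2]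
    exact H _ _ hh hhb
  have hcov : ∀ a b : α, a ⋖ b → rk b = rk a + 1 := fun a b hab =>
    (sat_rk _ b rfl).unique ((sat_rk _ a rfl).snoc hab)
  have key : ∀ n (x y b : α), Sat n x y → rk (y ⊔ b) + rk x ≤ rk y + rk (x ⊔ b) := by
    intro n x y b h
    induction h with
    | nil => omega
    | @cons n x x' y hx _ ih =>
      have : ¬ x' ≤ x := fun h => hx.lt.not_ge h
      rw [le_iff_atom_le_imp] at this
      push Not at this
      obtain ⟨h, hh, hha, hhb⟩ := this
      have e : x ⊔ h = x' := by
        rcases hx.eq_or_eq (c := x ⊔ h) le_sup_left (sup_le hx.le hha) with h' | h'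
        · exact absurd (le_sup_right.trans_eq h') hhb
        · exact h'
      have e1 := hcov _ _ hx
      have e2 : rk (x' ⊔ b) ≤ rk (x ⊔ b) + 1 := by
        have e3 : x' ⊔ b = x ⊔ b ⊔ h := by rw [← e, sup_right_comm]
        by_cases hb : h ≤ x ⊔ b
        · rw [e3, sup_eq_left.2 hb]
          omega
        · rw [e3, hcov _ _ (H _ _ hh hb)]
      omega
  refine ⟨inferInstance, hcov, inferInstance, fun a b => ?_⟩
  obtain ⟨n, hn⟩ := Sat.exists_of_le (inf_le_left : a ⊓ b ≤ a)
  have := key n _ _ b hn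
  rw [sup_eq_right.2 (inf_le_right : a ⊓ b ≤ b)] at this
  omega

end Rank

/-- Embeddings of geometric lattices: injective join-preserving (hence increasing) maps sending
atoms to atoms. -/
structure IsEmbedding {α : Type u} {β : Type v} [Lattice α] [BoundedOrder α] [Lattice β]
    [BoundedOrder β] (φ : α → β) : Prop where
  injective : Function.Injective φ
  map_sup : ∀ a b, φ (a ⊔ b) = φ a ⊔ φ b
  map_atom : ∀ a, IsAtom a → IsAtom (φ a)

/-- Modular elements. -/
def IsModularFlat {α : Type u} [Lattice α] (F : α) : Prop :=
  ∀ A B : α, A ≤ F → F ⊓ (A ⊔ B) = A ⊔ F ⊓ B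

/-- A modular extension of `L`: a geometric lattice with an embedding of `L` whose image is the
interval `[⊥, F]` of a modular element `F` (necessarily the image of `⊤`). -/
structure ModExt (L : Type u) [Lattice L] [BoundedOrder L] : Type (u + 1) where
  carrier : Type u
  [lattice : Lattice carrier]
  [bounded : BoundedOrder carrier]
  [geometric : IsGeometric carrier]
  incl : L → carrier
  isEmbedding : IsEmbedding incl
  range_incl : Set.range incl = Set.Iic (incl ⊤)
  modular : IsModularFlat (incl ⊤)

attribute [instance] ModExt.lattice ModExt.bounded ModExt.geometric

namespace IsEmbedding

variable {α : Type u} {β : Type v} [Lattice α] [BoundedOrder α] [Lattice β] [BoundedOrder β]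
  {φ : α → β}

theorem le_iff (h : IsEmbedding φ) {a b : α} : φ a ≤ φ b ↔ a ≤ b := by
  rw [← sup_eq_right, ← sup_eq_right, ← h.map_sup, h.injective.eq_iff]

theorem rk_top [IsGeometric α] [IsGeometric β] (h : IsEmbedding φ) (h0 : φ ⊥ = ⊥)
    (h1 : φ ⊤ = ⊤) : rk (⊤ : α) = rk (⊤ : β) := by
  have := IsGeometric.finite (α := α)
  have := IsGeometric.finite (α := β)
  have := IsGeometric.atomistic (α := α)
  have key : ∀ (n : ℕ) (x y : α), Sat n x y → rk (φ y) = rk (φ x) + n := by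
    intro n x y hs
    induction hs with
    | nil => rfl
    | @cons n x x' y hx _ ih =>
      have : ¬ x' ≤ x := fun h => hx.lt.not_ge h
      rw [le_iff_atom_le_imp] at this
      push Not at this
      obtain ⟨a, hh, hha, hhb⟩ := this
      have e : x ⊔ a = x' := by
        rcases hx.eq_or_eq (c := x ⊔ a) le_sup_left (sup_le hx.le hha) with h' | h'
        · exact absurd (le_sup_right.trans_eq h') hhb
        · exact h'
      have : rk (φ x') = rk (φ x) + 1 := by
        apply IsGeometric.rk_covBy
        rw [← e, h.map_sup]
        exact covBy_sup_atom (h.map_atom a hh) (fun h' => hhb (h.le_iff.1 h'))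
      omega
  have := key _ _ _ (sat_rk _ (⊤ : α) rfl)
  rw [h0, h1, rk_bot] at this
  omega

theorem map_top_of_rk [Finite α] [Finite β] (h : IsEmbedding φ)
    (hr : rk (⊤ : α) = rk (⊤ : β)) : φ ⊤ = ⊤ := by
  by_contra hne
  have h1 := rk_strictMono (lt_top_iff_ne_top.2 hne)
  have hm : StrictMono φ := fun a b hab =>
    lt_of_le_of_ne (h.le_iff.2 hab.le) fun e => hab.ne (h.injective e)
  have h2 := Order.height_le_height_apply_of_strictMono φ hm ⊤
  rw [← coe_rk, ← coe_rk] at h2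
  have : rk (⊤ : α) ≤ rk (φ ⊤) := by exact_mod_cast h2
  omega

theorem of_orderIso (e : α ≃o β) : IsEmbedding e :=
  ⟨e.injective, fun a b => OrderIso.map_sup e a b, fun a ha => (OrderIso.isAtom_iff e a).2 ha⟩

end IsEmbedding

theorem rk_orderIso {α : Type u} {β : Type v} [Preorder α] [Preorder β] (e : α ≃o β) (a : α) :
    rk (e a) = rk a := by
  simp [rk, Order.height_orderIso]

namespace ModExt

variable {L : Type u} [Lattice L] [BoundedOrder L] (E E₁ E₂ E₃ : ModExt L)

instance : Finite E.carrier := IsGeometric.finite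
instance : IsAtomistic E.carrier := IsGeometric.atomistic

/-- The flat `F` such that the image of `L` is `[⊥, F]`. -/
def flat : E.carrier := E.incl ⊤

theorem incl_le_incl {a b : L} : E.incl a ≤ E.incl b ↔ a ≤ b := E.isEmbedding.le_iff

theorem incl_le_flat (a : L) : E.incl a ≤ E.flat := E.incl_le_incl.2 le_top

theorem exists_incl (x : E.carrier) : ∃ l, E.incl l = x ⊓ E.flat := by
  have : x ⊓ E.flat ∈ Set.range E.incl := by
    rw [E.range_incl]
    exact inf_le_right
  exact this

/-- The element `ι⁻¹(x ∧ F)` of `L`. -/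
noncomputable def restr (x : E.carrier) : L := (E.exists_incl x).choose

theorem incl_restr (x : E.carrier) : E.incl (E.restr x) = x ⊓ E.flat := (E.exists_incl x).choose_spec

theorem incl_le_iff {l : L} {x : E.carrier} : E.incl l ≤ x ↔ l ≤ E.restr x := by
  rw [← E.incl_le_incl, incl_restr, le_inf_iff, and_iff_left (E.incl_le_flat l)]

theorem incl_restr_le (x : E.carrier) : E.incl (E.restr x) ≤ x := E.incl_le_iff.2 le_rfl

theorem restr_mono {x y : E.carrier} (h : x ≤ y) : E.restr x ≤ E.restr y :=
  E.incl_le_iff.1 ((E.incl_restr_le x).trans h)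

theorem restr_incl (l : L) : E.restr (E.incl l) = l := by
  apply E.isEmbedding.injective
  rw [incl_restr, inf_eq_left.2 (E.incl_le_flat l)]

theorem incl_restr_of_le {x : E.carrier} (h : x ≤ E.flat) : E.incl (E.restr x) = x := by
  rw [incl_restr, inf_eq_left.2 h]

theorem restr_eq_top {x : E.carrier} (h : E.flat ≤ x) : E.restr x = ⊤ :=
  top_le_iff.1 (E.incl_le_iff.1 h)

theorem restr_top : E.restr ⊤ = ⊤ := E.restr_eq_top le_top

theorem incl_bot : E.incl ⊥ = ⊥ := by
  have := E.incl_restr ⊥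
  rw [bot_inf_eq] at this
  exact le_bot_iff.1 (this ▸ E.incl_le_incl.2 bot_le)

theorem restr_bot : E.restr ⊥ = ⊥ := by
  rw [← E.incl_bot, restr_incl]

theorem restr_inf (x y : E.carrier) : E.restr (x ⊓ y) = E.restr x ⊓ E.restr y :=
  le_antisymm (le_inf (E.restr_mono inf_le_left) (E.restr_mono inf_le_right))
    (E.incl_le_iff.1 (le_inf (E.incl_le_iff.2 inf_le_left) (E.incl_le_iff.2 inf_le_right)))

theorem restr_incl_sup (l : L) (x : E.carrier) : E.restr (E.incl l ⊔ x) = l ⊔ E.restr x := by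
  apply E.isEmbedding.injective
  rw [E.isEmbedding.map_sup, incl_restr, incl_restr, inf_comm, inf_comm x]
  exact E.modular _ _ (E.incl_le_flat l)

theorem restr_sup_incl (l : L) (x : E.carrier) : E.restr (x ⊔ E.incl l) = E.restr x ⊔ l := by
  rw [sup_comm, restr_incl_sup, sup_comm]

end ModExt

/-- The underlying poset of the pushout of two modular extensions: the pairs `(F₁, F₂)` with
`ι₁⁻¹(F₁ ∧ F_ι₁) = ι₂⁻¹(F₂ ∧ F_ι₂)`. -/
def Pushout {L : Type u} [Lattice L] [BoundedOrder L] (E₁ E₂ : ModExt L) : Type u :=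
  {p : E₁.carrier × E₂.carrier // E₁.restr p.1 = E₂.restr p.2}

namespace Pushout

variable {L : Type u} [Lattice L] [BoundedOrder L] {E₁ E₂ : ModExt L}

instance : PartialOrder (Pushout E₁ E₂) := inferInstanceAs (PartialOrder (Subtype _))

instance : Finite (Pushout E₁ E₂) := inferInstanceAs (Finite (Subtype _))

theorem le_def {p q : Pushout E₁ E₂} : p ≤ q ↔ p.1.1 ≤ q.1.1 ∧ p.1.2 ≤ q.1.2 := Iff.rfl

theorem ext {p q : Pushout E₁ E₂} (h1 : p.1.1 = q.1.1) (h2 : p.1.2 = q.1.2) : p = q :=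
  Subtype.ext (Prod.ext h1 h2)

/-- The element of `L` added to both coordinates to form a join in the pushout. -/
noncomputable def joint (x : E₁.carrier) (y : E₂.carrier) : L := E₁.restr x ⊔ E₂.restr y

/-- The smallest element of the pushout above a pair. -/
noncomputable def close (x : E₁.carrier) (y : E₂.carrier) : Pushout E₁ E₂ :=
  ⟨(x ⊔ E₁.incl (joint x y), y ⊔ E₂.incl (joint x y)), by
    simp only [ModExt.restr_sup_incl, joint]
    rw [← sup_assoc, sup_idem, sup_left_comm, sup_idem]⟩

theorem close_le {x : E₁.carrier} {y : E₂.carrier} {r : Pushout E₁ E₂} :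
    close x y ≤ r ↔ x ≤ r.1.1 ∧ y ≤ r.1.2 := by
  constructor
  · intro h
    exact ⟨le_sup_left.trans h.1, le_sup_left.trans h.2⟩
  · rintro ⟨h1, h2⟩
    have e := r.2
    have h : joint x y ≤ E₁.restr r.1.1 :=
      sup_le (E₁.restr_mono h1) ((E₂.restr_mono h2).trans_eq e.symm)
    exact ⟨sup_le h1 (E₁.incl_le_iff.2 h), sup_le h2 (E₂.incl_le_iff.2 (h.trans_eq e))⟩

noncomputable instance : Lattice (Pushout E₁ E₂) where
  sup p q := close (p.1.1 ⊔ q.1.1) (p.1.2 ⊔ q.1.2)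
  inf p q := ⟨(p.1.1 ⊓ q.1.1, p.1.2 ⊓ q.1.2), by
    simp only [ModExt.restr_inf]
    rw [p.2, q.2]⟩
  le_sup_left p q := ⟨le_sup_left.trans le_sup_left, le_sup_left.trans le_sup_left⟩
  le_sup_right p q := ⟨le_sup_right.trans le_sup_left, le_sup_right.trans le_sup_left⟩
  sup_le p q r h1 h2 := close_le.2 ⟨sup_le h1.1 h2.1, sup_le h1.2 h2.2⟩
  inf_le_left p q := ⟨inf_le_left, inf_le_left⟩
  inf_le_right p q := ⟨inf_le_right, inf_le_right⟩
  le_inf p q r h1 h2 := ⟨le_inf h1.1 h2.1, le_inf h1.2 h2.2⟩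

noncomputable instance : BoundedOrder (Pushout E₁ E₂) where
  top := ⟨(⊤, ⊤), by simp [ModExt.restr_top]⟩
  le_top p := ⟨le_top, le_top⟩
  bot := ⟨(⊥, ⊥), by simp [ModExt.restr_bot]⟩
  bot_le p := ⟨bot_le, bot_le⟩

theorem sup_def (p q : Pushout E₁ E₂) : p ⊔ q = close (p.1.1 ⊔ q.1.1) (p.1.2 ⊔ q.1.2) := rfl
theorem inf_fst (p q : Pushout E₁ E₂) : (p ⊓ q).1.1 = p.1.1 ⊓ q.1.1 := rfl
theorem inf_snd (p q : Pushout E₁ E₂) : (p ⊓ q).1.2 = p.1.2 ⊓ q.1.2 := rfl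
theorem top_fst : (⊤ : Pushout E₁ E₂).1.1 = ⊤ := rfl
theorem top_snd : (⊤ : Pushout E₁ E₂).1.2 = ⊤ := rfl
theorem bot_fst : (⊥ : Pushout E₁ E₂).1.1 = ⊥ := rfl
theorem bot_snd : (⊥ : Pushout E₁ E₂).1.2 = ⊥ := rfl

/-- If the componentwise join lies in the pushout, it is the join. -/
theorem sup_eq {p q : Pushout E₁ E₂} (h : E₁.restr (p.1.1 ⊔ q.1.1) = E₂.restr (p.1.2 ⊔ q.1.2)) :
    p ⊔ q = ⟨(p.1.1 ⊔ q.1.1, p.1.2 ⊔ q.1.2), h⟩ :=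
  le_antisymm (sup_le ⟨le_sup_left, le_sup_left⟩ ⟨le_sup_right, le_sup_right⟩)
    ⟨le_sup_left, le_sup_left⟩

/-- The embedding of the first extension in the pushout. -/
noncomputable def inl (x : E₁.carrier) : Pushout E₁ E₂ :=
  ⟨(x, E₂.incl (E₁.restr x)), by simp [ModExt.restr_incl]⟩

/-- The embedding of the second extension in the pushout. -/
noncomputable def inr (x : E₂.carrier) : Pushout E₁ E₂ :=
  ⟨(E₁.incl (E₂.restr x), x), by simp [ModExt.restr_incl]⟩

/-- The embedding of `L` in the pushout. -/
def base (l : L) : Pushout E₁ E₂ := ⟨(E₁.incl l, E₂.incl l), by simp [ModExt.restr_incl]⟩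

theorem inl_le {x : E₁.carrier} {p : Pushout E₁ E₂} : inl x ≤ p ↔ x ≤ p.1.1 := by
  refine ⟨fun h => h.1, fun h => ⟨h, ?_⟩⟩
  exact E₂.incl_le_iff.2 ((E₁.restr_mono h).trans_eq p.2)

theorem inr_le {x : E₂.carrier} {p : Pushout E₁ E₂} : inr x ≤ p ↔ x ≤ p.1.2 := by
  refine ⟨fun h => h.2, fun h => ⟨?_, h⟩⟩
  exact E₁.incl_le_iff.2 ((E₂.restr_mono h).trans_eq p.2.symm)

theorem isAtom_inl {x : E₁.carrier} (hx : IsAtom x) : IsAtom (inl x : Pushout E₁ E₂) := by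
  refine ⟨fun h => hx.1 (congrArg (fun p : Pushout E₁ E₂ => p.1.1) h), fun q hq => ?_⟩
  rcases hx.le_iff.1 hq.le.1 with h | h
  · refine ext h ?_
    have h2 : q.1.2 ≤ E₂.flat := hq.le.2.trans (E₂.incl_le_flat _)
    have h3 := E₂.incl_restr_of_le h2
    have h4 : E₁.restr q.1.1 = ⊥ := by rw [h, E₁.restr_bot]
    rw [← h3, ← q.2, h4, E₂.incl_bot]
    rfl
  · exact absurd (inl_le.2 h.ge) hq.not_ge

theorem isAtom_inr {x : E₂.carrier} (hx : IsAtom x) : IsAtom (inr x : Pushout E₁ E₂) := by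
  refine ⟨fun h => hx.1 (congrArg (fun p : Pushout E₁ E₂ => p.1.2) h), fun q hq => ?_⟩
  rcases hx.le_iff.1 hq.le.2 with h | h
  · refine ext ?_ h
    have h2 : q.1.1 ≤ E₁.flat := hq.le.1.trans (E₁.incl_le_flat _)
    have h3 := E₁.incl_restr_of_le h2
    have h4 : E₂.restr q.1.2 = ⊥ := by rw [h, E₂.restr_bot]
    rw [← h3, q.2, h4, E₁.incl_bot]
    rfl
  · exact absurd (inr_le.2 h.ge) hq.not_ge

instance : IsAtomistic (Pushout E₁ E₂) := by
  refine ⟨fun p => ⟨{a | IsAtom a ∧ a ≤ p}, ⟨fun a ha => ha.2, fun r hr => ⟨?_, ?_⟩⟩,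
    fun a ha => ha.1⟩⟩
  · rw [le_iff_atom_le_imp]
    exact fun c hc hcp => inl_le.1 (hr ⟨isAtom_inl hc, inl_le.2 hcp⟩)
  · rw [le_iff_atom_le_imp]
    exact fun c hc hcp => inr_le.1 (hr ⟨isAtom_inr hc, inr_le.2 hcp⟩)

theorem atom_cases {a : Pushout E₁ E₂} (ha : IsAtom a) :
    (∃ x, IsAtom x ∧ a = inl x) ∨ ∃ x, IsAtom x ∧ a = inr x := by
  by_cases h1 : a.1.1 = ⊥
  · have h2 : a.1.2 ≠ ⊥ := fun h => ha.1 (ext h1 h)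
    have h3 : ¬ a.1.2 ≤ ⊥ := fun h => h2 (le_bot_iff.1 h)
    rw [le_iff_atom_le_imp] at h3
    push Not at h3
    obtain ⟨c, hc, hca, -⟩ := h3
    refine Or.inr ⟨c, hc, ?_⟩
    rcases ha.le_iff.1 (inr_le.2 hca) with h | h
    · exact absurd h (isAtom_inr hc).1
    · exact h.symm
  · have h3 : ¬ a.1.1 ≤ ⊥ := fun h => h1 (le_bot_iff.1 h)
    rw [le_iff_atom_le_imp] at h3
    push Not at h3
    obtain ⟨c, hc, hca, -⟩ := h3
    refine Or.inl ⟨c, hc, ?_⟩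
    rcases ha.le_iff.1 (inl_le.2 hca) with h | h
    · exact absurd h (isAtom_inl hc).1
    · exact h.symm

/-- The symmetry of the pushout. -/
def swap : Pushout E₁ E₂ ≃o Pushout E₂ E₁ where
  toFun p := ⟨(p.1.2, p.1.1), p.2.symm⟩
  invFun p := ⟨(p.1.2, p.1.1), p.2.symm⟩
  left_inv _ := rfl
  right_inv _ := rfl
  map_rel_iff' {p q} := by
    show _ ∧ _ ↔ _ ∧ _
    exact and_comm

theorem swap_inl (x : E₁.carrier) : swap (inl x : Pushout E₁ E₂) = inr x := rfl
theorem swap_inr (x : E₂.carrier) : swap (inr x : Pushout E₁ E₂) = inl x := rfl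

theorem covBy_inl [IsGeometric L] (p : Pushout E₁ E₂) {h : E₁.carrier} (hh : IsAtom h)
    (hp : ¬ inl h ≤ p) : p ⋖ p ⊔ inl h := by
  have := IsGeometric.finite (α := L)
  have := IsGeometric.atomistic (α := L)
  have hp1 : ¬ h ≤ p.1.1 := fun h' => hp (inl_le.2 h')
  refine ⟨lt_of_le_of_ne le_sup_left fun e => hp (e ▸ le_sup_right), fun q hq1 hq2 => ?_⟩
  refine hq2.not_ge (sup_le hq1.le (inl_le.2 ?_))
  have hc := covBy_sup_atom hh hp1
  have key : q.1.1 ≤ p.1.1 ⊔ h → p.1.1 ≠ q.1.1 → h ≤ q.1.1 := fun h1 h2 => by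
    rcases hc.eq_or_eq hq1.le.1 h1 with h' | h'
    · exact absurd h'.symm h2
    · exact h' ▸ le_sup_right
  by_cases hA : E₁.restr (p.1.1 ⊔ h) ≤ E₁.restr p.1.1
  · have e : E₁.restr (p.1.1 ⊔ h) = E₂.restr p.1.2 :=
      (le_antisymm hA (E₁.restr_mono le_sup_left)).trans p.2
    have hq3 : q ≤ ⟨(p.1.1 ⊔ h, p.1.2), e⟩ :=
      hq2.le.trans (sup_le ⟨le_sup_left, le_rfl⟩ (inl_le.2 le_sup_right))
    refine key hq3.1 fun h' => ?_
    exact hq1.ne (ext h' (le_antisymm hq1.le.2 hq3.2))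
  · rw [le_iff_atom_le_imp] at hA
    push Not at hA
    obtain ⟨l, hl, hl1, hl2⟩ := hA
    have e1 : p.1.1 ⊔ E₁.incl l = p.1.1 ⊔ h := by
      rcases hc.eq_or_eq (c := p.1.1 ⊔ E₁.incl l) le_sup_left
        (sup_le le_sup_left (E₁.incl_le_iff.2 hl1)) with h' | h'
      · exact absurd (E₁.incl_le_iff.1 (le_sup_right.trans_eq h')) hl2
      · exact h'
    have e : E₁.restr (p.1.1 ⊔ E₁.incl l) = E₂.restr (p.1.2 ⊔ E₂.incl l) := by
      rw [ModExt.restr_sup_incl, ModExt.restr_sup_incl, p.2]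
    have hq3 : q ≤ ⟨(p.1.1 ⊔ E₁.incl l, p.1.2 ⊔ E₂.incl l), e⟩ :=
      hq2.le.trans (sup_le ⟨le_sup_left, le_sup_left⟩ (inl_le.2 (le_sup_right.trans_eq e1.symm)))
    refine key (hq3.1.trans_eq e1) fun h' => ?_
    have hl3 : ¬ E₂.incl l ≤ p.1.2 := fun h'' => hl2 ((E₂.incl_le_iff.1 h'').trans_eq p.2.symm)
    rcases (covBy_sup_atom (E₂.isEmbedding.map_atom l hl) hl3).eq_or_eq hq1.le.2 hq3.2
      with h'' | h''
    · exact hq1.ne (ext h' h''.symm)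
    · have : E₂.incl l ≤ q.1.2 := h'' ▸ le_sup_right
      have := E₂.incl_le_iff.1 this
      rw [← q.2, ← h'] at this
      exact hl2 this

instance [IsGeometric L] : IsGeometric (Pushout E₁ E₂) := by
  apply isGeometric_of_covering
  intro p a ha hp
  rcases atom_cases ha with ⟨x, hx, rfl⟩ | ⟨x, hx, rfl⟩
  · exact covBy_inl p hx hp
  · have := covBy_inl (swap p) (E₂ := E₁) hx
      (fun h => hp ((OrderIso.le_iff_le (swap (E₁ := E₁) (E₂ := E₂))).1 h))
    rw [← swap_inr, ← map_sup] at this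
    exact (apply_covBy_apply_iff swap).1 this

theorem base_sup (l : L) (p : Pushout E₁ E₂) :
    base l ⊔ p = ⟨(E₁.incl l ⊔ p.1.1, E₂.incl l ⊔ p.1.2), by
      simp only [ModExt.restr_incl_sup]
      rw [p.2]⟩ :=
  sup_eq _

theorem base_le {l : L} {p : Pushout E₁ E₂} : base l ≤ p ↔ l ≤ E₁.restr p.1.1 := by
  rw [le_def]
  show E₁.incl l ≤ _ ∧ E₂.incl l ≤ _ ↔ _
  rw [E₁.incl_le_iff, E₂.incl_le_iff, p.2, and_self]

theorem base_eq_inl (l : L) : (base l : Pushout E₁ E₂) = inl (E₁.incl l) :=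
  ext rfl (by simp [base, inl, ModExt.restr_incl])

theorem base_eq_inr (l : L) : (base l : Pushout E₁ E₂) = inr (E₂.incl l) :=
  ext (by simp [base, inr, ModExt.restr_incl]) rfl

theorem base_restr {p : Pushout E₁ E₂} (h : p ≤ base ⊤) : base (E₁.restr p.1.1) = p :=
  ext (E₁.incl_restr_of_le h.1) (by
    show E₂.incl (E₁.restr p.1.1) = _
    rw [p.2]
    exact E₂.incl_restr_of_le h.2)

end Pushout

/-- The pushout of two modular extensions, as a modular extension. -/
@[reducible] noncomputable def ModExt.pushout {L : Type u} [Lattice L] [BoundedOrder L] [IsGeometric L]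
    (E₁ E₂ : ModExt L) : ModExt L where
  carrier := Pushout E₁ E₂
  incl := Pushout.base
  isEmbedding :=
    { injective := fun a b h => E₁.isEmbedding.injective
        (congrArg (fun p : Pushout E₁ E₂ => p.1.1) h)
      map_sup := fun a b => by
        rw [Pushout.base_sup]
        exact Pushout.ext (E₁.isEmbedding.map_sup a b) (E₂.isEmbedding.map_sup a b)
      map_atom := fun a ha => by
        rw [Pushout.base_eq_inl]
        exact Pushout.isAtom_inl (E₁.isEmbedding.map_atom a ha) }
  range_incl := by
    ext p
    constructor
    · rintro ⟨l, rfl⟩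
      exact ⟨E₁.incl_le_flat l, E₂.incl_le_flat l⟩
    · intro h
      exact ⟨_, Pushout.base_restr h⟩
  modular := by
    intro A B hA
    rw [← Pushout.base_restr hA, Pushout.base_sup, Pushout.base_sup]
    exact Pushout.ext (E₁.modular _ _ (E₁.incl_le_flat _)) (E₂.modular _ _ (E₂.incl_le_flat _))

/-- The trivial extension of `L` by itself. -/
def ModExt.self (L : Type u) [Lattice L] [BoundedOrder L] [IsGeometric L] : ModExt L where
  carrier := L
  incl := id
  isEmbedding := ⟨Function.injective_id, fun _ _ => rfl, fun _ h => h⟩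
  range_incl := by simp
  modular := by
    intro A B _
    simp

/-- Isomorphism of modular extensions of `L`. -/
def ModExt.Iso {L : Type u} [Lattice L] [BoundedOrder L] (E₁ E₂ : ModExt L) : Prop :=
  ∃ e : E₁.carrier ≃o E₂.carrier, ∀ l, e (E₁.incl l) = E₂.incl l

/-- A modular extension is trivial if its embedding is an isomorphism. -/
def ModExt.IsTrivial {L : Type u} [Lattice L] [BoundedOrder L] (E : ModExt L) : Prop :=
  Function.Surjective E.incl

/-- A modular extension is irreducible if it is non-trivial and is not (isomorphic to) a pushout of
two non-trivial modular extensions. -/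
def ModExt.IsIrreducible {L : Type u} [Lattice L] [BoundedOrder L] [IsGeometric L]
    (E : ModExt L) : Prop :=
  ¬ E.IsTrivial ∧ ¬ ∃ E₁ E₂ : ModExt L, ¬ E₁.IsTrivial ∧ ¬ E₂.IsTrivial ∧ E.Iso (E₁.pushout E₂)

/-- The iterated pushout of a finite list of modular extensions. -/
noncomputable def ModExt.pushoutList {L : Type u} [Lattice L] [BoundedOrder L] [IsGeometric L] :
    List (ModExt L) → ModExt L
  | [] => ModExt.self L
  | E :: l => E.pushout (pushoutList l)

/-- A modular diagram: a modular extension with a finite word in its atoms (a linearly ordered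
multiset of atoms). -/
structure ModDiag (L : Type u) [Lattice L] [BoundedOrder L] : Type (u + 1) extends ModExt L where
  word : List carrier
  word_atom : ∀ h ∈ word, IsAtom h

/-- The join of a finite list. -/
def listJoin {α : Type u} [Lattice α] [BoundedOrder α] (J : List α) : α := J.foldr (· ⊔ ·) ⊥

/-- The degree `|J| - 2 (rk ⋁J - rk (⋁J ∧ F))` of a modular diagram. -/
noncomputable def ModDiag.degree {L : Type u} [Lattice L] [BoundedOrder L] (Γ : ModDiag L) : ℤ :=
  Γ.word.length - 2 * ((rk (listJoin Γ.word) : ℤ) - rk (listJoin Γ.word ⊓ Γ.flat))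

open Classical in
/-- The relations imposed on modular diagrams. In `prod` the factors are arbitrary posets with more
than one element (as factors of a geometric lattice they are geometric lattices). -/
inductive MDRel {L : Type u} [Lattice L] [BoundedOrder L] : (ModDiag L →₀ ℚ) → Prop
  /-- Exchanging two consecutive letters changes the sign. -/
  | swap (E : ModExt L) (J₁ J₂ : List E.carrier) (a b : E.carrier)
      (h : ∀ x ∈ J₁ ++ a :: b :: J₂, IsAtom x) (h' : ∀ x ∈ J₁ ++ b :: a :: J₂, IsAtom x) :
      MDRel (Finsupp.single ⟨E, J₁ ++ a :: b :: J₂, h⟩ 1 +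
        Finsupp.single ⟨E, J₁ ++ b :: a :: J₂, h'⟩ 1)
  /-- Diagrams related by an embedding between lattices of the same rank are identified. -/
  | embed (Γ Γ' : ModDiag L) (φ : Γ.carrier → Γ'.carrier) (hφ : IsEmbedding φ)
      (hr : rk (⊤ : Γ.carrier) = rk (⊤ : Γ'.carrier)) (hι : ∀ l, Γ'.incl l = φ (Γ.incl l))
      (hJ : Γ'.word = Γ.word.map φ) :
      MDRel (Finsupp.single Γ 1 - Finsupp.single Γ' 1)
  /-- Diagrams that do not span vanish. -/
  | span (Γ : ModDiag L) (h : Γ.flat ⊔ listJoin Γ.word < ⊤) : MDRel (Finsupp.single Γ 1)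
  /-- Diagrams on a product, with `L` contained in one factor, vanish. -/
  | prod (Γ : ModDiag L) (A B : Type u) [PartialOrder A] [PartialOrder B] [OrderBot B]
      [Nontrivial A] [Nontrivial B] (e : Γ.carrier ≃o A × B) (h : (e Γ.flat).2 = ⊥) :
      MDRel (Finsupp.single Γ 1)
  /-- Diagrams with exactly two letters not below some modular `F ≥ F_ι` vanish. -/
  | two (Γ : ModDiag L) (F : Γ.carrier) (hF : IsModularFlat F) (hle : Γ.flat ≤ F)
      (h : (Γ.word.filter fun x => ¬ x ≤ F).length = 2) : MDRel (Finsupp.single Γ 1)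

/-- The vector space of modular diagrams of `L`. -/
def MD (L : Type u) [Lattice L] [BoundedOrder L] : Type (u + 1) :=
  (ModDiag L →₀ ℚ) ⧸ Submodule.span ℚ {v : ModDiag L →₀ ℚ | MDRel v}

namespace MD

variable {L : Type u} [Lattice L] [BoundedOrder L]

noncomputable instance : AddCommGroup (MD L) :=
  inferInstanceAs (AddCommGroup ((ModDiag L →₀ ℚ) ⧸ Submodule.span ℚ {v | MDRel v}))

noncomputable instance : Module ℚ (MD L) :=
  inferInstanceAs (Module ℚ ((ModDiag L →₀ ℚ) ⧸ Submodule.span ℚ {v | MDRel v}))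

/-- The quotient map. -/
noncomputable def proj : (ModDiag L →₀ ℚ) →ₗ[ℚ] MD L :=
  Submodule.mkQ (Submodule.span ℚ {v : ModDiag L →₀ ℚ | MDRel v})

/-- The class of a modular diagram. -/
noncomputable def cls (Γ : ModDiag L) : MD L := proj (Finsupp.single Γ 1)

/-- The homogeneous part of degree `n`, spanned by the diagrams of degree `n`. -/
noncomputable def homogeneous (L : Type u) [Lattice L] [BoundedOrder L] (n : ℤ) :
    Submodule ℚ (MD L) :=
  Submodule.span ℚ {x | ∃ Γ : ModDiag L, Γ.degree = n ∧ cls Γ = x}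

theorem proj_rel {v : ModDiag L →₀ ℚ} (h : MDRel v) : proj v = 0 :=
  (Submodule.Quotient.mk_eq_zero _).2 (Submodule.subset_span h)

theorem ind {p : MD L → Prop} (h0 : p 0) (hadd : ∀ x y, p x → p y → p (x + y))
    (hc : ∀ (c : ℚ) (Γ : ModDiag L), p (c • cls Γ)) (x : MD L) : p x := by
  obtain ⟨v, rfl⟩ : ∃ v, proj v = x := Submodule.mkQ_surjective _ x
  induction v using Finsupp.induction_linear with
  | zero =>
    rw [map_zero]
    exact h0
  | add v w hv hw => rw [map_add]; exact hadd _ _ hv hw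
  | single Γ c =>
    have : Finsupp.single Γ c = c • Finsupp.single Γ (1 : ℚ) := by simp
    rw [this, map_smul]
    exact hc c Γ

theorem hom_ext {M : Type w} [AddCommGroup M] [Module ℚ M] {f g : MD L →ₗ[ℚ] M}
    (h : ∀ Γ, f (cls Γ) = g (cls Γ)) : f = g := by
  ext x
  induction x using ind with
  | hadd x y hx hy => rw [map_add, map_add, hx, hy]
  | hc c Γ => rw [map_smul, map_smul, h]
  | h0 => rw [map_zero, map_zero]

/-- Extend a map on diagrams that is compatible with the relations. -/
noncomputable def lift {M : Type w} [AddCommGroup M] [Module ℚ M] (f : ModDiag L → M)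
    (hf : ∀ v, MDRel v → Finsupp.linearCombination ℚ f v = 0) : MD L →ₗ[ℚ] M :=
  Submodule.liftQ _ (Finsupp.linearCombination ℚ f) (Submodule.span_le.2 fun v hv => hf v hv)

theorem lift_cls {M : Type w} [AddCommGroup M] [Module ℚ M] (f : ModDiag L → M)
    (hf : ∀ v, MDRel v → Finsupp.linearCombination ℚ f v = 0) (Γ : ModDiag L) :
    lift f hf (cls Γ) = f Γ := by
  have : lift f hf (cls Γ) = Finsupp.linearCombination ℚ f (Finsupp.single Γ 1) :=
    Submodule.liftQ_apply _ _ _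
  rw [this, Finsupp.linearCombination_single, one_smul]

theorem cls_swap (E : ModExt L) (J₁ J₂ : List E.carrier) (a b : E.carrier)
    (h : ∀ x ∈ J₁ ++ a :: b :: J₂, IsAtom x) (h' : ∀ x ∈ J₁ ++ b :: a :: J₂, IsAtom x) :
    cls ⟨E, J₁ ++ a :: b :: J₂, h⟩ = - cls ⟨E, J₁ ++ b :: a :: J₂, h'⟩ := by
  have := proj_rel (MDRel.swap E J₁ J₂ a b h h')
  rw [map_add] at this
  exact eq_neg_of_add_eq_zero_left this

theorem cls_embed (Γ Γ' : ModDiag L) (φ : Γ.carrier → Γ'.carrier) (hφ : IsEmbedding φ)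
    (hr : rk (⊤ : Γ.carrier) = rk (⊤ : Γ'.carrier)) (hι : ∀ l, Γ'.incl l = φ (Γ.incl l))
    (hJ : Γ'.word = Γ.word.map φ) : cls Γ = cls Γ' := by
  have := proj_rel (MDRel.embed Γ Γ' φ hφ hr hι hJ)
  rw [map_sub] at this
  exact sub_eq_zero.1 this

theorem cls_iso (Γ Γ' : ModDiag L) (e : Γ.carrier ≃o Γ'.carrier)
    (hι : ∀ l, Γ'.incl l = e (Γ.incl l)) (hJ : Γ'.word = Γ.word.map e) : cls Γ = cls Γ' :=
  cls_embed Γ Γ' e (.of_orderIso e) (by rw [← map_top e, rk_orderIso]) hι hJ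

/-- Moving one letter through a block. -/
theorem cls_move (E : ModExt L) (a : E.carrier) (J₂ : List E.carrier) :
    ∀ (J₁ J₃ : List E.carrier) (h : ∀ x ∈ J₁ ++ a :: (J₂ ++ J₃), IsAtom x)
      (h' : ∀ x ∈ J₁ ++ (J₂ ++ a :: J₃), IsAtom x),
      cls ⟨E, J₁ ++ a :: (J₂ ++ J₃), h⟩ = (-1 : ℚ) ^ J₂.length • cls ⟨E, J₁ ++ (J₂ ++ a :: J₃), h'⟩ := by
  induction J₂ with
  | nil =>
    intro J₁ J₃ h h'
    simp
  | cons b J₂ ih =>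
    intro J₁ J₃ h h'
    have h2 : ∀ x ∈ J₁ ++ b :: a :: (J₂ ++ J₃), IsAtom x := by
      intro x hx
      apply h
      simp only [List.mem_append, List.mem_cons, List.cons_append] at hx ⊢
      tauto
    have h3 := cls_swap E J₁ (J₂ ++ J₃) a b h h2
    have h4 := ih (J₁ ++ [b]) J₃ (by simpa using h2) (by simpa using h')
    simp only [List.append_assoc, List.cons_append, List.nil_append] at h4
    simp only [List.cons_append, List.length_cons, pow_succ, mul_neg, mul_one, neg_smul]
    rw [h3, h4]

/-- Exchanging two blocks. -/
theorem cls_append (E : ModExt L) (J₂ : List E.carrier) :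
    ∀ (J₁ : List E.carrier) (h : ∀ x ∈ J₁ ++ J₂, IsAtom x) (h' : ∀ x ∈ J₂ ++ J₁, IsAtom x),
      cls ⟨E, J₁ ++ J₂, h⟩ = (-1 : ℚ) ^ (J₁.length * J₂.length) • cls ⟨E, J₂ ++ J₁, h'⟩ := by
  intro J₁
  induction J₁ generalizing J₂ with
  | nil =>
    intro h h'
    simp
  | cons a J₁ ih =>
    intro h h'
    have h2 : ∀ x ∈ J₁ ++ (J₂ ++ [a]), IsAtom x := by
      intro x hx
      apply h
      simp only [List.mem_append, List.mem_cons, List.cons_append, List.not_mem_nil] at hx ⊢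
      tauto
    have h3 := cls_move E a (J₁ ++ J₂) [] [] (by simpa using h) (by simpa using h2)
    have h4 := ih (J₂ ++ [a]) h2 (by simpa using h')
    simp only [List.nil_append, List.append_nil, List.append_assoc] at h3
    simp only [List.append_assoc, List.cons_append, List.nil_append] at h4
    simp only [List.cons_append]
    rw [h3, h4, smul_smul, ← pow_add]
    congr 1
    simp only [List.length_append, List.length_cons, List.length_nil]
    rw [show J₁.length + J₂.length + J₁.length * (J₂.length + (0 + 1)) =
      (J₁.length + 1) * J₂.length + 2 * J₁.length by ring, pow_add, pow_mul (-1 : ℚ) 2]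
    simp

end MD

theorem le_listJoin {α : Type u} [Lattice α] [BoundedOrder α] {J : List α} {x : α} (h : x ∈ J) :
    x ≤ listJoin J := by
  induction J with
  | nil => simp at h
  | cons a J ih =>
    rcases List.mem_cons.1 h with rfl | h
    · exact le_sup_left
    · exact (ih h).trans le_sup_right

theorem listJoin_le {α : Type u} [Lattice α] [BoundedOrder α] {J : List α} {y : α}
    (h : ∀ x ∈ J, x ≤ y) : listJoin J ≤ y := by
  induction J with
  | nil => exact bot_le
  | cons a J ih =>
    exact sup_le (h a (by simp)) (ih fun x hx => h x (by simp [hx]))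

theorem restr_of_embedding {L : Type u} [Lattice L] [BoundedOrder L] {E E' : ModExt L} {φ : E.carrier → E'.carrier}
    (hφ : IsEmbedding φ) (hι : ∀ l, E'.incl l = φ (E.incl l)) (x : E.carrier) :
    E'.restr (φ x) = E.restr x := by
  apply eq_of_forall_le_iff
  intro l
  rw [← E'.incl_le_iff, ← E.incl_le_iff, hι, hφ.le_iff]

section Product

variable {L : Type u} [Lattice L] [BoundedOrder L] [IsGeometric L]

/-- The product of two modular diagrams. -/
@[reducible] noncomputable def ModDiag.mul (Γ₁ Γ₂ : ModDiag L) : ModDiag L where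
  toModExt := Γ₁.toModExt.pushout Γ₂.toModExt
  word := Γ₁.word.map Pushout.inl ++ Γ₂.word.map Pushout.inr
  word_atom := by
    intro h hh
    rcases List.mem_append.1 hh with hh | hh
    · obtain ⟨x, hx, rfl⟩ := List.mem_map.1 hh
      exact Pushout.isAtom_inl (Γ₁.word_atom x hx)
    · obtain ⟨x, hx, rfl⟩ := List.mem_map.1 hh
      exact Pushout.isAtom_inr (Γ₂.word_atom x hx)

/-- The empty diagram on the trivial extension. -/
def ModDiag.one (L : Type u) [Lattice L] [BoundedOrder L] [IsGeometric L] : ModDiag L where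
  toModExt := ModExt.self L
  word := []
  word_atom := by simp

open MD

theorem cls_mul_comm (Γ₁ Γ₂ : ModDiag L) :
    cls (Γ₁.mul Γ₂) = (-1 : ℚ) ^ (Γ₁.word.length * Γ₂.word.length) • cls (Γ₂.mul Γ₁) := by
  have h := (Γ₁.mul Γ₂).word_atom
  have h' : ∀ x ∈ Γ₂.word.map (Pushout.inr : _ → Pushout Γ₁.toModExt Γ₂.toModExt) ++
      Γ₁.word.map Pushout.inl, IsAtom x := fun x hx =>
    h x (List.mem_append.2 (List.mem_append.1 hx).symm)
  have h1 := cls_append (Γ₁.toModExt.pushout Γ₂.toModExt)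
    (Γ₂.word.map Pushout.inr) (Γ₁.word.map Pushout.inl) h h'
  simp only [List.length_map] at h1
  refine h1.trans ?_
  congr 1
  refine cls_iso _ _ Pushout.swap (fun l => rfl) ?_
  simp only [ModDiag.mul, List.map_append, List.map_map]
  rfl

/-- Functoriality of the pushout in its first argument. -/
def Pushout.mapFst {E E' E₂ : ModExt L} (φ : E.carrier → E'.carrier)
    (hφ : IsEmbedding φ) (hι : ∀ l, E'.incl l = φ (E.incl l)) (p : Pushout E E₂) :
    Pushout E' E₂ :=
  ⟨(φ p.1.1, p.1.2), by
    rw [← p.2]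
    apply eq_of_forall_le_iff
    intro l
    rw [← E'.incl_le_iff, ← E.incl_le_iff, hι, hφ.le_iff]⟩

theorem Pushout.isEmbedding_mapFst {E E' E₂ : ModExt L} {φ : E.carrier → E'.carrier}
    (hφ : IsEmbedding φ) (hι : ∀ l, E'.incl l = φ (E.incl l)) :
    IsEmbedding (Pushout.mapFst (E₂ := E₂) φ hφ hι) where
  injective p q h := Pushout.ext
    (hφ.injective (congrArg (fun p : Pushout E' E₂ => p.1.1) h))
    (congrArg (fun p : Pushout E' E₂ => p.1.2) h)
  map_sup p q := by
    have hj : Pushout.joint (E₁ := E') (E₂ := E₂) (φ (p.1.1 ⊔ q.1.1)) (p.1.2 ⊔ q.1.2) =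
        Pushout.joint (p.1.1 ⊔ q.1.1) (p.1.2 ⊔ q.1.2) := by
      simp only [Pushout.joint, restr_of_embedding hφ hι]
    refine Pushout.ext ?_ ?_
    · show φ (_ ⊔ E.incl _) = φ p.1.1 ⊔ φ q.1.1 ⊔ E'.incl (Pushout.joint (φ p.1.1 ⊔ φ q.1.1) _)
      rw [← hφ.map_sup p.1.1, hφ.map_sup, hι]
      exact congrArg (fun l => φ (p.1.1 ⊔ q.1.1) ⊔ φ (E.incl l)) hj.symm
    · show _ ⊔ E₂.incl _ = _ ⊔ E₂.incl (Pushout.joint (φ p.1.1 ⊔ φ q.1.1) _)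
      rw [← hφ.map_sup p.1.1]
      exact congrArg (fun l => p.1.2 ⊔ q.1.2 ⊔ E₂.incl l) hj.symm
  map_atom a ha := by
    rcases Pushout.atom_cases ha with ⟨x, hx, rfl⟩ | ⟨x, hx, rfl⟩
    · have : Pushout.mapFst (E₂ := E₂) φ hφ hι (Pushout.inl x) = Pushout.inl (φ x) :=
        Pushout.ext rfl (by simp [Pushout.mapFst, Pushout.inl, restr_of_embedding hφ hι])
      rw [this]
      exact Pushout.isAtom_inl (hφ.map_atom x hx)
    · have : Pushout.mapFst (E₂ := E₂) φ hφ hι (Pushout.inr x) = Pushout.inr x :=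
        Pushout.ext (by simp [Pushout.mapFst, Pushout.inr, hι]) rfl
      rw [this]
      exact Pushout.isAtom_inr hx

theorem cls_mul_embed (Γ Γ' Γ₂ : ModDiag L) (φ : Γ.carrier → Γ'.carrier) (hφ : IsEmbedding φ)
    (hr : rk (⊤ : Γ.carrier) = rk (⊤ : Γ'.carrier)) (hι : ∀ l, Γ'.incl l = φ (Γ.incl l))
    (hJ : Γ'.word = Γ.word.map φ) : cls (Γ.mul Γ₂) = cls (Γ'.mul Γ₂) := by
  have hemb := Pushout.isEmbedding_mapFst (E₂ := Γ₂.toModExt) hφ hι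
  refine cls_embed (Γ.mul Γ₂) (Γ'.mul Γ₂) (Pushout.mapFst φ hφ hι) hemb ?_ ?_ ?_
  · refine hemb.rk_top ?_ ?_
    · refine Pushout.ext ?_ rfl
      show φ ⊥ = ⊥
      rw [← Γ.incl_bot, ← hι, Γ'.incl_bot]
    · exact Pushout.ext (hφ.map_top_of_rk hr) rfl
  · exact fun l => Pushout.ext (hι l) rfl
  · show Γ'.word.map Pushout.inl ++ _ = (Γ.word.map Pushout.inl ++ _).map _
    rw [List.map_append, List.map_map, List.map_map, hJ, List.map_map]
    congr 1
    · refine List.map_congr_left fun x _ => Pushout.ext rfl ?_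
      simp [Pushout.mapFst, Pushout.inl, restr_of_embedding hφ hι]
    · refine List.map_congr_left fun x _ => Pushout.ext ?_ rfl
      simp [Pushout.mapFst, Pushout.inr, hι]

theorem cls_mul_span (Γ Γ₂ : ModDiag L) (h : Γ.flat ⊔ listJoin Γ.word < ⊤) :
    cls (Γ.mul Γ₂) = 0 := by
  refine proj_rel (MDRel.span _ ?_)
  let t : Pushout Γ.toModExt Γ₂.toModExt := ⟨(Γ.flat ⊔ listJoin Γ.word, ⊤), by
    rw [Γ.restr_eq_top le_sup_left, ModExt.restr_top]⟩
  have ht : t < ⊤ := lt_top_iff_ne_top.2 fun e =>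
    h.ne (congrArg (fun p : Pushout Γ.toModExt Γ₂.toModExt => p.1.1) e)
  refine lt_of_le_of_lt (sup_le ?_ (listJoin_le ?_)) ht
  · exact ⟨le_sup_left, le_top⟩
  · intro x hx
    rcases List.mem_append.1 hx with hx | hx
    · obtain ⟨y, hy, rfl⟩ := List.mem_map.1 hx
      exact Pushout.inl_le.2 ((le_listJoin hy).trans le_sup_right)
    · obtain ⟨y, hy, rfl⟩ := List.mem_map.1 hx
      exact Pushout.inr_le.2 le_top

open Classical in
theorem cls_mul_two (Γ Γ₂ : ModDiag L) (F : Γ.carrier) (hF : IsModularFlat F) (hle : Γ.flat ≤ F)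
    (h : (Γ.word.filter fun x => ¬ x ≤ F).length = 2) : cls (Γ.mul Γ₂) = 0 := by
  let t : Pushout Γ.toModExt Γ₂.toModExt := ⟨(F, ⊤), by
    rw [Γ.restr_eq_top hle, ModExt.restr_top]⟩
  refine proj_rel (MDRel.two (Γ.mul Γ₂) t ?_ ⟨hle, le_top⟩ ?_)
  · intro A B hA
    have hA1 : A.1.1 ≤ F := hA.1
    have h1 : F ⊓ (A.1.1 ⊔ B.1.1) = A.1.1 ⊔ F ⊓ B.1.1 := hF _ _ hA1
    have hj : Pushout.joint (E₁ := Γ.toModExt) (E₂ := Γ₂.toModExt)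
        (A.1.1 ⊔ F ⊓ B.1.1) (A.1.2 ⊔ ⊤ ⊓ B.1.2) =
        Pushout.joint (A.1.1 ⊔ B.1.1) (A.1.2 ⊔ B.1.2) := by
      simp only [Pushout.joint]
      rw [← h1, ModExt.restr_inf, Γ.restr_eq_top hle, top_inf_eq, top_inf_eq]
    refine Pushout.ext ?_ ?_
    · show F ⊓ (A.1.1 ⊔ B.1.1 ⊔ Γ.incl _) = A.1.1 ⊔ F ⊓ B.1.1 ⊔
        Γ.incl (Pushout.joint (A.1.1 ⊔ F ⊓ B.1.1) (A.1.2 ⊔ ⊤ ⊓ B.1.2))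
      rw [hj, ← h1, sup_comm, hF _ _ ((Γ.incl_le_flat _).trans hle), sup_comm]
    · show ⊤ ⊓ (A.1.2 ⊔ B.1.2 ⊔ Γ₂.incl _) = A.1.2 ⊔ ⊤ ⊓ B.1.2 ⊔
        Γ₂.incl (Pushout.joint (A.1.1 ⊔ F ⊓ B.1.1) (A.1.2 ⊔ ⊤ ⊓ B.1.2))
      rw [hj, top_inf_eq, top_inf_eq]
  · rw [← h]
    show (List.filter _ (Γ.word.map Pushout.inl ++ Γ₂.word.map Pushout.inr)).length = _
    rw [List.filter_append, List.length_append, List.filter_map, List.filter_map,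
      List.length_map, List.length_map]
    have h2 : List.filter ((fun x => decide (¬ x ≤ t)) ∘ Pushout.inr) Γ₂.word = [] := by
      rw [List.filter_eq_nil_iff]
      intro x _
      simp only [Function.comp, decide_not, Bool.not_eq_true', decide_eq_false_iff_not, not_not]
      exact Pushout.inr_le.2 le_top
    rw [h2, List.length_nil, add_zero]
    congr 2
    funext x
    simp only [Function.comp, Pushout.inl_le]
    rfl

theorem cls_mul_prod (Γ Γ₂ : ModDiag L) (A B : Type u) [PartialOrder A] [PartialOrder B]
    [OrderBot B] [Nontrivial A] [Nontrivial B] (e : Γ.carrier ≃o A × B) (h : (e Γ.flat).2 = ⊥) :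
    cls (Γ.mul Γ₂) = 0 := by
  have key : ∀ x : Γ.carrier, Γ.restr (e.symm ((e x).1, ⊥)) = Γ.restr x := by
    intro x
    apply eq_of_forall_le_iff
    intro l
    rw [← Γ.incl_le_iff, ← Γ.incl_le_iff, ← e.le_iff_le, e.apply_symm_apply, ← e.le_iff_le (x := Γ.incl l) (y := x),
      Prod.le_def, Prod.le_def]
    have : (e (Γ.incl l)).2 = ⊥ :=
      le_bot_iff.1 ((e.le_iff_le.2 (Γ.incl_le_flat l)).2.trans_eq h)
    simp [this]
  let A' : Type u := {p : A × Γ₂.carrier // Γ.restr (e.symm (p.1, ⊥)) = Γ₂.restr p.2}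
  let e' : (Γ.mul Γ₂).carrier ≃o A' × B :=
    { toFun := fun p => (⟨((e p.1.1).1, p.1.2), (key _).trans p.2⟩, (e p.1.1).2)
      invFun := fun q => ⟨(e.symm (q.1.1.1, q.2), q.1.1.2), by
        have := key (e.symm (q.1.1.1, q.2))
        rw [e.apply_symm_apply] at this
        exact this.symm.trans q.1.2⟩
      left_inv := fun p => Pushout.ext (e.symm_apply_apply _) rfl
      right_inv := fun q => by
        refine Prod.ext (Subtype.ext (Prod.ext ?_ rfl)) ?_
        · exact (congrArg Prod.fst (e.apply_symm_apply (q.1.1.1, q.2)) :)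
        · exact (congrArg Prod.snd (e.apply_symm_apply (q.1.1.1, q.2)) :)
      map_rel_iff' := by
        intro p q
        show (((e p.1.1).1 ≤ (e q.1.1).1 ∧ p.1.2 ≤ q.1.2) ∧ (e p.1.1).2 ≤ (e q.1.1).2) ↔
          p.1.1 ≤ q.1.1 ∧ p.1.2 ≤ q.1.2
        rw [← e.le_iff_le (x := p.1.1), Prod.le_def]
        tauto }
  have hA' : Nontrivial A' := by
    have hle : (e ⊥).2 = ⊥ := le_bot_iff.1 ((e.le_iff_le.2 (bot_le : ⊥ ≤ Γ.flat)).2.trans_eq h)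
    obtain ⟨a, ha⟩ := exists_ne ((e ⊥).1)
    refine ⟨⟨((e ⊥).1, ⊥), ?_⟩, ⟨(a, Γ₂.incl (Γ.restr (e.symm (a, ⊥)))), ?_⟩, ?_⟩
    · rw [key, ModExt.restr_bot, ModExt.restr_bot]
    · rw [ModExt.restr_incl]
    · intro hh
      exact ha (congrArg (fun p : A' => p.1.1) hh).symm
  exact proj_rel (MDRel.prod (Γ.mul Γ₂) A' B e' h)

theorem cls_mul_swap (E : ModExt L) (J₁ J₂ : List E.carrier) (a b : E.carrier)
    (h : ∀ x ∈ J₁ ++ a :: b :: J₂, IsAtom x) (h' : ∀ x ∈ J₁ ++ b :: a :: J₂, IsAtom x)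
    (Γ₂ : ModDiag L) :
    cls (ModDiag.mul ⟨E, J₁ ++ a :: b :: J₂, h⟩ Γ₂) +
      cls (ModDiag.mul ⟨E, J₁ ++ b :: a :: J₂, h'⟩ Γ₂) = 0 := by
  have h1 := (ModDiag.mul ⟨E, J₁ ++ a :: b :: J₂, h⟩ Γ₂).word_atom
  have h2 := (ModDiag.mul ⟨E, J₁ ++ b :: a :: J₂, h'⟩ Γ₂).word_atom
  simp only [ModDiag.mul, List.map_append, List.map_cons, List.append_assoc,
    List.cons_append] at h1 h2
  have := cls_swap (E.pushout Γ₂.toModExt) (J₁.map Pushout.inl)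
    (J₂.map Pushout.inl ++ Γ₂.word.map Pushout.inr) (Pushout.inl a) (Pushout.inl b) h1 h2
  simp only [ModDiag.mul, List.map_append, List.map_cons, List.append_assoc, List.cons_append]
  rw [this, neg_add_cancel]

theorem mul_rel_left (Γ₂ : ModDiag L) (v : ModDiag L →₀ ℚ) (hv : MDRel v) :
    Finsupp.linearCombination ℚ (fun Γ => cls (Γ.mul Γ₂)) v = 0 := by
  cases hv with
  | swap E J₁ J₂ a b h h' =>
    simpa using cls_mul_swap E J₁ J₂ a b h h' Γ₂
  | embed Γ Γ' φ hφ hr hι hJ =>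
    simpa [sub_eq_zero] using cls_mul_embed Γ Γ' Γ₂ φ hφ hr hι hJ
  | span Γ h => simpa using cls_mul_span Γ Γ₂ h
  | prod Γ A B e h => simpa using cls_mul_prod Γ Γ₂ A B e h
  | two Γ F hF hle h => simpa using cls_mul_two Γ Γ₂ F hF hle h

theorem mul_rel_right (Γ₁ : ModDiag L) (v : ModDiag L →₀ ℚ) (hv : MDRel v) :
    Finsupp.linearCombination ℚ (fun Γ => cls (Γ₁.mul Γ)) v = 0 := by
  cases hv with
  | swap E J₁ J₂ a b h h' =>
    have := cls_mul_swap E J₁ J₂ a b h h' Γ₁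
    simp only [map_add, Finsupp.linearCombination_single, one_smul]
    rw [cls_mul_comm Γ₁, cls_mul_comm Γ₁]
    simp only [List.length_append, List.length_cons]
    rw [← smul_add, this, smul_zero]
  | embed Γ Γ' φ hφ hr hι hJ =>
    have h1 := cls_mul_embed Γ Γ' Γ₁ φ hφ hr hι hJ
    have h2 : Γ'.word.length = Γ.word.length := by rw [hJ, List.length_map]
    simp only [map_sub, Finsupp.linearCombination_single, one_smul]
    rw [cls_mul_comm Γ₁, cls_mul_comm Γ₁, h1, h2, sub_self]
  | span Γ h =>
    simp only [Finsupp.linearCombination_single, one_smul]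
    rw [cls_mul_comm Γ₁, cls_mul_span Γ Γ₁ h, smul_zero]
  | prod Γ A B e h =>
    simp only [Finsupp.linearCombination_single, one_smul]
    rw [cls_mul_comm Γ₁, cls_mul_prod Γ Γ₁ A B e h, smul_zero]
  | two Γ F hF hle h =>
    simp only [Finsupp.linearCombination_single, one_smul]
    rw [cls_mul_comm Γ₁, cls_mul_two Γ Γ₁ F hF hle h, smul_zero]

/-- The product of `MD L`, as a bilinear map. -/
noncomputable def MD.mulHom : MD L →ₗ[ℚ] MD L →ₗ[ℚ] MD L :=
  MD.lift (fun Γ₁ => MD.lift (fun Γ₂ => cls (Γ₁.mul Γ₂)) (mul_rel_right Γ₁)) (by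
    intro v hv
    apply MD.hom_ext
    intro Γ₂
    rw [LinearMap.zero_apply, ← mul_rel_left Γ₂ v hv, Finsupp.linearCombination_apply,
      Finsupp.linearCombination_apply, Finsupp.sum, Finsupp.sum, LinearMap.sum_apply]
    refine Finset.sum_congr rfl fun Γ _ => ?_
    rw [LinearMap.smul_apply, MD.lift_cls])

theorem MD.mulHom_cls (Γ₁ Γ₂ : ModDiag L) : MD.mulHom (cls Γ₁) (cls Γ₂) = cls (Γ₁.mul Γ₂) := by
  rw [MD.mulHom, MD.lift_cls, MD.lift_cls]

theorem cls_mul_assoc (Γ₁ Γ₂ Γ₃ : ModDiag L) :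
    cls ((Γ₁.mul Γ₂).mul Γ₃) = cls (Γ₁.mul (Γ₂.mul Γ₃)) := by
  have hr : ∀ (Γ Γ' : ModDiag L) (p : Pushout Γ.toModExt Γ'.toModExt),
      (Γ.mul Γ').restr p = Γ.restr p.1.1 := by
    intro Γ Γ' p
    apply eq_of_forall_le_iff
    intro l
    rw [← ModExt.incl_le_iff]
    exact Pushout.base_le
  let e : ((Γ₁.mul Γ₂).mul Γ₃).carrier ≃o (Γ₁.mul (Γ₂.mul Γ₃)).carrier :=
    { toFun := fun p => ⟨(p.1.1.1.1, ⟨(p.1.1.1.2, p.1.2),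
          (p.1.1.2.symm.trans (hr Γ₁ Γ₂ p.1.1).symm).trans p.2⟩),
        p.1.1.2.trans (hr Γ₂ Γ₃ ⟨(p.1.1.1.2, p.1.2),
          (p.1.1.2.symm.trans (hr Γ₁ Γ₂ p.1.1).symm).trans p.2⟩).symm⟩
      invFun := fun p => ⟨(⟨(p.1.1, p.1.2.1.1), p.2.trans (hr Γ₂ Γ₃ p.1.2)⟩, p.1.2.1.2),
        ((hr Γ₁ Γ₂ ⟨(p.1.1, p.1.2.1.1), p.2.trans (hr Γ₂ Γ₃ p.1.2)⟩).trans
          (p.2.trans (hr Γ₂ Γ₃ p.1.2))).trans p.1.2.2⟩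
      left_inv := fun p => rfl
      right_inv := fun p => rfl
      map_rel_iff' := by
        intro p q
        show (p.1.1.1.1 ≤ q.1.1.1.1 ∧ (p.1.1.1.2 ≤ q.1.1.1.2 ∧ p.1.2 ≤ q.1.2)) ↔
          ((p.1.1.1.1 ≤ q.1.1.1.1 ∧ p.1.1.1.2 ≤ q.1.1.1.2) ∧ p.1.2 ≤ q.1.2)
        tauto }
  refine cls_iso _ _ e (fun l => rfl) ?_
  show Γ₁.word.map Pushout.inl ++ (Γ₂.word.map Pushout.inl ++ Γ₃.word.map Pushout.inr).map
    Pushout.inr = ((Γ₁.word.map Pushout.inl ++ Γ₂.word.map Pushout.inr).map Pushout.inl ++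
      Γ₃.word.map Pushout.inr).map e
  simp only [List.map_append, List.map_map, List.append_assoc]
  congr 1
  · refine List.map_congr_left fun x _ => Pushout.ext rfl (Pushout.ext rfl ?_)
    exact congrArg Γ₃.incl (hr Γ₁ Γ₂ (Pushout.inl x)).symm
  congr 1
  · refine List.map_congr_left fun x _ => Pushout.ext ?_ (Pushout.ext rfl ?_)
    · exact congrArg Γ₁.incl (hr Γ₂ Γ₃ (Pushout.inl x))
    · refine congrArg Γ₃.incl (Eq.symm ?_)
      refine (hr Γ₁ Γ₂ (Pushout.inr x)).trans ?_
      exact Γ₁.restr_incl _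
  · refine List.map_congr_left fun x _ => Pushout.ext ?_ (Pushout.ext rfl rfl)
    refine congrArg Γ₁.incl ((hr Γ₂ Γ₃ (Pushout.inr x)).trans ?_)
    exact Γ₂.restr_incl _

theorem self_restr (l : L) : (ModExt.self L).restr l = l := (ModExt.self L).restr_incl l

theorem cls_one_mul (Γ : ModDiag L) : cls ((ModDiag.one L).mul Γ) = cls Γ := by
  let e : Γ.carrier ≃o ((ModDiag.one L).mul Γ).carrier :=
    { toFun := fun x => Pushout.inr x
      invFun := fun p => p.1.2
      left_inv := fun _ => rfl
      right_inv := fun p => Pushout.ext (p.2.symm.trans (self_restr _)) rfl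
      map_rel_iff' := by
        intro x y
        exact Pushout.inr_le }
  refine (cls_iso _ _ e (fun l => ?_) rfl).symm
  exact Pushout.base_eq_inr l

theorem cls_mul_one (Γ : ModDiag L) : cls (Γ.mul (ModDiag.one L)) = cls Γ := by
  rw [cls_mul_comm, cls_one_mul]
  simp [ModDiag.one]

namespace MD

theorem mulHom_assoc (x y z : MD L) : mulHom (mulHom x y) z = mulHom x (mulHom y z) := by
  induction x using ind with
  | h0 => simp
  | hadd x x' hx hx' => simp only [map_add, LinearMap.add_apply, hx, hx']
  | hc c Γ₁ =>
  induction y using ind with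
  | h0 => simp
  | hadd x x' hx hx' => simp only [map_add, LinearMap.add_apply, hx, hx']
  | hc c' Γ₂ =>
  induction z using ind with
  | h0 => simp
  | hadd x x' hx hx' => simp only [map_add, hx, hx']
  | hc c'' Γ₃ => simp only [map_smul, LinearMap.smul_apply, mulHom_cls, cls_mul_assoc]

theorem one_mulHom (x : MD L) : mulHom (cls (ModDiag.one L)) x = x := by
  induction x using ind with
  | h0 => simp
  | hadd x x' hx hx' => simp only [map_add, hx, hx']
  | hc c Γ => simp only [map_smul, mulHom_cls, cls_one_mul]

theorem mulHom_one (x : MD L) : mulHom x (cls (ModDiag.one L)) = x := by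
  induction x using ind with
  | h0 => simp
  | hadd x x' hx hx' => simp only [map_add, LinearMap.add_apply, hx, hx']
  | hc c Γ => simp only [map_smul, LinearMap.smul_apply, mulHom_cls, cls_mul_one]

noncomputable instance : Ring (MD L) where
  toAddCommGroup := inferInstance
  mul x y := mulHom x y
  one := cls (ModDiag.one L)
  left_distrib x y z := map_add (mulHom x) y z
  right_distrib x y z := by
    show mulHom (x + y) z = mulHom x z + mulHom y z
    rw [map_add, LinearMap.add_apply]
  zero_mul x := by
    show mulHom 0 x = 0
    rw [map_zero, LinearMap.zero_apply]
  mul_zero x := map_zero (mulHom x)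
  mul_assoc := mulHom_assoc
  one_mul := one_mulHom
  mul_one := mulHom_one

noncomputable instance : Algebra ℚ (MD L) :=
  Algebra.ofModule
    (fun c x y => by
      show mulHom (c • x) y = c • mulHom x y
      rw [map_smul, LinearMap.smul_apply])
    (fun c x y => map_smul (mulHom x) c y)

theorem cls_mul_cls (Γ₁ Γ₂ : ModDiag L) : cls Γ₁ * cls Γ₂ = cls (Γ₁.mul Γ₂) := mulHom_cls Γ₁ Γ₂

theorem one_def : (1 : MD L) = cls (ModDiag.one L) := rfl

end MD

end Product

/-- The defining relations of a free graded commutative algebra. -/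
inductive GCRel {X : Type w} (deg : X → ℤ) : FreeAlgebra ℚ X → FreeAlgebra ℚ X → Prop
  | comm (x y : X) : GCRel deg (FreeAlgebra.ι ℚ x * FreeAlgebra.ι ℚ y)
      (((deg x * deg y).negOnePow : ℤ) • (FreeAlgebra.ι ℚ y * FreeAlgebra.ι ℚ x))

/-- The free graded commutative `ℚ`-algebra on generators `x : X` of degree `deg x`: the quotient of
the free algebra by `x y = (-1) ^ (deg x * deg y) y x` (so that `x ^ 2 = 0` for `x` odd). -/
def FreeGradedComm {X : Type w} (deg : X → ℤ) : Type w := RingQuot (GCRel deg)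

namespace FreeGradedComm

variable {X : Type w} (deg : X → ℤ)

noncomputable instance : Ring (FreeGradedComm deg) :=
  inferInstanceAs (Ring (RingQuot (GCRel deg)))

noncomputable instance : Algebra ℚ (FreeGradedComm deg) :=
  inferInstanceAs (Algebra ℚ (RingQuot (GCRel deg)))

/-- The generators. -/
noncomputable def gen (x : X) : FreeGradedComm deg :=
  RingQuot.mkAlgHom ℚ (GCRel deg) (FreeAlgebra.ι ℚ x)

/-- The homogeneous part of degree `n`, spanned by the monomials of degree `n`. -/
noncomputable def homogeneous (n : ℤ) : Submodule ℚ (FreeGradedComm deg) :=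
  Submodule.span ℚ {m | ∃ w : List X, (w.map deg).sum = n ∧ (w.map (gen deg)).prod = m}

end FreeGradedComm

/-- The modular diagrams whose classes generate `MD L`: a single atom of `L`, or an irreducible
modular extension together with a word that has no letter in `L` and in which every atom outside `L`
occurs. -/
def ModDiag.IsGenerator {L : Type u} [Lattice L] [BoundedOrder L] [IsGeometric L]
    (Γ : ModDiag L) : Prop :=
  (Γ.toModExt.IsTrivial ∧ Γ.word.length = 1) ∨
    (Γ.toModExt.IsIrreducible ∧ (∀ h ∈ Γ.word, ¬ h ≤ Γ.flat) ∧
      ∀ h : Γ.carrier, IsAtom h → h ≤ Γ.flat ∨ h ∈ Γ.word)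

/-- A set of representatives, up to sign, of the non-zero classes of generators. -/
structure IsGeneratorSystem {L : Type u} [Lattice L] [BoundedOrder L] [IsGeometric L]
    (X : Set (ModDiag L)) : Prop where
  isGenerator : ∀ Γ ∈ X, Γ.IsGenerator
  ne_zero : ∀ Γ ∈ X, MD.cls Γ ≠ 0
  existsUnique : ∀ Γ : ModDiag L, Γ.IsGenerator → MD.cls Γ ≠ 0 →
    ∃! Γ' : ModDiag L, Γ' ∈ X ∧ (MD.cls Γ = MD.cls Γ' ∨ MD.cls Γ = - MD.cls Γ')

end GeomLattice

open GeomLattice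

/-! Let A be the free graded commutative algebra on X. The degree of a diagram has the parity of its
word length, and exchanging two blocks of letters costs (-1)^(product of their lengths). Hence the
classes of the elements of X satisfy the relations of A, which gives an algebra map `ofFree` from A
to MD(L).

Surjectivity, degree by degree, is a reduction on the size of a diagram
(`IsGeneratorSystem.cls_mem`). A diagram with non-zero class spans, so relation (2) allows passing
to the lattice generated by L and the letters; afterwards every atom outside L is a letter (the
diagram is reduced). A letter in L splits off as a factor on the trivial extension. Every atom of a
pushout comes from one of the two sides, so a diagram on a pushout is a product up to sign. Only
generators and the unit remain.

Injectivity comes from a linear left inverse `IsGeneratorSystem.toFree`. A diagram Γ without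
repeated letters is sent to plus or minus a monomial if the product of the factors of that monomial
embeds in Γ with the same rank and the same word up to permutation (`Match`), and to 0 if there is
no such monomial.

This is well defined because the matching product, being reduced, is exactly what L and the letters
of Γ generate, hence unique up to isomorphism, and because factorizations are unique. Indeed,
pushout decompositions are described inside E by pairs (G, H) (`ModExt.IsSplit`) and restrict to
lower intervals. So an irreducible interval lies on one side of any splitting, and two irreducible
factors with a common element outside L coincide (`ModExt.IsSplit.eq_of_common`). The letters of an
irreducible generator are then forced, and `FreeGradedComm.exists_sign` compares the signs.

It respects the relations: (1) and (2) are built into matching, and no diagram killed by (3), (4) or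
(5) is matched. A matched diagram spans; if (4) or (5) applied to it, then one of the factors would
be a product, or have exactly two letters outside a modular element, or have an atom as direct
factor, so its class would vanish (`Match.not_prod`, `Match.not_two`).

The same uniqueness argument, applied with empty words, gives unique factorization of modular
extensions; existence is an induction on cardinality. -/

namespace GeomLattice

/-! ### Signs of permutations of words -/

/-- Signed permutations of words: `SPerm ε l l'` says that `l'` arises from `l` by a sequence of
exchanges of consecutive letters, whose number has the parity given by `ε`. -/
inductive SPerm {α : Type u} : ℤˣ → List α → List α → Prop
  | nil : SPerm 1 [] []
  | cons (a : α) {ε : ℤˣ} {l l' : List α} : SPerm ε l l' → SPerm ε (a :: l) (a :: l')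
  | swap (a b : α) (l : List α) : SPerm (-1) (a :: b :: l) (b :: a :: l)
  | trans {ε ε' : ℤˣ} {l₁ l₂ l₃ : List α} :
      SPerm ε l₁ l₂ → SPerm ε' l₂ l₃ → SPerm (ε * ε') l₁ l₃

namespace SPerm

variable {α : Type u} {β : Type v} {ε ε' : ℤˣ} {l l' l₁ l₂ l₃ : List α}

theorem refl : ∀ l : List α, SPerm 1 l l
  | [] => .nil
  | a :: l => .cons a (refl l)

theorem of_eq (h : l = l') : SPerm 1 l l' := h ▸ refl l

theorem symm (h : SPerm ε l l') : SPerm ε l' l := by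
  induction h with
  | nil => exact .nil
  | cons a _ ih => exact .cons a ih
  | swap a b l => exact .swap b a l
  | trans _ _ ih₁ ih₂ => rw [mul_comm]; exact ih₂.trans ih₁

theorem perm (h : SPerm ε l l') : l.Perm l' := by
  induction h with
  | nil => exact .nil
  | cons a _ ih => exact ih.cons a
  | swap a b l => exact .swap b a l
  | trans _ _ ih₁ ih₂ => exact ih₁.trans ih₂

theorem exists_of_perm (h : l.Perm l') : ∃ ε, SPerm ε l l' := by
  induction h with
  | nil => exact ⟨1, .nil⟩
  | cons a _ ih => exact ih.imp fun _ h => h.cons a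
  | swap a b l => exact ⟨-1, .swap b a l⟩
  | trans _ _ ih₁ ih₂ =>
    obtain ⟨ε, h⟩ := ih₁
    obtain ⟨ε', h'⟩ := ih₂
    exact ⟨_, h.trans h'⟩

theorem append_left (l₀ : List α) (h : SPerm ε l l') : SPerm ε (l₀ ++ l) (l₀ ++ l') := by
  induction l₀ with
  | nil => exact h
  | cons a l₀ ih => exact ih.cons a

theorem append_right (l₀ : List α) (h : SPerm ε l l') : SPerm ε (l ++ l₀) (l' ++ l₀) := by
  induction h with
  | nil => exact refl _
  | cons a _ ih => exact ih.cons a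
  | swap a b l => exact .swap a b _
  | trans _ _ ih₁ ih₂ => exact ih₁.trans ih₂

theorem map (f : α → β) (h : SPerm ε l l') : SPerm ε (l.map f) (l'.map f) := by
  induction h with
  | nil => exact .nil
  | cons a _ ih => exact ih.cons _
  | swap a b l => exact .swap _ _ _
  | trans _ _ ih₁ ih₂ => exact ih₁.trans ih₂

/-- Exchanges act on positions, not on letters, so each one performed on the image word can be
performed on the original word. -/
theorem exists_map {f : α → β} {m m' : List β} (h : SPerm ε m m') :
    ∀ l : List α, m = l.map f → ∃ l', m' = l'.map f ∧ SPerm ε l l' := by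
  induction h with
  | nil =>
    intro l hl
    have : l = [] := by simpa using hl.symm
    exact ⟨[], rfl, this ▸ .nil⟩
  | cons a _ ih =>
    intro l hl
    obtain ⟨b, l, rfl, rfl, rfl⟩ := List.map_eq_cons_iff.1 hl.symm
    obtain ⟨l', rfl, hl'⟩ := ih l rfl
    exact ⟨b :: l', rfl, hl'.cons b⟩
  | swap a b m =>
    intro l hl
    obtain ⟨a, l, rfl, rfl, h⟩ := List.map_eq_cons_iff.1 hl.symm
    obtain ⟨b, l, rfl, rfl, rfl⟩ := List.map_eq_cons_iff.1 h
    exact ⟨b :: a :: l, rfl, .swap _ _ _⟩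
  | trans _ _ ih₁ ih₂ =>
    intro l hl
    obtain ⟨l₂, h₂, h⟩ := ih₁ l hl
    obtain ⟨l₃, h₃, h'⟩ := ih₂ l₂ h₂
    exact ⟨l₃, h₃, h.trans h'⟩

theorem of_map {f : α → β} (hf : Function.Injective f) (h : SPerm ε (l.map f) (l'.map f)) :
    SPerm ε l l' := by
  obtain ⟨l₂, h₂, h⟩ := h.exists_map l rfl
  rw [List.map_injective_iff.2 hf h₂]
  exact h

theorem cons_move (a : α) : ∀ l : List α, SPerm ((-1) ^ l.length) (a :: l) (l ++ [a])
  | [] => refl _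
  | b :: l => by
    rw [List.length_cons, pow_succ']
    exact (SPerm.swap a b l).trans ((cons_move a l).cons b)

theorem append_comm (l' : List α) :
    ∀ l : List α, SPerm ((-1) ^ (l.length * l'.length)) (l ++ l') (l' ++ l)
  | [] => by simpa using refl l'
  | a :: l => by
    have h := ((append_comm l' l).cons a).trans ((cons_move a l').append_right l)
    rw [← pow_add] at h
    simpa [add_mul] using h

open Classical in
/-- The sign of a word of natural numbers, by inversions. -/
noncomputable def wordSign (f : α → ℕ) : List α → ℤˣ
  | [] => 1
  | a :: l => (-1) ^ (l.filter fun b => f b < f a).length * wordSign f l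

/-- Exchanging two distinct neighbours creates or removes exactly one inversion, and the inversions
with a fixed first letter depend only on the multiset of the remaining letters. Equal neighbours
would break the count, hence the assumption on repetitions. -/
theorem wordSign_eq (f : α → ℕ) (hf : Function.Injective f) (h : SPerm ε l l') (hl : l.Nodup) :
    wordSign f l' = ε * wordSign f l := by
  induction h with
  | nil => simp
  | @cons a ε l l' h ih =>
    rw [wordSign, wordSign, ih (List.nodup_cons.1 hl).2, (h.perm.filter _).length_eq]
    exact mul_left_comm _ _ _
  | swap a b l =>
    have hab : a ≠ b := fun h => by simp [h] at hl
    simp only [wordSign]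
    rcases lt_or_gt_of_ne (hf.ne hab) with h | h
    · rw [List.filter_cons_of_pos (by simpa using h), List.filter_cons_of_neg (by simpa using h.le),
        List.length_cons, pow_succ]
      simp only [mul_neg, mul_one, neg_mul, one_mul, neg_inj]
      exact mul_left_comm _ _ _
    · rw [List.filter_cons_of_neg (by simpa using h.le), List.filter_cons_of_pos (by simpa using h),
        List.length_cons, pow_succ]
      simp only [mul_neg, mul_one, neg_mul, one_mul, neg_neg]
      exact mul_left_comm _ _ _
  | trans h _ ih₁ ih₂ =>
    rw [ih₂ (h.perm.nodup_iff.1 hl), ih₁ hl]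
    exact (mul_left_comm _ _ _).trans (mul_assoc _ _ _).symm

/-- The sign of a signed permutation of a word without repetitions is determined. -/
theorem sign_unique [Finite α] (hl : l.Nodup) (h : SPerm ε l l') (h' : SPerm ε' l l') : ε = ε' := by
  obtain ⟨n, ⟨e⟩⟩ := Finite.exists_equiv_fin α
  have hf : Function.Injective fun x => (e x : ℕ) := Fin.val_injective.comp e.injective
  exact mul_right_cancel ((wordSign_eq _ hf h hl).symm.trans (wordSign_eq _ hf h' hl))

end SPerm

/-! ### Ranks, modular elements and lower intervals -/

section Order

variable {α : Type u} {β : Type v}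

/-- In a finite atomistic lattice every element is obtained from the bottom by joining atoms. -/
theorem atom_induction [Lattice α] [BoundedOrder α] [Finite α] [IsAtomistic α] {p : α → Prop}
    (h0 : p ⊥) (hs : ∀ x a, IsAtom a → p x → p (x ⊔ a)) (x : α) : p x := by
  obtain ⟨y, ⟨hy, hpy⟩, hmax⟩ := (Set.toFinite {y | y ≤ x ∧ p y}).exists_maximal ⟨⊥, bot_le, h0⟩
  by_cases h : x ≤ y
  · exact le_antisymm hy h ▸ hpy
  · rw [le_iff_atom_le_imp] at h
    push Not at h
    obtain ⟨a, ha, hax, hay⟩ := h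
    exact absurd (le_sup_right.trans (hmax ⟨sup_le hy hax, hs y a ha hpy⟩ le_sup_left)) hay

theorem rk_add_of_sat [Lattice α] [BoundedOrder α] [IsGeometric α] {n : ℕ} {x y : α}
    (h : Sat n x y) : rk y = rk x + n := by
  induction h with
  | nil => rfl
  | cons hx _ ih => rw [ih, IsGeometric.rk_covBy _ _ hx, add_right_comm, add_assoc]

theorem Sat.append [PartialOrder α] {m n : ℕ} {x y z : α} (h : Sat m x y) (h' : Sat n y z) :
    Sat (m + n) x z := by
  induction h with
  | nil => rwa [zero_add]
  | cons hx _ ih => rw [add_right_comm]; exact .cons hx (ih h')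

/-- A modular element satisfies the rank identity of modular pairs. -/
theorem IsModularFlat.rk_eq [Lattice α] [BoundedOrder α] [IsGeometric α] {F : α}
    (hF : IsModularFlat F) (x : α) : rk (x ⊔ F) + rk (x ⊓ F) = rk x + rk F := by
  have := IsGeometric.finite (α := α)
  have := IsGeometric.atomistic (α := α)
  have key : ∀ (n : ℕ) (y : α), y ≤ F → Sat n (x ⊓ F) y → Sat n x (x ⊔ y) := by
    intro n
    induction n with
    | zero =>
      intro y _ h
      cases h
      rw [sup_eq_left.2 inf_le_left]
      exact .nil _
    | succ n ih =>
      intro y hy h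
      -- `Sat` grows at its lower end, whereas the induction needs the last covering step.
      obtain ⟨z, hz, hzy⟩ : ∃ z, Sat n (x ⊓ F) z ∧ z ⋖ y := by
        clear ih hy
        generalize x ⊓ F = t at h
        induction n generalizing t with
        | zero =>
          cases h with
          | cons h1 h2 => cases h2; exact ⟨_, .nil _, h1⟩
        | succ n ih =>
          cases h with
          | cons h1 h2 =>
            obtain ⟨z, hz, hzy⟩ := ih _ h2
            exact ⟨z, .cons h1 hz, hzy⟩
      refine (ih z (hzy.le.trans hy) hz).snoc ?_
      have : ¬ y ≤ z := hzy.lt.not_ge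
      rw [le_iff_atom_le_imp] at this
      push Not at this
      obtain ⟨a, ha, hay, haz⟩ := this
      have e : z ⊔ a = y := by
        rcases hzy.eq_or_eq (c := z ⊔ a) le_sup_left (sup_le hzy.le hay) with h' | h'
        · exact absurd (le_sup_right.trans_eq h') haz
        · exact h'
      rw [← e, ← sup_assoc]
      refine covBy_sup_atom ha fun h' => haz ?_
      -- Modularity gives F ∧ (z ∨ x) = z ∨ (F ∧ x) = z, so the new atom a is not already below x ∨
      -- z.
      have h1 := hF z x (hzy.le.trans hy)
      have h2 : a ≤ F ⊓ (z ⊔ x) := le_inf (hay.trans hy) (h'.trans (sup_comm _ _).le)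
      rw [h1, inf_comm, sup_eq_left.2 hz.le] at h2
      exact h2
  obtain ⟨n, hn⟩ := Sat.exists_of_le (inf_le_right : x ⊓ F ≤ F)
  have h1 := rk_add_of_sat hn
  have h2 := rk_add_of_sat (key n F le_rfl hn)
  omega

theorem isAtom_Iic_iff [Lattice α] [BoundedOrder α] {G : α} (a : Set.Iic G) :
    IsAtom a ↔ IsAtom a.1 := by
  constructor
  · intro h
    refine ⟨fun e => h.1 (Subtype.ext e), fun b hb => ?_⟩
    exact congrArg Subtype.val (h.2 ⟨b, hb.le.trans a.2⟩ hb)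
  · intro h
    exact ⟨fun e => h.1 (congrArg Subtype.val e), fun b hb => Subtype.ext (h.2 b.1 hb)⟩

instance [Lattice α] [BoundedOrder α] [IsGeometric α] (G : α) : IsGeometric (Set.Iic G) := by
  have := IsGeometric.finite (α := α)
  have := IsGeometric.atomistic (α := α)
  have : IsAtomistic (Set.Iic G) := by
    refine ⟨fun p => ⟨{a | IsAtom a ∧ a ≤ p}, ⟨fun a ha => ha.2, fun r hr => ?_⟩, fun a ha => ha.1⟩⟩
    show p.1 ≤ r.1
    rw [le_iff_atom_le_imp]
    intro c hc hcp
    exact hr (a := ⟨c, hcp.trans p.2⟩) ⟨(isAtom_Iic_iff _).2 hc, hcp⟩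
  apply isGeometric_of_covering
  intro x h hh hx
  have := covBy_sup_atom ((isAtom_Iic_iff h).1 hh) hx
  exact ⟨this.lt, fun c h1 h2 => this.2 (c := c.1) h1 h2⟩

theorem listJoin_le_iff [Lattice α] [BoundedOrder α] {J : List α} {y : α} :
    listJoin J ≤ y ↔ ∀ x ∈ J, x ≤ y :=
  ⟨fun h _ hx => (le_listJoin hx).trans h, listJoin_le⟩

theorem listJoin_perm [Lattice α] [BoundedOrder α] {J J' : List α} (h : J.Perm J') :
    listJoin J = listJoin J' :=
  eq_of_forall_ge_iff fun c => by simp [listJoin_le_iff, h.mem_iff]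

theorem IsEmbedding.comp {γ : Type w} [Lattice α] [BoundedOrder α] [Lattice β] [BoundedOrder β]
    [Lattice γ] [BoundedOrder γ] {ψ : β → γ} {φ : α → β} (hψ : IsEmbedding ψ)
    (hφ : IsEmbedding φ) : IsEmbedding (ψ ∘ φ) :=
  ⟨hψ.injective.comp hφ.injective, fun a b => by simp [hφ.map_sup, hψ.map_sup],
    fun a ha => hψ.map_atom _ (hφ.map_atom a ha)⟩

theorem IsEmbedding.map_listJoin [Lattice α] [BoundedOrder α] [Lattice β] [BoundedOrder β]
    {φ : α → β} (hφ : IsEmbedding φ) (h0 : φ ⊥ = ⊥) (J : List α) :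
    φ (listJoin J) = listJoin (J.map φ) := by
  induction J with
  | nil => exact h0
  | cons a J ih =>
    show φ (a ⊔ listJoin J) = φ a ⊔ listJoin (J.map φ)
    rw [hφ.map_sup, ih]

/-- Embeddings need not preserve meets. Here the range is a lower set, so the meet of two images has
a preimage. -/
theorem IsEmbedding.map_inf_of_range [Lattice α] [BoundedOrder α] [Lattice β] [BoundedOrder β]
    {φ : α → β} (hφ : IsEmbedding φ) {G : β} (hr : Set.range φ = Set.Iic G) (x y : α) :
    φ (x ⊓ y) = φ x ⊓ φ y := by
  apply le_antisymm
  · exact le_inf (hφ.le_iff.2 inf_le_left) (hφ.le_iff.2 inf_le_right)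
  · have hx : φ x ⊓ φ y ∈ Set.range φ := by
      rw [hr]
      exact inf_le_left.trans (hr ▸ Set.mem_range_self x : φ x ∈ Set.Iic G)
    obtain ⟨z, hz⟩ := hx
    rw [← hz, hφ.le_iff]
    exact le_inf (hφ.le_iff.1 (hz ▸ inf_le_left)) (hφ.le_iff.1 (hz ▸ inf_le_right))

end Order

/-! ### Embeddings of modular extensions -/

namespace ModExt

variable {L : Type u} [Lattice L] [BoundedOrder L]

/-- The interval below an element above `F`, as a modular extension. -/
@[reducible] def interval (E : ModExt L) (G : E.carrier) (hG : E.flat ≤ G) : ModExt L where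
  carrier := Set.Iic G
  incl l := ⟨E.incl l, (E.incl_le_flat l).trans hG⟩
  isEmbedding :=
    { injective := fun a b h => E.isEmbedding.injective (congrArg Subtype.val h)
      map_sup := fun a b => Subtype.ext (E.isEmbedding.map_sup a b)
      map_atom := fun a ha => (isAtom_Iic_iff _).2 (E.isEmbedding.map_atom a ha) }
  range_incl := by
    ext p
    constructor
    · rintro ⟨l, rfl⟩
      exact E.incl_le_flat l
    · intro h
      exact ⟨_, Subtype.ext (E.incl_restr_of_le h)⟩
  modular A B hA := Subtype.ext (E.modular A.1 B.1 hA)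

/-- Embeddings of modular extensions of `L`. -/
structure IsHom (E E' : ModExt L) (φ : E.carrier → E'.carrier) : Prop where
  isEmbedding : IsEmbedding φ
  map_incl : ∀ l, E'.incl l = φ (E.incl l)

theorem exists_incl_of_le (E : ModExt L) {x : E.carrier} (h : x ≤ E.flat) : ∃ l, E.incl l = x :=
  ⟨_, E.incl_restr_of_le h⟩

namespace IsHom

variable {E E' E'' : ModExt L} {φ : E.carrier → E'.carrier} {ψ : E'.carrier → E''.carrier}

theorem comp (hψ : IsHom E' E'' ψ) (hφ : IsHom E E' φ) : IsHom E E'' (ψ ∘ φ) :=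
  ⟨hψ.1.comp hφ.1, fun l => by rw [hψ.2, hφ.2]; rfl⟩

theorem id (E : ModExt L) : IsHom E E id :=
  ⟨⟨Function.injective_id, fun _ _ => rfl, fun _ h => h⟩, fun _ => rfl⟩

theorem map_flat (h : IsHom E E' φ) : φ E.flat = E'.flat := (h.map_incl ⊤).symm

theorem map_bot (h : IsHom E E' φ) : φ ⊥ = ⊥ := by
  rw [← E.incl_bot, ← h.map_incl, E'.incl_bot]

theorem le_iff (h : IsHom E E' φ) {x y : E.carrier} : φ x ≤ φ y ↔ x ≤ y := h.isEmbedding.le_iff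

theorem le_flat_iff (h : IsHom E E' φ) {x : E.carrier} : φ x ≤ E'.flat ↔ x ≤ E.flat := by
  rw [← h.map_flat, h.le_iff]

theorem restr (h : IsHom E E' φ) (x : E.carrier) : E'.restr (φ x) = E.restr x :=
  restr_of_embedding h.isEmbedding h.map_incl x

theorem flat_le (h : IsHom E E' φ) : E'.flat ≤ φ ⊤ := by
  rw [← h.map_flat, h.le_iff]
  exact le_top

theorem le_top (h : IsHom E E' φ) (x : E.carrier) : φ x ≤ φ ⊤ := h.le_iff.2 _root_.le_top

/-- Restricting the target of an embedding. -/
theorem codRestrict (h : IsHom E E' φ) (G : E'.carrier) (hG : E'.flat ≤ G) (hφ : ∀ x, φ x ≤ G) :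
    IsHom E (E'.interval G hG) fun x => ⟨φ x, hφ x⟩ where
  isEmbedding :=
    { injective := fun _ _ h' => h.1.1 (congrArg Subtype.val h')
      map_sup := fun a b => Subtype.ext (h.1.2 a b)
      map_atom := fun a ha => (isAtom_Iic_iff _).2 (h.1.3 a ha) }
  map_incl l := Subtype.ext (h.2 l)

theorem rk_top (h : IsHom E E' φ) (h1 : φ ⊤ = ⊤) :
    rk (⊤ : E.carrier) = rk (⊤ : E'.carrier) :=
  h.isEmbedding.rk_top h.map_bot h1

theorem subtype_val (E : ModExt L) (G : E.carrier) (hG : E.flat ≤ G) :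
    IsHom (E.interval G hG) E Subtype.val :=
  ⟨⟨Subtype.val_injective, fun _ _ => rfl, fun a ha => (isAtom_Iic_iff a).1 ha⟩, fun _ => rfl⟩

/-- A covering is a join with a new atom, and an embedding keeps it so; thus saturated chains go to
saturated chains. -/
theorem rk_apply (h : IsHom E E' φ) (x : E.carrier) : rk (φ x) = rk x := by
  have key : ∀ {n : ℕ} {x y : E.carrier}, Sat n x y → Sat n (φ x) (φ y) := by
    intro n x y hs
    induction hs with
    | nil => exact .nil _
    | @cons n x x' y hx _ ih =>
      refine .cons ?_ ih
      have : ¬ x' ≤ x := fun h => hx.lt.not_ge h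
      rw [le_iff_atom_le_imp] at this
      push Not at this
      obtain ⟨a, hh, hha, hhb⟩ := this
      have e : x ⊔ a = x' := by
        rcases hx.eq_or_eq (c := x ⊔ a) le_sup_left (sup_le hx.le hha) with h' | h'
        · exact absurd (le_sup_right.trans_eq h') hhb
        · exact h'
      rw [← e, h.1.map_sup]
      exact covBy_sup_atom (h.1.map_atom a hh) (fun h' => hhb (h.le_iff.1 h'))
  obtain ⟨n, hn⟩ := Sat.exists_of_le (bot_le : ⊥ ≤ x)
  have h1 := rk_add_of_sat (key hn)
  rw [rk_add_of_sat hn, h1, h.map_bot, rk_bot, rk_bot]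

/-- A surjective embedding is an isomorphism. -/
noncomputable def toOrderIso (h : IsHom E E' φ) (hs : Function.Surjective φ) :
    E.carrier ≃o E'.carrier where
  toEquiv := Equiv.ofBijective φ ⟨h.1.1, hs⟩
  map_rel_iff' := h.le_iff

theorem of_orderIso (e : E.carrier ≃o E'.carrier) (h : ∀ l, e (E.incl l) = E'.incl l) :
    IsHom E E' e :=
  ⟨.of_orderIso e, fun l => (h l).symm⟩

/-- Factoring an embedding through another one. -/
theorem lift {D : ModExt L} (h : IsHom E E' φ) {χ : D.carrier → E'.carrier} (hχ : IsHom D E' χ)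
    (hr : ∀ x, χ x ∈ Set.range φ) : ∃ θ : D.carrier → E.carrier, IsHom D E θ ∧ ∀ x, φ (θ x) = χ x := by
  choose θ hθ using hr
  refine ⟨θ, ⟨⟨fun a b hab => hχ.1.1 ?_, fun a b => h.1.1 ?_, fun a ha => ?_⟩, fun l => h.1.1 ?_⟩, hθ⟩
  · rw [← hθ, ← hθ, hab]
  · rw [h.1.2, hθ, hθ, hθ, hχ.1.2]
  · have h1 := hχ.1.3 a ha
    rw [← hθ] at h1
    refine ⟨fun e => h1.1 (by rw [e, h.map_bot]), fun b hb => h.1.1 ?_⟩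
    rw [h.map_bot]
    exact h1.2 _ (lt_of_le_of_ne (h.le_iff.2 hb.le) (h.1.1.ne hb.ne))
  · rw [hθ, ← hχ.2, ← h.2]

/-- The range of an embedding contains everything that is generated by `L` and by elements of the
range. -/
theorem mem_range {D : ModExt L} (h : IsHom E E' φ) {χ : D.carrier → E'.carrier}
    (hχ : IsHom D E' χ) (hr : ∀ a, IsAtom a → a ≤ D.flat ∨ χ a ∈ Set.range φ) (x : D.carrier) :
    χ x ∈ Set.range φ := by
  induction x using atom_induction with
  | h0 => exact ⟨⊥, by rw [h.map_bot, hχ.map_bot]⟩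
  | hs x a ha hx =>
    obtain ⟨y, hy⟩ := hx
    have : χ a ∈ Set.range φ := by
      rcases hr a ha with h' | h'
      · obtain ⟨l, rfl⟩ := D.exists_incl_of_le h'
        exact ⟨E.incl l, by rw [← h.2, ← hχ.2]⟩
      · exact h'
    obtain ⟨z, hz⟩ := this
    exact ⟨y ⊔ z, by rw [h.1.2, hχ.1.2, hy, hz]⟩

end IsHom

end ModExt

theorem eq_zero_of_eq_neg_self {M : Type u} [AddCommGroup M] [Module ℚ M] {x : M} (h : x = -x) :
    x = 0 := by
  have h2 : (2 : ℚ) • x = 0 := by rw [two_smul]; exact eq_neg_iff_add_eq_zero.1 h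
  exact (smul_eq_zero.1 h2).resolve_left two_ne_zero

/-! ### Classes of diagrams: signs, intervals and the grading -/

section Classes

variable {L : Type u} [Lattice L] [BoundedOrder L]

open MD

/-- The prefix J₀ absorbs the unchanged first letters, which makes the induction over exchanges go
through. -/
theorem cls_sperm_append (E : ModExt L) {ε : ℤˣ} {J J' : List E.carrier} (h : SPerm ε J J') :
    ∀ (J₀ : List E.carrier) (hJ : ∀ x ∈ J₀ ++ J, IsAtom x) (hJ' : ∀ x ∈ J₀ ++ J', IsAtom x),
      cls ⟨E, J₀ ++ J, hJ⟩ = ε • cls ⟨E, J₀ ++ J', hJ'⟩ := by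
  induction h with
  | nil => intro J₀ hJ hJ'; rw [one_smul]
  | cons a h ih =>
    intro J₀ hJ hJ'
    have := ih (J₀ ++ [a]) (by simpa using hJ) (by simpa using hJ')
    simpa using this
  | swap a b l =>
    intro J₀ hJ hJ'
    rw [cls_swap E J₀ l a b hJ hJ', Units.neg_smul, one_smul]
  | trans h₁ h₂ ih₁ ih₂ =>
    intro J₀ hJ hJ'
    have h0 : ∀ x ∈ J₀ ++ _, IsAtom x := fun x hx =>
      hJ x (List.mem_append.2 ((List.mem_append.1 hx).imp id h₁.perm.mem_iff.2))
    rw [ih₁ J₀ hJ h0, ih₂ J₀ h0 hJ', smul_smul]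

theorem cls_sperm (E : ModExt L) {ε : ℤˣ} {J J' : List E.carrier} (h : SPerm ε J J')
    (hJ : ∀ x ∈ J, IsAtom x) (hJ' : ∀ x ∈ J', IsAtom x) :
    cls ⟨E, J, hJ⟩ = ε • cls ⟨E, J', hJ'⟩ :=
  cls_sperm_append E h [] hJ hJ'

theorem cls_eq_zero_of_sperm_neg (Γ : ModDiag L) (h : SPerm (-1) Γ.word Γ.word) : cls Γ = 0 := by
  apply eq_zero_of_eq_neg_self
  have := cls_sperm Γ.toModExt h Γ.word_atom Γ.word_atom
  rwa [Units.neg_smul, one_smul] at this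

/-- Bringing two copies of a letter to the front, exchanging them and moving back is an odd
rearrangement that fixes the word; the class equals its negative and 2 is invertible. -/
theorem cls_eq_zero_of_not_nodup (Γ : ModDiag L) (h : ¬ Γ.word.Nodup) : cls Γ = 0 := by
  obtain ⟨a, ha⟩ : ∃ a, List.Sublist [a, a] Γ.word := by
    simpa [List.nodup_iff_sublist] using h
  obtain ⟨l, hl⟩ := ha.exists_perm_append
  obtain ⟨ε, hε⟩ := SPerm.exists_of_perm hl
  have := (hε.trans (SPerm.swap a a l)).trans hε.symm
  rw [mul_neg, mul_one, neg_mul, Int.units_mul_self] at this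
  exact cls_eq_zero_of_sperm_neg Γ this

/-- The diagram on an interval containing the image of an embedding. -/
@[reducible] def ModDiag.image (Γ : ModDiag L) {E : ModExt L} {φ : Γ.carrier → E.carrier}
    (h : ModExt.IsHom Γ.toModExt E φ) (G : E.carrier) (hG : E.flat ≤ G) (hφ : ∀ x, φ x ≤ G) :
    ModDiag L where
  toModExt := E.interval G hG
  word := Γ.word.map fun x => ⟨φ x, hφ x⟩
  word_atom := by
    intro x hx
    obtain ⟨y, hy, rfl⟩ := List.mem_map.1 hx
    exact (h.codRestrict G hG hφ).1.3 y (Γ.word_atom y hy)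

theorem cls_hom (Γ Γ' : ModDiag L) {φ : Γ.carrier → Γ'.carrier}
    (h : ModExt.IsHom Γ.toModExt Γ'.toModExt φ) (h1 : φ ⊤ = ⊤) (hJ : Γ'.word = Γ.word.map φ) :
    cls Γ = cls Γ' :=
  cls_embed Γ Γ' φ h.1 (h.rk_top h1) h.2 hJ

/-- By relation (2) the class of a diagram embedded in E can be read off on the interval below the
image of the top. This is how relations in E are transported to its factors. -/
theorem cls_image (Γ : ModDiag L) {E : ModExt L} {φ : Γ.carrier → E.carrier}
    (h : ModExt.IsHom Γ.toModExt E φ) (G : E.carrier) (hG : E.flat ≤ G) (hφ : ∀ x, φ x ≤ G)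
    (h1 : φ ⊤ = G) : cls (Γ.image h G hG hφ) = cls Γ :=
  (cls_hom Γ (Γ.image h G hG hφ) (h.codRestrict G hG hφ) (Subtype.ext h1) rfl).symm

/-- The rank identity for the modular element F replaces the meet by a join. Embeddings preserve
joins and ranks but not always meets, so invariance and additivity of the degree are proved in this
form. -/
theorem ModDiag.degree_eq (Γ : ModDiag L) :
    Γ.degree = Γ.word.length - 2 * ((rk (listJoin Γ.word ⊔ Γ.flat) : ℤ) - rk Γ.flat) := by
  have := Γ.modular.rk_eq (listJoin Γ.word)
  have h : rk (listJoin Γ.word ⊔ Γ.flat) + rk (listJoin Γ.word ⊓ Γ.flat) =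
    rk (listJoin Γ.word) + rk Γ.flat := this
  rw [degree]
  omega

theorem ModDiag.degree_hom (Γ Γ' : ModDiag L) {φ : Γ.carrier → Γ'.carrier}
    (h : ModExt.IsHom Γ.toModExt Γ'.toModExt φ) (hJ : Γ'.word.Perm (Γ.word.map φ)) :
    Γ'.degree = Γ.degree := by
  rw [degree_eq, degree_eq, hJ.length_eq, listJoin_perm hJ, List.length_map,
    ← h.1.map_listJoin h.map_bot, ← h.map_flat, ← h.1.map_sup, h.rk_apply, h.rk_apply]

theorem ModDiag.degree_perm (E : ModExt L) {J J' : List E.carrier} (h : J.Perm J')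
    (hJ : ∀ x ∈ J, IsAtom x) (hJ' : ∀ x ∈ J', IsAtom x) :
    (⟨E, J, hJ⟩ : ModDiag L).degree = (⟨E, J', hJ'⟩ : ModDiag L).degree :=
  degree_hom ⟨E, J', hJ'⟩ ⟨E, J, hJ⟩ (ModExt.IsHom.id E) (by simpa using h)

/-- The decomposition of `MD L` in homogeneous components. -/
noncomputable def MD.components : MD L →ₗ[ℚ] (ℤ →₀ MD L) :=
  MD.lift (fun Γ => Finsupp.single Γ.degree (cls Γ)) (by
    intro v hv
    -- Relations (1) and (2) compare diagrams of equal degree; the other three kill single diagrams.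
    -- So all relations are homogeneous.
    have hz : ∀ Γ : ModDiag L, MDRel (Finsupp.single Γ 1) → cls Γ = 0 := fun Γ h => proj_rel h
    cases hv with
    | swap E J₁ J₂ a b h h' =>
      simp only [map_add, Finsupp.linearCombination_single, one_smul]
      rw [ModDiag.degree_perm E ((List.Perm.swap b a J₂).append_left J₁) h h', ← Finsupp.single_add,
        cls_swap E J₁ J₂ a b h h', neg_add_cancel, Finsupp.single_zero]
    | embed Γ Γ' φ hφ hr hι hJ =>
      simp only [map_sub, Finsupp.linearCombination_single, one_smul]
      rw [cls_embed Γ Γ' φ hφ hr hι hJ, Γ.degree_hom Γ' ⟨hφ, hι⟩ (hJ ▸ .refl _), sub_self]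
    | span Γ h =>
      simp only [Finsupp.linearCombination_single, one_smul]
      rw [hz Γ (.span Γ h), Finsupp.single_zero]
    | prod Γ A B e h =>
      simp only [Finsupp.linearCombination_single, one_smul]
      rw [hz Γ (.prod Γ A B e h), Finsupp.single_zero]
    | two Γ F hF hle h =>
      simp only [Finsupp.linearCombination_single, one_smul]
      rw [hz Γ (.two Γ F hF hle h), Finsupp.single_zero])

/-- A non-zero class sits in a single homogeneous component, so it remembers the degree. A
representative in X thus has the degree of the generator that it represents. -/
theorem MD.degree_eq_of_cls_eq {Γ Γ' : ModDiag L} (h0 : cls Γ ≠ 0)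
    (h : cls Γ = cls Γ' ∨ cls Γ = -cls Γ') : Γ.degree = Γ'.degree := by
  have hc : ∀ Γ : ModDiag L, components (cls Γ) = Finsupp.single Γ.degree (cls Γ) := fun Γ =>
    MD.lift_cls _ _ Γ
  have h1 : ∃ x : MD L, Finsupp.single Γ.degree (cls Γ) = Finsupp.single Γ'.degree x := by
    rcases h with h | h
    · exact ⟨cls Γ', by rw [← hc, h, hc]⟩
    · exact ⟨-cls Γ', by rw [← hc, h, map_neg, hc, Finsupp.single_neg]⟩
  obtain ⟨x, hx⟩ := h1
  rcases Finsupp.single_eq_single_iff _ _ _ _ |>.1 hx with h | h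
  · exact h.1
  · exact absurd h.1 h0

theorem ModDiag.negOnePow_degree (Γ : ModDiag L) : Γ.degree.negOnePow = (-1) ^ Γ.word.length := by
  rw [degree, Int.negOnePow_sub, Int.negOnePow_two_mul, mul_one]
  exact Int.negOnePow_def _

theorem ModDiag.spanning_of_ne_zero {Γ : ModDiag L} (h : cls Γ ≠ 0) :
    Γ.flat ⊔ listJoin Γ.word = ⊤ := by
  by_contra h'
  exact h (proj_rel (.span Γ (lt_top_iff_ne_top.2 h')))

end Classes

/-! ### The two sides of a pushout and additivity of the degree -/

section Products

variable {L : Type u} [Lattice L] [BoundedOrder L] [IsGeometric L]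

open MD

theorem ModExt.isHom_inl (E₁ E₂ : ModExt L) : IsHom E₁ (E₁.pushout E₂) Pushout.inl where
  isEmbedding :=
    { injective := fun _ _ h => congrArg (fun p : Pushout E₁ E₂ => p.1.1) h
      map_sup := fun a b => le_antisymm
        (Pushout.inl_le.2 (sup_le (Pushout.inl_le.1 (le_sup_left (b := (Pushout.inl b : Pushout E₁ E₂))))
          (Pushout.inl_le.1 (le_sup_right (a := (Pushout.inl a : Pushout E₁ E₂))))))
        (sup_le (Pushout.inl_le.2 le_sup_left) (Pushout.inl_le.2 le_sup_right))
      map_atom := fun _ h => Pushout.isAtom_inl h }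
  map_incl := Pushout.base_eq_inl

theorem ModExt.isHom_inr (E₁ E₂ : ModExt L) : IsHom E₂ (E₁.pushout E₂) Pushout.inr where
  isEmbedding :=
    { injective := fun _ _ h => congrArg (fun p : Pushout E₁ E₂ => p.1.2) h
      map_sup := fun a b => le_antisymm
        (Pushout.inr_le.2 (sup_le (Pushout.inr_le.1 (le_sup_left (b := (Pushout.inr b : Pushout E₁ E₂))))
          (Pushout.inr_le.1 (le_sup_right (a := (Pushout.inr a : Pushout E₁ E₂))))))
        (sup_le (Pushout.inr_le.2 le_sup_left) (Pushout.inr_le.2 le_sup_right))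
      map_atom := fun _ h => Pushout.isAtom_inr h }
  map_incl := Pushout.base_eq_inr

/-- Above `F` the pushout is a product. -/
theorem Pushout.rk_above {E₁ E₂ : ModExt L} (p : Pushout E₁ E₂) (h : base ⊤ ≤ p) :
    (rk p : ℤ) - rk (base ⊤ : Pushout E₁ E₂) =
      ((rk p.1.1 : ℤ) - rk E₁.flat) + ((rk p.1.2 : ℤ) - rk E₂.flat) := by
  have hr : ∀ {x y}, E₁.flat ≤ x → E₂.flat ≤ y → E₁.restr x = E₂.restr y := fun hx hy => by
    rw [E₁.restr_eq_top hx, E₂.restr_eq_top hy]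
  -- Above F both traces on L are the top, so the compatibility condition is vacuous and a saturated
  -- chain in one coordinate stays saturated in the pushout.
  have key1 : ∀ {n : ℕ} {x y : E₁.carrier}, Sat n x y → ∀ hx : E₁.flat ≤ x, ∀ hy : E₁.flat ≤ y,
      Sat (α := Pushout E₁ E₂) n ⟨(x, E₂.flat), hr hx le_rfl⟩ ⟨(y, E₂.flat), hr hy le_rfl⟩ := by
    intro n x y hs
    induction hs with
    | nil => exact fun _ _ => .nil _
    | cons hxy _ ih =>
      intro hx hy
      refine .cons ⟨?_, ?_⟩ (ih (hx.trans hxy.le) hy)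
      · exact lt_of_le_of_ne ⟨hxy.le, le_rfl⟩ fun e =>
          hxy.ne (congrArg (fun p : Pushout E₁ E₂ => p.1.1) e)
      · intro q h1 h2
        have h3 : q.1.2 = E₂.flat := le_antisymm h2.le.2 h1.le.2
        rcases hxy.eq_or_eq h1.le.1 h2.le.1 with h4 | h4
        · exact h1.ne (Pushout.ext h4.symm h3.symm)
        · exact h2.ne (Pushout.ext h4 h3)
  have key2 : ∀ {n : ℕ} {x y : E₂.carrier}, Sat n x y → ∀ (z : E₁.carrier) (hz : E₁.flat ≤ z)
      (hx : E₂.flat ≤ x) (hy : E₂.flat ≤ y),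
      Sat (α := Pushout E₁ E₂) n ⟨(z, x), hr hz hx⟩ ⟨(z, y), hr hz hy⟩ := by
    intro n x y hs z hz
    induction hs with
    | nil => exact fun _ _ => .nil _
    | cons hxy _ ih =>
      intro hx hy
      refine .cons ⟨?_, ?_⟩ (ih (hx.trans hxy.le) hy)
      · exact lt_of_le_of_ne ⟨le_rfl, hxy.le⟩ fun e =>
          hxy.ne (congrArg (fun p : Pushout E₁ E₂ => p.1.2) e)
      · intro q h1 h2
        have h3 : q.1.1 = z := le_antisymm h2.le.1 h1.le.1
        rcases hxy.eq_or_eq h1.le.2 h2.le.2 with h4 | h4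
        · exact h1.ne (Pushout.ext h3.symm h4.symm)
        · exact h2.ne (Pushout.ext h3 h4)
  obtain ⟨m, hm⟩ := Sat.exists_of_le h.1
  obtain ⟨n, hn⟩ := Sat.exists_of_le h.2
  have h1 := rk_add_of_sat hm
  have h2 := rk_add_of_sat hn
  have h3 := rk_add_of_sat (α := Pushout E₁ E₂) ((key1 hm le_rfl h.1).append (key2 hn p.1.1 h.1 le_rfl h.2))
  change rk p = rk (base ⊤ : Pushout E₁ E₂) + (m + n) at h3
  change rk p.1.1 = rk E₁.flat + m at h1
  change rk p.1.2 = rk E₂.flat + n at h2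
  omega

theorem ModDiag.degree_mul (Γ₁ Γ₂ : ModDiag L) : (Γ₁.mul Γ₂).degree = Γ₁.degree + Γ₂.degree := by
  -- Above F joins are computed in each coordinate.
  have e : (listJoin (Γ₁.mul Γ₂).word ⊔ (Γ₁.mul Γ₂).flat : Pushout Γ₁.toModExt Γ₂.toModExt) =
      ⟨(listJoin Γ₁.word ⊔ Γ₁.flat, listJoin Γ₂.word ⊔ Γ₂.flat), by
        rw [Γ₁.restr_eq_top le_sup_right, Γ₂.restr_eq_top le_sup_right]⟩ := by
    refine eq_of_forall_ge_iff fun c => ?_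
    have h1 : (Γ₁.mul Γ₂).flat ≤ c ↔ Γ₁.flat ≤ c.1.1 ∧ Γ₂.flat ≤ c.1.2 := Iff.rfl
    have h2 : listJoin (Γ₁.mul Γ₂).word ≤ c ↔
        listJoin Γ₁.word ≤ c.1.1 ∧ listJoin Γ₂.word ≤ c.1.2 := by
      rw [listJoin_le_iff, listJoin_le_iff, listJoin_le_iff]
      simp only [List.mem_append, List.mem_map, or_imp, forall_and,
        forall_exists_index, and_imp, forall_apply_eq_imp_iff₂, Pushout.inl_le, Pushout.inr_le]
    rw [sup_le_iff, h1, h2]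
    show _ ↔ listJoin Γ₁.word ⊔ Γ₁.flat ≤ c.1.1 ∧ listJoin Γ₂.word ⊔ Γ₂.flat ≤ c.1.2
    rw [sup_le_iff, sup_le_iff]
    tauto
  have h := Pushout.rk_above (listJoin (Γ₁.mul Γ₂).word ⊔ (Γ₁.mul Γ₂).flat) le_sup_right
  rw [degree_eq, degree_eq, degree_eq]
  have e1 : ((Γ₁.mul Γ₂).word.length : ℤ) = Γ₁.word.length + Γ₂.word.length := by
    simp [ModDiag.mul]
  have h' : (rk (listJoin (Γ₁.mul Γ₂).word ⊔ (Γ₁.mul Γ₂).flat) : ℤ) - rk (Γ₁.mul Γ₂).flat =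
    ((rk (listJoin Γ₁.word ⊔ Γ₁.flat) : ℤ) - rk Γ₁.flat) +
      ((rk (listJoin Γ₂.word ⊔ Γ₂.flat) : ℤ) - rk Γ₂.flat) := by
    refine h.trans ?_
    rw [e]
  rw [h', e1]
  ring

theorem ModDiag.degree_one : (ModDiag.one L).degree = 0 := by
  rw [degree_eq]
  have : listJoin (ModDiag.one L).word ⊔ (ModDiag.one L).flat = (ModDiag.one L).flat :=
    bot_sup_eq _
  rw [this]
  simp [ModDiag.one]

/-- The product of a list of modular diagrams. -/
noncomputable def ModDiag.mulList : List (ModDiag L) → ModDiag L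
  | [] => ModDiag.one L
  | Γ :: l => Γ.mul (mulList l)

theorem cls_mulList (l : List (ModDiag L)) : cls (ModDiag.mulList l) = (l.map cls).prod := by
  induction l with
  | nil => rfl
  | cons Γ l ih => rw [List.map_cons, List.prod_cons, ← ih, MD.cls_mul_cls]; rfl

end Products

/-! ### Isomorphisms of extensions and internal pushout decompositions -/

namespace ModExt

section Iso

variable {L : Type u} [Lattice L] [BoundedOrder L] {E E' E'' : ModExt L}

theorem Iso.refl (E : ModExt L) : E.Iso E := ⟨OrderIso.refl _, fun _ => rfl⟩

theorem Iso.symm (h : E.Iso E') : E'.Iso E := by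
  obtain ⟨e, he⟩ := h
  exact ⟨e.symm, fun l => by rw [← he, e.symm_apply_apply]⟩

theorem Iso.trans (h : E.Iso E') (h' : E'.Iso E'') : E.Iso E'' := by
  obtain ⟨e, he⟩ := h
  obtain ⟨e', he'⟩ := h'
  exact ⟨e.trans e', fun l => by rw [OrderIso.trans_apply, he, he']⟩

/-- Two extensions that embed with the same interval as image are isomorphic. -/
theorem IsHom.iso_of_range {φ : E.carrier → E''.carrier} {ψ : E'.carrier → E''.carrier}
    (hφ : IsHom E E'' φ) (hψ : IsHom E' E'' ψ) (h : Set.range φ = Set.range ψ) : E.Iso E' := by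
  obtain ⟨θ, hθ, hc⟩ := hψ.lift hφ fun x => h ▸ Set.mem_range_self x
  have hs : Function.Surjective θ := by
    intro y
    obtain ⟨x, hx⟩ : ψ y ∈ Set.range φ := h ▸ Set.mem_range_self y
    exact ⟨x, hψ.1.1 (by rw [hc, hx])⟩
  exact ⟨hθ.toOrderIso hs, fun l => (hθ.2 l).symm⟩

theorem IsHom.apply_top {φ : E.carrier → E'.carrier} (hφ : IsHom E E' φ) {G : E'.carrier}
    (hr : Set.range φ = Set.Iic G) : φ ⊤ = G := by
  apply le_antisymm
  · exact (hr ▸ Set.mem_range_self ⊤ : φ ⊤ ∈ Set.Iic G)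
  · obtain ⟨x, hx⟩ : G ∈ Set.range φ := hr ▸ le_refl G
    rw [← hx]
    exact hφ.le_top x

theorem IsHom.range_comp {φ : E.carrier → E'.carrier} {ψ : E'.carrier → E''.carrier}
    (hψ : IsHom E' E'' ψ) {G : E'.carrier} {H : E''.carrier}
    (hr : Set.range φ = Set.Iic G) (hr' : Set.range ψ = Set.Iic H) :
    Set.range (ψ ∘ φ) = Set.Iic (ψ G) := by
  ext y
  constructor
  · rintro ⟨x, rfl⟩
    exact hψ.le_iff.2 (hr ▸ Set.mem_range_self x : φ x ∈ Set.Iic G)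
  · intro hy
    obtain ⟨z, rfl⟩ : y ∈ Set.range ψ := by
      rw [hr']
      exact le_trans hy (hr' ▸ Set.mem_range_self G : ψ G ∈ Set.Iic H)
    obtain ⟨x, rfl⟩ : z ∈ Set.range φ := hr ▸ hψ.le_iff.1 hy
    exact ⟨x, rfl⟩

theorem isTrivial_of_flat_eq_top (h : (⊤ : E.carrier) ≤ E.flat) : E.IsTrivial := fun _ =>
  E.exists_incl_of_le (le_top.trans h)

theorem IsTrivial.le_flat (h : E.IsTrivial) (x : E.carrier) : x ≤ E.flat := by
  obtain ⟨l, rfl⟩ := h x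
  exact E.incl_le_flat l

end Iso

section Split

variable {L : Type u} [Lattice L] [BoundedOrder L]

/-- The pair `(G, H)` exhibits `E` as the pushout of the intervals below `G` and `H`. -/
structure IsSplit (E : ModExt L) (G H : E.carrier) : Prop where
  flat_le_left : E.flat ≤ G
  flat_le_right : E.flat ≤ H
  le_sup : ∀ x, x ≤ x ⊓ G ⊔ x ⊓ H
  inf_left_le : ∀ y z, y ≤ G → z ≤ H → E.restr y = E.restr z → (y ⊔ z) ⊓ G ≤ y
  inf_right_le : ∀ y z, y ≤ G → z ≤ H → E.restr y = E.restr z → (y ⊔ z) ⊓ H ≤ z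

/-- F and G ∧ H have the same trace on L, namely the top; gluing them and meeting with G must give
back F. -/
theorem IsSplit.inf_le {E : ModExt L} {G H : E.carrier} (h : E.IsSplit G H) : G ⊓ H ≤ E.flat := by
  refine le_trans (le_inf le_sup_right inf_le_left) (h.inf_left_le E.flat (G ⊓ H) h.flat_le_left
    inf_le_right ?_)
  rw [E.restr_eq_top le_rfl, E.restr_eq_top (le_inf h.flat_le_left h.flat_le_right)]

/-- Splittings restrict to intervals. -/
theorem IsSplit.comap {E E' : ModExt L} {φ : E.carrier → E'.carrier} (hφ : IsHom E E' φ)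
    {G : E'.carrier} (hr : Set.range φ = Set.Iic G) {H₁ H₂ : E'.carrier} (h : E'.IsSplit H₁ H₂)
    {a₁ a₂ : E.carrier} (h₁ : φ a₁ = G ⊓ H₁) (h₂ : φ a₂ = G ⊓ H₂) : E.IsSplit a₁ a₂ := by
  have hG : ∀ x, φ x ≤ G := fun x => (hr ▸ Set.mem_range_self x : φ x ∈ Set.Iic G)
  have hF : E'.flat ≤ G := hφ.map_flat ▸ hG _
  have e₁ : ∀ x, φ (x ⊓ a₁) = φ x ⊓ H₁ := fun x => by
    rw [hφ.1.map_inf_of_range hr, h₁, ← inf_assoc, inf_eq_left.2 (hG x)]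
  have e₂ : ∀ x, φ (x ⊓ a₂) = φ x ⊓ H₂ := fun x => by
    rw [hφ.1.map_inf_of_range hr, h₂, ← inf_assoc, inf_eq_left.2 (hG x)]
  have i₁ : ∀ {x}, x ≤ a₁ → φ x ≤ H₁ := fun hx =>
    (hφ.le_iff.2 hx).trans (h₁.le.trans inf_le_right)
  have i₂ : ∀ {x}, x ≤ a₂ → φ x ≤ H₂ := fun hx =>
    (hφ.le_iff.2 hx).trans (h₂.le.trans inf_le_right)
  refine ⟨?_, ?_, fun x => ?_, fun y z hy hz hyz => ?_, fun y z hy hz hyz => ?_⟩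
  · rw [← hφ.le_iff, hφ.map_flat, h₁]
    exact le_inf hF h.flat_le_left
  · rw [← hφ.le_iff, hφ.map_flat, h₂]
    exact le_inf hF h.flat_le_right
  · rw [← hφ.le_iff, hφ.1.map_sup, e₁, e₂]
    exact h.le_sup _
  · rw [← hφ.le_iff, e₁, hφ.1.map_sup]
    exact h.inf_left_le _ _ (i₁ hy) (i₂ hz) (by rw [hφ.restr, hφ.restr, hyz])
  · rw [← hφ.le_iff, e₂, hφ.1.map_sup]
    exact h.inf_right_le _ _ (i₁ hy) (i₂ hz) (by rw [hφ.restr, hφ.restr, hyz])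

theorem IsSplit.map {E E' : ModExt L} (e : E.carrier ≃o E'.carrier)
    (he : ∀ l, e (E.incl l) = E'.incl l) {G H : E.carrier} (h : E.IsSplit G H) :
    E'.IsSplit (e G) (e H) := by
  have hs : IsHom E' E e.symm := .of_orderIso e.symm fun l => by rw [← he, e.symm_apply_apply]
  exact h.comap hs (G := ⊤) (by rw [e.symm.surjective.range_eq, Set.Iic_top]) (by simp) (by simp)

variable [IsGeometric L]

theorem restr_pushout {E₁ E₂ : ModExt L} (p : Pushout E₁ E₂) :
    (E₁.pushout E₂).restr p = E₁.restr p.1.1 :=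
  eq_of_forall_le_iff fun l => by
    rw [← ModExt.incl_le_iff]
    exact Pushout.base_le

/-- If y and z lie on the two sides and agree on L, then the pair (y₁, z₂) belongs to the pushout
and bounds y ∨ z; its traces on the two sides are y and z. -/
theorem isSplit_pushout (E₁ E₂ : ModExt L) :
    (E₁.pushout E₂).IsSplit (Pushout.inl ⊤) (Pushout.inr ⊤) := by
  have key : ∀ y z : Pushout E₁ E₂, y ≤ Pushout.inl ⊤ → z ≤ Pushout.inr ⊤ →
      (E₁.pushout E₂).restr y = (E₁.pushout E₂).restr z → ∃ p : Pushout E₁ E₂, y ⊔ z ≤ p ∧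
        p.1.1 = y.1.1 ∧ p.1.2 = z.1.2 := by
    intro y z hy hz hyz
    rw [restr_pushout, restr_pushout] at hyz
    have h1 : E₁.restr y.1.1 = E₂.restr z.1.2 := hyz.trans z.2
    refine ⟨⟨(y.1.1, z.1.2), h1⟩, sup_le ⟨le_rfl, ?_⟩ ⟨?_, le_rfl⟩, rfl, rfl⟩
    · have := E₂.incl_restr_of_le (hy.2.trans (E₂.incl_le_flat _))
      rw [← this]
      exact E₂.incl_le_iff.2 (y.2.symm.trans h1).le
    · have := E₁.incl_restr_of_le (hz.1.trans (E₁.incl_le_flat _))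
      rw [← this]
      exact E₁.incl_le_iff.2 hyz.ge
  refine ⟨?_, ?_, fun x => ⟨?_, ?_⟩, fun y z hy hz hyz => ?_, fun y z hy hz hyz => ?_⟩
  · exact (isHom_inl E₁ E₂).flat_le
  · exact (isHom_inr E₁ E₂).flat_le
  · exact le_trans (le_inf le_rfl le_top)
      (le_sup_left : x ⊓ Pushout.inl ⊤ ≤ (x ⊓ Pushout.inl ⊤ ⊔ x ⊓ Pushout.inr ⊤ :
        Pushout E₁ E₂)).1
  · exact le_trans (le_inf le_rfl le_top)
      (le_sup_right : x ⊓ Pushout.inr ⊤ ≤ (x ⊓ Pushout.inl ⊤ ⊔ x ⊓ Pushout.inr ⊤ :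
        Pushout E₁ E₂)).2
  · obtain ⟨p, hp, h1, h2⟩ := key y z hy hz hyz
    refine (inf_le_inf_right _ hp).trans ?_
    have h3 : (p ⊓ Pushout.inl ⊤ : Pushout E₁ E₂) ≤ Pushout.inl p.1.1 := by
      refine ⟨inf_le_left, ?_⟩
      have := (E₂.incl_restr_of_le (x := p.1.2 ⊓ (Pushout.inl ⊤ : Pushout E₁ E₂).1.2)
        (inf_le_right.trans (E₂.incl_le_flat _)))
      show p.1.2 ⊓ (Pushout.inl ⊤ : Pushout E₁ E₂).1.2 ≤ E₂.incl (E₁.restr p.1.1)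
      rw [← this, E₂.incl_le_incl, p.2]
      exact E₂.restr_mono inf_le_left
    exact h3.trans (Pushout.inl_le.2 h1.le)
  · obtain ⟨p, hp, h1, h2⟩ := key y z hy hz hyz
    refine (inf_le_inf_right _ hp).trans ?_
    have h3 : (p ⊓ Pushout.inr ⊤ : Pushout E₁ E₂) ≤ Pushout.inr p.1.2 := by
      refine ⟨?_, inf_le_left⟩
      have := (E₁.incl_restr_of_le (x := p.1.1 ⊓ (Pushout.inr ⊤ : Pushout E₁ E₂).1.1)
        (inf_le_right.trans (E₁.incl_le_flat _)))
      show p.1.1 ⊓ (Pushout.inr ⊤ : Pushout E₁ E₂).1.1 ≤ E₁.incl (E₂.restr p.1.2)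
      rw [← this, E₁.incl_le_incl, ← p.2]
      exact E₁.restr_mono inf_le_left
    exact h3.trans (Pushout.inr_le.2 h2.le)

/-- Splittings of the second factor induce splittings of a pushout. -/
theorem IsSplit.inr {E₁ E₂ : ModExt L} {K K' : E₂.carrier} (h : E₂.IsSplit K K') :
    ∃ H, (E₁.pushout E₂).IsSplit (Pushout.inr K) H := by
  have hK' : E₁.restr ⊤ = E₂.restr K' := by rw [E₁.restr_top, E₂.restr_eq_top h.flat_le_right]
  -- The complementary side collects all of E₁ and the other half K' of E₂.
  let H : Pushout E₁ E₂ := ⟨(⊤, K'), hK'⟩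
  have hrK : (Pushout.inr K : Pushout E₁ E₂).1.1 = E₁.flat := by
    show E₁.incl _ = E₁.flat
    rw [E₂.restr_eq_top h.flat_le_left]
    rfl
  have key : ∀ y z : Pushout E₁ E₂, y ≤ Pushout.inr K → z ≤ H →
      (E₁.pushout E₂).restr y = (E₁.pushout E₂).restr z → ∃ p : Pushout E₁ E₂, y ⊔ z ≤ p ∧
        p.1.1 = z.1.1 ∧ p.1.2 = y.1.2 ⊔ z.1.2 ∧ E₂.restr y.1.2 = E₂.restr z.1.2 := by
    intro y z hy hz hyz
    rw [restr_pushout, restr_pushout] at hyz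
    have h0 : E₂.restr y.1.2 = E₂.restr z.1.2 := y.2.symm.trans (hyz.trans z.2)
    -- Gluing y₂ and z₂ adds nothing in L: the trace of y₂ ∨ z₂ on K is y₂, and K contains F.
    have h1 : E₁.restr z.1.1 = E₂.restr (y.1.2 ⊔ z.1.2) := by
      rw [z.2, ← h0]
      apply le_antisymm (E₂.restr_mono le_sup_left)
      have h2 := E₂.restr_mono (h.inf_left_le y.1.2 z.1.2 hy.2 hz.2 h0)
      rwa [E₂.restr_inf, E₂.restr_eq_top h.flat_le_left, inf_top_eq] at h2
    refine ⟨⟨(z.1.1, y.1.2 ⊔ z.1.2), h1⟩, sup_le ⟨?_, le_sup_left⟩ ⟨le_rfl, le_sup_right⟩,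
      rfl, rfl, h0⟩
    rw [← E₁.incl_restr_of_le (hy.1.trans hrK.le)]
    exact E₁.incl_le_iff.2 hyz.le
  refine ⟨H, (isHom_inr E₁ E₂).map_flat ▸ (isHom_inr E₁ E₂).le_iff.2 h.flat_le_left,
    ⟨le_top, h.flat_le_right⟩, fun x => ⟨?_, ?_⟩, fun y z hy hz hyz => ?_,
    fun y z hy hz hyz => ?_⟩
  · exact le_trans (le_inf le_rfl le_top)
      (le_sup_right : x ⊓ H ≤ (x ⊓ Pushout.inr K ⊔ x ⊓ H : Pushout E₁ E₂)).1
  · refine (h.le_sup x.1.2).trans (sup_le ?_ ?_)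
    · exact (le_sup_left : x ⊓ Pushout.inr K ≤ (x ⊓ Pushout.inr K ⊔ x ⊓ H : Pushout E₁ E₂)).2
    · exact (le_sup_right : x ⊓ H ≤ (x ⊓ Pushout.inr K ⊔ x ⊓ H : Pushout E₁ E₂)).2
  · obtain ⟨p, hp, h1, h2, h0⟩ := key y z hy hz hyz
    refine (inf_le_inf_right _ hp).trans ⟨?_, ?_⟩
    · show p.1.1 ⊓ (Pushout.inr K : Pushout E₁ E₂).1.1 ≤ y.1.1
      rw [hrK, h1, ← E₁.incl_restr, E₁.incl_le_iff, ← restr_pushout, ← hyz, restr_pushout]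
    · show p.1.2 ⊓ K ≤ y.1.2
      rw [h2]
      exact h.inf_left_le _ _ hy.2 hz.2 h0
  · obtain ⟨p, hp, h1, h2, h0⟩ := key y z hy hz hyz
    refine (inf_le_inf_right _ hp).trans ⟨inf_le_left.trans h1.le, ?_⟩
    show p.1.2 ⊓ K' ≤ z.1.2
    rw [h2]
    exact h.inf_right_le _ _ hy.2 hz.2 h0

/-- A splitting exhibits `E` as a pushout. -/
theorem IsSplit.iso {E : ModExt L} {G H : E.carrier} (h : E.IsSplit G H) :
    E.Iso ((E.interval G h.flat_le_left).pushout (E.interval H h.flat_le_right)) := by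
  have rG := (IsHom.subtype_val E G h.flat_le_left).restr
  have rH := (IsHom.subtype_val E H h.flat_le_right).restr
  refine ⟨?_, fun l => ?_⟩
  · exact
      { toFun := fun x => ⟨(⟨x ⊓ G, inf_le_right⟩, ⟨x ⊓ H, inf_le_right⟩), by
          rw [← rG, ← rH, E.restr_inf, E.restr_inf, E.restr_eq_top h.flat_le_left,
            E.restr_eq_top h.flat_le_right]⟩
        invFun := fun p => p.1.1.1 ⊔ p.1.2.1
        left_inv := fun x => le_antisymm (sup_le inf_le_left inf_le_left) (h.le_sup x)
        right_inv := fun p => by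
          have hp : E.restr p.1.1.1 = E.restr p.1.2.1 := by
            rw [rG, rH]
            exact p.2
          refine Pushout.ext (Subtype.ext ?_) (Subtype.ext ?_)
          · exact le_antisymm (h.inf_left_le _ _ p.1.1.2 p.1.2.2 hp) (le_inf le_sup_left p.1.1.2)
          · exact le_antisymm (h.inf_right_le _ _ p.1.1.2 p.1.2.2 hp) (le_inf le_sup_right p.1.2.2)
        map_rel_iff' := by
          intro x y
          constructor
          · intro hxy
            have h1 : x ⊓ G ≤ y ⊓ G := hxy.1
            have h2 : x ⊓ H ≤ y ⊓ H := hxy.2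
            exact (h.le_sup x).trans (sup_le (h1.trans inf_le_left) (h2.trans inf_le_left))
          · intro hxy
            exact ⟨inf_le_inf_right G hxy, inf_le_inf_right H hxy⟩ }
  · exact Pushout.ext (Subtype.ext (inf_eq_left.2 ((E.incl_le_flat l).trans h.flat_le_left)))
      (Subtype.ext (inf_eq_left.2 ((E.incl_le_flat l).trans h.flat_le_right)))

theorem IsIrreducible.le_flat {E : ModExt L} (hE : E.IsIrreducible) {G H : E.carrier}
    (h : E.IsSplit G H) : G ≤ E.flat ∨ H ≤ E.flat := by
  by_contra! hn
  refine hE.2 ⟨_, _, fun ht => hn.1 ?_, fun ht => hn.2 ?_, h.iso⟩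
  · exact ht.le_flat ⊤
  · exact ht.le_flat ⊤

/-- Irreducible intervals are contained in one side of every splitting. -/
theorem IsSplit.le_or_le {E E' : ModExt L} {φ : E.carrier → E'.carrier} (hφ : IsHom E E' φ)
    {G : E'.carrier} (hr : Set.range φ = Set.Iic G) (hE : E.IsIrreducible)
    {H₁ H₂ : E'.carrier} (h : E'.IsSplit H₁ H₂) : G ≤ H₁ ∨ G ≤ H₂ := by
  -- The splitting restricts to the traces of its sides on the interval below G. Irreducibility puts
  -- one of them in L, and then G lies on the other side.
  obtain ⟨a₁, h₁⟩ : G ⊓ H₁ ∈ Set.range φ := hr ▸ inf_le_left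
  obtain ⟨a₂, h₂⟩ : G ⊓ H₂ ∈ Set.range φ := hr ▸ inf_le_left
  rcases hE.le_flat (h.comap hφ hr h₁ h₂) with h' | h'
  · right
    rw [← hφ.le_flat_iff, h₁] at h'
    exact (h.le_sup G).trans (sup_le (h'.trans h.flat_le_right) inf_le_right)
  · left
    rw [← hφ.le_flat_iff, h₂] at h'
    exact (h.le_sup G).trans (sup_le inf_le_right (h'.trans h.flat_le_left))

/-- Irreducible parts with a common element outside `L` coincide. -/
theorem IsSplit.eq_of_common {E₁ E₂ E : ModExt L} {φ₁ : E₁.carrier → E.carrier}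
    {φ₂ : E₂.carrier → E.carrier} (h₁ : IsHom E₁ E φ₁) (h₂ : IsHom E₂ E φ₂) {G₁ G₂ : E.carrier}
    (hr₁ : Set.range φ₁ = Set.Iic G₁) (hr₂ : Set.range φ₂ = Set.Iic G₂)
    (hE₁ : E₁.IsIrreducible) (hE₂ : E₂.IsIrreducible) {H₁ H₂ : E.carrier}
    (hs₁ : E.IsSplit G₁ H₁) (hs₂ : E.IsSplit G₂ H₂) {a : E.carrier} (ha : ¬ a ≤ E.flat)
    (ha₁ : a ≤ G₁) (ha₂ : a ≤ G₂) : G₁ = G₂ := by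
  apply le_antisymm
  · refine (hs₂.le_or_le h₁ hr₁ hE₁).resolve_right fun h => ha ?_
    exact (le_inf ha₂ (ha₁.trans h)).trans hs₂.inf_le
  · refine (hs₁.le_or_le h₂ hr₂ hE₂).resolve_right fun h => ha ?_
    exact (le_inf ha₁ (ha₂.trans h)).trans hs₁.inf_le

end Split

end ModExt

/-! ### Decompositions of a diagram into components -/

section Family

variable {L : Type u} [Lattice L] [BoundedOrder L]

/-- The diagram `Γ` occurs in `E` on the interval below `G`, with word `B`. -/
def IsComponent (E : ModExt L) (Γ : ModDiag L) (G : E.carrier) (B : List E.carrier) : Prop :=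
  ∃ φ : Γ.carrier → E.carrier, ModExt.IsHom Γ.toModExt E φ ∧ Set.range φ = Set.Iic G ∧
    B = Γ.word.map φ

/-- A decomposition of `E`, with a word `J`, into the diagrams `f i`. -/
structure IsFamily {I : Type v} (f : I → ModDiag L) (E : ModExt L) (J : List E.carrier)
    (ps : List (I × E.carrier × List E.carrier)) : Prop where
  isComponent : ∀ p ∈ ps, IsComponent E (f p.1) p.2.1 p.2.2
  isSplit : ∀ p ∈ ps, ∃ H, E.IsSplit p.2.1 H
  word : J = (ps.map fun p => p.2.2).flatten
  pairwise : ps.Pairwise fun p q => p.2.1 ⊓ q.2.1 ≤ E.flat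
  cover : ∀ a, IsAtom a → a ≤ E.flat ∨ ∃ p ∈ ps, a ≤ p.2.1

theorem IsComponent.le {E : ModExt L} {Γ : ModDiag L} {G : E.carrier} {B : List E.carrier}
    (h : IsComponent E Γ G B) {a : E.carrier} (ha : a ∈ B) : a ≤ G := by
  obtain ⟨φ, _, hr, rfl⟩ := h
  obtain ⟨x, _, rfl⟩ := List.mem_map.1 ha
  exact (hr ▸ Set.mem_range_self x : φ x ∈ Set.Iic G)

/-- Decompositions are transported along isomorphisms in order to compare two of them inside one
lattice. -/
theorem IsFamily.map {I : Type v} {f : I → ModDiag L} {E E' : ModExt L} {J : List E.carrier}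
    {ps : List (I × E.carrier × List E.carrier)} (h : IsFamily f E J ps)
    (e : E.carrier ≃o E'.carrier) (he : ∀ l, e (E.incl l) = E'.incl l) :
    IsFamily f E' (J.map e) (ps.map fun p => (p.1, e p.2.1, p.2.2.map e)) := by
  have hh : ModExt.IsHom E E' e := .of_orderIso e he
  refine ⟨fun p hp => ?_, fun p hp => ?_, ?_, ?_, fun a ha => ?_⟩
  · obtain ⟨q, hq, rfl⟩ := List.mem_map.1 hp
    obtain ⟨φ, hφ, hr, hB⟩ := h.isComponent q hq
    refine ⟨e ∘ φ, hh.comp hφ, hh.range_comp hr (H := ⊤) ?_, ?_⟩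
    · rw [e.surjective.range_eq, Set.Iic_top]
    · rw [hB, List.map_map]
  · obtain ⟨q, hq, rfl⟩ := List.mem_map.1 hp
    obtain ⟨H, hH⟩ := h.isSplit q hq
    exact ⟨e H, hH.map e he⟩
  · rw [h.word, List.map_flatten, List.map_map, List.map_map]
    rfl
  · rw [List.pairwise_map]
    refine h.pairwise.imp fun {p q} hpq => ?_
    rw [← hh.map_flat, ← map_inf]
    exact hh.le_iff.2 hpq
  · rcases h.cover (e.symm a) ((OrderIso.isAtom_iff _ _).2 ha) with h' | ⟨p, hp, h'⟩
    · left
      rwa [← hh.le_flat_iff, e.apply_symm_apply] at h'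
    · refine Or.inr ⟨_, List.mem_map_of_mem hp, ?_⟩
      rwa [← hh.le_iff, e.apply_symm_apply] at h'

theorem range_inl {E₁ E₂ : ModExt L} :
    Set.range (Pushout.inl : E₁.carrier → Pushout E₁ E₂) = Set.Iic (Pushout.inl ⊤) := by
  ext p
  constructor
  · rintro ⟨x, rfl⟩
    exact Pushout.inl_le.2 le_top
  · intro h
    refine ⟨p.1.1, Pushout.ext rfl ?_⟩
    have := E₂.incl_restr_of_le (h.2.trans (E₂.incl_le_flat _))
    rw [← p.2] at this
    exact this

theorem range_inr {E₁ E₂ : ModExt L} :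
    Set.range (Pushout.inr : E₂.carrier → Pushout E₁ E₂) = Set.Iic (Pushout.inr ⊤) := by
  ext p
  constructor
  · rintro ⟨x, rfl⟩
    exact Pushout.inr_le.2 le_top
  · intro h
    refine ⟨p.1.2, Pushout.ext ?_ rfl⟩
    have := E₁.incl_restr_of_le (h.1.trans (E₁.incl_le_flat _))
    rw [p.2] at this
    exact this

variable [IsGeometric L]

/-- A product of diagrams decomposes into its factors. -/
theorem exists_family {I : Type v} (f : I → ModDiag L) (l : List I) :
    ∃ ps, ps.map Prod.fst = l ∧ IsFamily f (ModDiag.mulList (l.map f)).toModExt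
      (ModDiag.mulList (l.map f)).word ps := by
  induction l with
  | nil => exact ⟨[], rfl, by simp, by simp, rfl, .nil, fun a _ => Or.inl le_top⟩
  | cons i l ih =>
    obtain ⟨ps, hps, h⟩ := ih
    revert ps
    generalize hM : ModDiag.mulList (l.map f) = M
    rintro ps hps h
    subst hps
    have hm : ModDiag.mulList ((i :: ps.map Prod.fst).map f) = (f i).mul M :=
      congrArg (f i).mul hM
    rw [hm]
    have hl := ModExt.isHom_inl (f i).toModExt M.toModExt
    have hr := ModExt.isHom_inr (f i).toModExt M.toModExt
    refine ⟨(i, Pushout.inl ⊤, (f i).word.map Pushout.inl) ::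
      ps.map fun p => (p.1, Pushout.inr p.2.1, p.2.2.map Pushout.inr), ?_, ?_, ?_, ?_, ?_, ?_⟩
    · simp [Function.comp_def]
    · intro p hp
      rcases List.mem_cons.1 hp with rfl | hp
      · exact ⟨Pushout.inl, hl, range_inl, rfl⟩
      · obtain ⟨q, hq, rfl⟩ := List.mem_map.1 hp
        obtain ⟨φ, hφ, hr', hB⟩ := h.isComponent q hq
        refine ⟨Pushout.inr ∘ φ, hr.comp hφ, hr.range_comp hr' range_inr, ?_⟩
        rw [hB, List.map_map]
    · intro p hp
      rcases List.mem_cons.1 hp with rfl | hp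
      · exact ⟨_, ModExt.isSplit_pushout _ _⟩
      · obtain ⟨q, hq, rfl⟩ := List.mem_map.1 hp
        obtain ⟨H, hH⟩ := h.isSplit q hq
        exact hH.inr
    · rw [List.map_cons, List.flatten_cons, List.map_map]
      show _ ++ M.word.map Pushout.inr = _
      rw [h.word, List.map_flatten, List.map_map]
      rfl
    · rw [List.pairwise_cons]
      constructor
      · intro p hp
        obtain ⟨q, hq, rfl⟩ := List.mem_map.1 hp
        exact ⟨inf_le_right.trans ((f i).incl_le_flat _), inf_le_left.trans (M.incl_le_flat _)⟩
      · rw [List.pairwise_map]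
        refine h.pairwise.imp fun {p q} hpq => ?_
        exact ⟨inf_le_right.trans ((f i).incl_le_flat _), hpq⟩
    · intro a ha
      rcases Pushout.atom_cases ha with ⟨x, hx, rfl⟩ | ⟨x, hx, rfl⟩
      · exact Or.inr ⟨_, List.mem_cons_self, Pushout.inl_le.2 le_top⟩
      · rcases h.cover x hx with h' | ⟨p, hp, h'⟩
        · exact Or.inl (hr.le_flat_iff.2 h')
        · exact Or.inr ⟨_, List.mem_cons_of_mem _ (List.mem_map_of_mem hp), hr.le_iff.2 h'⟩

end Family

section Components

variable {L : Type u} [Lattice L] [BoundedOrder L]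

open MD

theorem ModExt.IsHom.isAtom_iff {E E' : ModExt L} {φ : E.carrier → E'.carrier}
    (h : ModExt.IsHom E E' φ) {a : E.carrier} : IsAtom (φ a) ↔ IsAtom a := by
  refine ⟨fun ha => ⟨fun e => ha.1 (by rw [e, h.map_bot]), fun b hb => h.1.1 ?_⟩, h.1.3 a⟩
  rw [h.map_bot]
  exact ha.2 _ (lt_of_le_of_ne (h.le_iff.2 hb.le) (h.1.1.ne hb.ne))

theorem IsComponent.isTrivial_of_le {E : ModExt L} {Γ : ModDiag L} {G : E.carrier}
    {B : List E.carrier} (h : IsComponent E Γ G B) (hG : G ≤ E.flat) : Γ.toModExt.IsTrivial := by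
  obtain ⟨φ, hφ, hr, rfl⟩ := h
  apply ModExt.isTrivial_of_flat_eq_top
  rw [← hφ.le_flat_iff, hφ.apply_top hr]
  exact hG

theorem IsComponent.le_of_isTrivial {E : ModExt L} {Γ : ModDiag L} {G : E.carrier}
    {B : List E.carrier} (h : IsComponent E Γ G B) (hΓ : Γ.toModExt.IsTrivial) : G ≤ E.flat := by
  obtain ⟨φ, hφ, hr, rfl⟩ := h
  rw [← hφ.apply_top hr, hφ.le_flat_iff]
  exact hΓ.le_flat ⊤

theorem IsComponent.flat_le {E : ModExt L} {Γ : ModDiag L} {G : E.carrier}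
    {B : List E.carrier} (h : IsComponent E Γ G B) : E.flat ≤ G := by
  obtain ⟨φ, hφ, hr, rfl⟩ := h
  rw [← hφ.apply_top hr]
  exact hφ.flat_le

theorem IsComponent.iso {E : ModExt L} {Γ Γ' : ModDiag L} {G : E.carrier}
    {B B' : List E.carrier} (h : IsComponent E Γ G B) (h' : IsComponent E Γ' G B') :
    Γ.toModExt.Iso Γ'.toModExt := by
  obtain ⟨φ, hφ, hr, -⟩ := h
  obtain ⟨φ', hφ', hr', -⟩ := h'
  exact hφ.iso_of_range hφ' (hr.trans hr'.symm)

/-- Both classes are computed on the same interval of E, whatever the two embeddings are; only the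
order of the letters can differ. -/
theorem IsComponent.cls_eq {E : ModExt L} {Γ Γ' : ModDiag L} {G : E.carrier}
    {B B' : List E.carrier} (h : IsComponent E Γ G B) (h' : IsComponent E Γ' G B') {ε : ℤˣ}
    (hε : SPerm ε B B') : cls Γ = ε • cls Γ' := by
  have hG := h.flat_le
  obtain ⟨φ, hφ, hr, rfl⟩ := h
  obtain ⟨φ', hφ', hr', rfl⟩ := h'
  have hle : ∀ x, φ x ≤ G := fun x => (hr ▸ Set.mem_range_self x : φ x ∈ Set.Iic G)
  have hle' : ∀ x, φ' x ≤ G := fun x => (hr' ▸ Set.mem_range_self x : φ' x ∈ Set.Iic G)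
  rw [← cls_image Γ hφ G hG hle (hφ.apply_top hr),
    ← cls_image Γ' hφ' G hG hle' (hφ'.apply_top hr')]
  refine cls_sperm _ (SPerm.of_map Subtype.val_injective ?_) _ _
  rw [List.map_map, List.map_map]
  exact hε

variable [IsGeometric L]

/-- An irreducible component is met by the other decomposition in the same interval. -/
theorem IsFamily.exists_eq {I : Type v} {I' : Type w} {f : I → ModDiag L} {f' : I' → ModDiag L}
    {E : ModExt L} {J J' : List E.carrier} {ps : List (I × E.carrier × List E.carrier)}
    {ps' : List (I' × E.carrier × List E.carrier)} (h : IsFamily f E J ps)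
    (h' : IsFamily f' E J' ps')
    (hf : ∀ p ∈ ps', (f' p.1).toModExt.IsTrivial ∨ (f' p.1).toModExt.IsIrreducible)
    {p : I × E.carrier × List E.carrier} (hp : p ∈ ps) (hi : (f p.1).toModExt.IsIrreducible) :
    ∃ p' ∈ ps', (f' p'.1).toModExt.IsIrreducible ∧ p.2.1 = p'.2.1 := by
  -- A non-trivial component has an atom outside L. The component of the other family that contains
  -- it cannot be trivial, so it is irreducible, and two irreducible components sharing this atom
  -- are equal.
  have hG : ¬ p.2.1 ≤ E.flat := fun hle => hi.1 ((h.isComponent p hp).isTrivial_of_le hle)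
  rw [le_iff_atom_le_imp] at hG
  push Not at hG
  obtain ⟨a, ha, hap, haF⟩ := hG
  obtain ⟨p', hp', hap'⟩ := (h'.cover a ha).resolve_left haF
  have hi' : (f' p'.1).toModExt.IsIrreducible := (hf p' hp').resolve_left fun ht =>
    haF (hap'.trans ((h'.isComponent p' hp').le_of_isTrivial ht))
  obtain ⟨φ, hφ, hr, -⟩ := h.isComponent p hp
  obtain ⟨φ', hφ', hr', -⟩ := h'.isComponent p' hp'
  obtain ⟨H, hH⟩ := h.isSplit p hp
  obtain ⟨H', hH'⟩ := h'.isSplit p' hp'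
  exact ⟨p', hp', hi', ModExt.IsSplit.eq_of_common hφ hφ' hr hr' hi hi' hH hH' haF hap hap'⟩

end Components

/-! ### Unique factorization of modular extensions -/

section Decomposition

variable {L : Type u} [Lattice L] [BoundedOrder L] [IsGeometric L]

namespace ModExt

theorem Iso.pushout {E₁ E₁' E₂ E₂' : ModExt L} (h₁ : E₁.Iso E₁') (h₂ : E₂.Iso E₂') :
    (E₁.pushout E₂).Iso (E₁'.pushout E₂') := by
  obtain ⟨e₁, h₁⟩ := h₁
  obtain ⟨e₂, h₂⟩ := h₂
  have r₁ := (IsHom.of_orderIso e₁ h₁).restr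
  have r₂ := (IsHom.of_orderIso e₂ h₂).restr
  refine ⟨?_, ?_⟩
  exact
    { toFun := fun p => ⟨(e₁ p.1.1, e₂ p.1.2), by rw [r₁, r₂, p.2]⟩
      invFun := fun p => ⟨(e₁.symm p.1.1, e₂.symm p.1.2), by
        rw [← r₁, ← r₂, e₁.apply_symm_apply, e₂.apply_symm_apply, p.2]⟩
      left_inv := fun p => Pushout.ext (e₁.symm_apply_apply _) (e₂.symm_apply_apply _)
      right_inv := fun p => Pushout.ext (e₁.apply_symm_apply _) (e₂.apply_symm_apply _)
      map_rel_iff' := by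
        intro p q
        show e₁ p.1.1 ≤ e₁ q.1.1 ∧ e₂ p.1.2 ≤ e₂ q.1.2 ↔ p.1.1 ≤ q.1.1 ∧ p.1.2 ≤ q.1.2
        rw [e₁.le_iff_le, e₂.le_iff_le] }
  exact fun l => Pushout.ext (h₁ l) (h₂ l)

theorem pushout_assoc_iso (E₁ E₂ E₃ : ModExt L) :
    ((E₁.pushout E₂).pushout E₃).Iso (E₁.pushout (E₂.pushout E₃)) := by
  refine ⟨?_, ?_⟩
  exact
    { toFun := fun p => ⟨(p.1.1.1.1, ⟨(p.1.1.1.2, p.1.2),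
          (p.1.1.2.symm.trans (restr_pushout p.1.1).symm).trans p.2⟩),
        p.1.1.2.trans (restr_pushout (E₁ := E₂) (E₂ := E₃) ⟨(p.1.1.1.2, p.1.2),
          (p.1.1.2.symm.trans (restr_pushout p.1.1).symm).trans p.2⟩).symm⟩
      invFun := fun p => ⟨(⟨(p.1.1, p.1.2.1.1), p.2.trans (restr_pushout p.1.2)⟩, p.1.2.1.2),
        ((restr_pushout (E₁ := E₁) (E₂ := E₂) ⟨(p.1.1, p.1.2.1.1),
          p.2.trans (restr_pushout p.1.2)⟩).trans (p.2.trans (restr_pushout p.1.2))).trans p.1.2.2⟩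
      left_inv := fun p => rfl
      right_inv := fun p => rfl
      map_rel_iff' := by
        intro p q
        show (p.1.1.1.1 ≤ q.1.1.1.1 ∧ (p.1.1.1.2 ≤ q.1.1.1.2 ∧ p.1.2 ≤ q.1.2)) ↔
          ((p.1.1.1.1 ≤ q.1.1.1.1 ∧ p.1.1.1.2 ≤ q.1.1.1.2) ∧ p.1.2 ≤ q.1.2)
        tauto }
  exact fun l => rfl

theorem self_pushout_iso (E : ModExt L) : E.Iso ((ModExt.self L).pushout E) :=
  ⟨{ toFun := fun x => Pushout.inr x
     invFun := fun p => p.1.2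
     left_inv := fun _ => rfl
     right_inv := fun p => Pushout.ext (p.2.symm.trans (self_restr _)) rfl
     map_rel_iff' := Pushout.inr_le }, fun l => (Pushout.base_eq_inr l).symm⟩

theorem pushout_self_iso (E : ModExt L) : E.Iso (E.pushout (ModExt.self L)) :=
  ⟨{ toFun := fun x => Pushout.inl x
     invFun := fun p => p.1.1
     left_inv := fun _ => rfl
     right_inv := fun p => Pushout.ext rfl (p.2.trans (self_restr _))
     map_rel_iff' := Pushout.inl_le }, fun l => (Pushout.base_eq_inl l).symm⟩

theorem pushoutList_append_iso (l l' : List (ModExt L)) :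
    ((pushoutList l).pushout (pushoutList l')).Iso (pushoutList (l ++ l')) := by
  induction l with
  | nil => exact (self_pushout_iso _).symm
  | cons E l ih => exact (pushout_assoc_iso _ _ _).trans ((Iso.refl E).pushout ih)

theorem IsTrivial.iso_self {E : ModExt L} (h : E.IsTrivial) : E.Iso (ModExt.self L) := by
  have hE : IsHom (ModExt.self L) E E.incl := ⟨E.isEmbedding, fun _ => rfl⟩
  exact ⟨(hE.toOrderIso h).symm, fun l => (hE.toOrderIso h).symm_apply_apply l⟩

/-- If E₁ filled the pushout, the top of E₂ would come from E₁ and thus lie in L. This drives the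
inductions on cardinality. -/
theorem card_lt_pushout_left {E₁ E₂ : ModExt L} (h : ¬ E₂.IsTrivial) :
    Nat.card E₁.carrier < Nat.card (Pushout E₁ E₂) := by
  have := Fintype.ofFinite E₁.carrier
  have := Fintype.ofFinite (Pushout E₁ E₂)
  rw [Nat.card_eq_fintype_card, Nat.card_eq_fintype_card]
  refine Fintype.card_lt_of_injective_not_surjective _ (isHom_inl E₁ E₂).1.1 fun hs => h ?_
  obtain ⟨x, hx⟩ := hs (Pushout.inr ⊤)
  apply isTrivial_of_flat_eq_top
  have h2 : E₂.incl (E₁.restr x) = ⊤ := congrArg (fun p : Pushout E₁ E₂ => p.1.2) hx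
  rw [← h2]
  exact E₂.incl_le_flat _

theorem card_lt_pushout_right {E₁ E₂ : ModExt L} (h : ¬ E₁.IsTrivial) :
    Nat.card E₂.carrier < Nat.card (Pushout E₁ E₂) :=
  (card_lt_pushout_left h).trans_eq
    (Nat.card_congr (Pushout.swap (E₁ := E₂) (E₂ := E₁)).toEquiv)

/-- Every modular extension is an iterated pushout of irreducible ones. -/
theorem exists_iso_pushoutList (E : ModExt L) :
    ∃ l : List (ModExt L), (∀ E' ∈ l, E'.IsIrreducible) ∧ E.Iso (pushoutList l) := by
  induction hn : Nat.card E.carrier using Nat.strong_induction_on generalizing E with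
  | _ n ih =>
    by_cases ht : E.IsTrivial
    · exact ⟨[], by simp, ht.iso_self⟩
    by_cases hi : E.IsIrreducible
    · exact ⟨[E], by simpa using hi, pushout_self_iso E⟩
    obtain ⟨E₁, E₂, h₁, h₂, e⟩ := not_not.1 fun h => hi ⟨ht, h⟩
    have hc : Nat.card E.carrier = Nat.card (Pushout E₁ E₂) := Nat.card_congr e.choose.toEquiv
    obtain ⟨l₁, hl₁, e₁⟩ := ih _ (hn ▸ hc ▸ card_lt_pushout_left h₂) E₁ rfl
    obtain ⟨l₂, hl₂, e₂⟩ := ih _ (hn ▸ hc ▸ card_lt_pushout_right h₁) E₂ rfl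
    refine ⟨l₁ ++ l₂, fun E' h => ?_, (e.trans (e₁.pushout e₂)).trans (pushoutList_append_iso _ _)⟩
    exact (List.mem_append.1 h).elim (hl₁ E') (hl₂ E')

/-- A modular extension with the empty word. -/
@[reducible] def emptyDiag (E : ModExt L) : ModDiag L := ⟨E, [], by simp⟩

theorem mulList_emptyDiag (l : List (ModExt L)) :
    (ModDiag.mulList (l.map emptyDiag)).toModExt = pushoutList l := by
  induction l with
  | nil => rfl
  | cons E l ih => exact congrArg E.pushout ih

/-- Equipped with empty words, bare extensions fall under the decompositions of diagrams; J and the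
blocks carry no information. -/
theorem exists_family_of_iso {E : ModExt L} {l : List (ModExt L)} (h : E.Iso (pushoutList l)) :
    ∃ J ps, ps.map Prod.fst = l ∧ IsFamily emptyDiag E J ps := by
  obtain ⟨ps, hps, hf⟩ := exists_family emptyDiag l
  rw [← mulList_emptyDiag] at h
  obtain ⟨e, he⟩ := h.symm
  refine ⟨_, _, ?_, hf.map e he⟩
  rw [List.map_map]
  exact hps

/-- Distinct components meet inside L, so a repeated interval would lie in L and its component would
be trivial. -/
theorem nodup_family {E : ModExt L} {J : List E.carrier}
    {ps : List (ModExt L × E.carrier × List E.carrier)} (h : IsFamily emptyDiag E J ps)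
    (hi : ∀ p ∈ ps, p.1.IsIrreducible) : (ps.map fun p => p.2.1).Nodup := by
  rw [List.Nodup, List.pairwise_map]
  refine h.pairwise.imp_of_mem fun {p q} hp _ hpq e => (hi p hp).1 ?_
  rw [← e, inf_idem] at hpq
  exact (h.isComponent p hp).isTrivial_of_le hpq

/-- The decomposition in irreducible extensions is unique up to order and isomorphism. -/
theorem pushoutList_unique {E : ModExt L} {l l' : List (ModExt L)}
    (hl : ∀ E' ∈ l, E'.IsIrreducible) (hl' : ∀ E' ∈ l', E'.IsIrreducible)
    (h : E.Iso (pushoutList l)) (h' : E.Iso (pushoutList l')) :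
    ∃ l'' : List (ModExt L), l''.Perm l' ∧ List.Forall₂ Iso l l'' := by
  obtain ⟨J, ps, rfl, hf⟩ := exists_family_of_iso h
  obtain ⟨J', ps', rfl, hf'⟩ := exists_family_of_iso h'
  replace hl : ∀ p ∈ ps, p.1.IsIrreducible := fun p hp => hl _ (List.mem_map_of_mem hp)
  replace hl' : ∀ p ∈ ps', p.1.IsIrreducible := fun p hp => hl' _ (List.mem_map_of_mem hp)
  -- Both lists of intervals are repetition-free and have the same members, since each irreducible
  -- component occurs in the other decomposition.
  have hperm : (ps.map fun p => p.2.1).Perm (ps'.map fun p => p.2.1) := by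
    rw [List.perm_ext_iff_of_nodup (nodup_family hf hl) (nodup_family hf' hl')]
    intro G
    simp only [List.mem_map]
    constructor
    · rintro ⟨p, hp, rfl⟩
      obtain ⟨p', hp', -, e⟩ := hf.exists_eq hf' (fun p hp => Or.inr (hl' p hp)) hp (hl p hp)
      exact ⟨p', hp', e.symm⟩
    · rintro ⟨p, hp, rfl⟩
      obtain ⟨p', hp', -, e⟩ := hf'.exists_eq hf (fun p hp => Or.inr (hl p hp)) hp (hl' p hp)
      exact ⟨p', hp', e.symm⟩
  let R : ModExt L → E.carrier → Prop := fun E' G => ∃ B, IsComponent E (emptyDiag E') G B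
  have hR : List.Forall₂ R (ps.map Prod.fst) (ps.map fun p => p.2.1) := by
    rw [List.forall₂_map_left_iff, List.forall₂_map_right_iff, List.forall₂_same]
    exact fun p hp => ⟨_, hf.isComponent p hp⟩
  have hR' : List.Forall₂ R (ps'.map Prod.fst) (ps'.map fun p => p.2.1) := by
    rw [List.forall₂_map_left_iff, List.forall₂_map_right_iff, List.forall₂_same]
    exact fun p hp => ⟨_, hf'.isComponent p hp⟩
  -- The permutation of the intervals is pulled back to a reordering of l', after which the two
  -- lists occupy the same intervals term by term.
  have hc : Relation.Comp (List.Forall₂ R) List.Perm (ps'.map Prod.fst)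
      (ps.map fun p => p.2.1) := ⟨_, hR', hperm.symm⟩
  rw [List.forall₂_comp_perm_eq_perm_comp_forall₂] at hc
  obtain ⟨l'', hp, hR''⟩ := hc
  refine ⟨l'', hp.symm, ?_⟩
  clear hp hperm
  generalize ps.map Prod.fst = l at hR
  generalize (ps.map fun p => p.2.1) = gs at hR hR''
  induction hR generalizing l'' with
  | nil => cases hR''; exact .nil
  | cons hh _ ih =>
    cases hR'' with
    | cons hh' ht =>
      obtain ⟨B, hB⟩ := hh
      obtain ⟨B', hB'⟩ := hh'
      exact .cons (hB.iso hB') (ih _ ht)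

end ModExt

end Decomposition

/-! ### Matching a diagram with a reduced diagram -/

section Match

variable {L : Type u} [Lattice L] [BoundedOrder L]

open MD

/-- `M` embeds in `Γ` with the same rank, and the words correspond up to a permutation of sign
`ε`. -/
def Match (ε : ℤˣ) (M Γ : ModDiag L) : Prop :=
  ∃ ψ : M.carrier → Γ.carrier, ModExt.IsHom M.toModExt Γ.toModExt ψ ∧ ψ ⊤ = ⊤ ∧
    SPerm ε (M.word.map ψ) Γ.word

/-- Every atom outside `L` is a letter. -/
def ModDiag.IsReduced (Γ : ModDiag L) : Prop := ∀ a, IsAtom a → a ≤ Γ.flat ∨ a ∈ Γ.word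

theorem Match.refl (M : ModDiag L) : Match 1 M M :=
  ⟨id, .id _, rfl, .of_eq (List.map_id _)⟩

theorem Match.sperm {ε ε' : ℤˣ} {M : ModDiag L} {E : ModExt L} {J J' : List E.carrier}
    {hJ : ∀ x ∈ J, IsAtom x} (hJ' : ∀ x ∈ J', IsAtom x) (h : Match ε M ⟨E, J, hJ⟩)
    (hs : SPerm ε' J J') : Match (ε * ε') M ⟨E, J', hJ'⟩ := by
  obtain ⟨ψ, hψ, h1, h2⟩ := h
  exact ⟨ψ, hψ, h1, h2.trans hs⟩

theorem Match.comp {ε : ℤˣ} {M Γ Γ' : ModDiag L} (h : Match ε M Γ) {φ : Γ.carrier → Γ'.carrier}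
    (hφ : ModExt.IsHom Γ.toModExt Γ'.toModExt φ) (h1 : φ ⊤ = ⊤) (hJ : Γ'.word = Γ.word.map φ) :
    Match ε M Γ' := by
  obtain ⟨ψ, hψ, h2, h3⟩ := h
  refine ⟨φ ∘ ψ, hφ.comp hψ, by simp [h1, h2], ?_⟩
  rw [hJ, ← List.map_map]
  exact h3.map φ

/-- The image of a reduced diagram is generated by L and the letters, and M contains both, so the
embedding of M' factors through M. Signs multiply because the embedding of M is injective on
letters. -/
theorem Match.lift {ε ε' : ℤˣ} {M M' Γ : ModDiag L} (hM' : M'.IsReduced) (h : Match ε M Γ)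
    (h' : Match ε' M' Γ) : Match (ε' * ε) M' M := by
  obtain ⟨ψ, hψ, h1, h2⟩ := h
  obtain ⟨ψ', hψ', h1', h2'⟩ := h'
  obtain ⟨θ, hθ, hc⟩ := hψ.lift hψ' (hψ.mem_range hψ' fun a ha => (hM' a ha).imp id fun hw => by
    have : ψ' a ∈ M.word.map ψ := h2.perm.mem_iff.2 (h2'.perm.mem_iff.1 (List.mem_map_of_mem hw))
    obtain ⟨x, -, hx⟩ := List.mem_map.1 this
    exact ⟨x, hx⟩)
  refine ⟨θ, hθ, hψ.1.1 (by rw [hc, h1', h1]), SPerm.of_map hψ.1.1 ?_⟩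
  rw [List.map_map]
  exact (List.map_congr_left (fun x _ => hc x) ▸ h2').trans h2.symm

theorem Match.of_comp {ε : ℤˣ} {M Γ Γ' : ModDiag L} (hM : M.IsReduced) (h : Match ε M Γ')
    {φ : Γ.carrier → Γ'.carrier} (hφ : ModExt.IsHom Γ.toModExt Γ'.toModExt φ) (h1 : φ ⊤ = ⊤)
    (hJ : Γ'.word = Γ.word.map φ) : Match ε M Γ := by
  have : Match 1 Γ Γ' := ⟨φ, hφ, h1, .of_eq hJ.symm⟩
  simpa using this.lift hM h

/-- Every atom of a reduced target is in L or is a letter, hence is reached; so the embedding is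
onto. -/
theorem Match.exists_orderIso {ε : ℤˣ} {M M' : ModDiag L} (hM : M.IsReduced)
    (h : Match ε M' M) : ∃ θ : M'.carrier ≃o M.carrier, (∀ l, θ (M'.incl l) = M.incl l) ∧
      SPerm ε (M'.word.map θ) M.word := by
  obtain ⟨θ, hθ, -, hs⟩ := h
  have hsurj : Function.Surjective θ := fun x =>
    hθ.mem_range (ModExt.IsHom.id M.toModExt) (fun a ha => (hM a ha).imp id fun hw => by
      obtain ⟨x, -, hx⟩ := List.mem_map.1 (hs.perm.mem_iff.2 hw)
      exact ⟨x, hx⟩) x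
  exact ⟨hθ.toOrderIso hsurj, fun l => (hθ.2 l).symm, hs⟩

/-- The top of Γ is the image of the top of M, a join of atoms that are in L or letters. -/
theorem Match.spanning {ε : ℤˣ} {M Γ : ModDiag L} (hM : M.IsReduced) (h : Match ε M Γ)
    {T : Γ.carrier} (hF : Γ.flat ≤ T) (hT : ∀ x ∈ Γ.word, x ≤ T) : T = ⊤ := by
  obtain ⟨ψ, hψ, h1, hs⟩ := h
  rw [eq_top_iff, ← h1]
  induction (⊤ : M.carrier) using atom_induction with
  | h0 => rw [hψ.map_bot]; exact bot_le
  | hs x a ha hx =>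
    rw [hψ.1.map_sup]
    refine sup_le hx ((hM a ha).elim (fun h => ?_) fun h => ?_)
    · exact (hψ.le_flat_iff.2 h).trans hF
    · exact hT _ (hs.perm.mem_iff.1 (List.mem_map_of_mem h))

end Match

/-! ### Reduced diagrams, and why products of generators escape the vanishing relations -/

section Reduced

variable {L : Type u} [Lattice L] [BoundedOrder L]

theorem IsComponent.mem_of_isReduced {E : ModExt L} {Γ : ModDiag L} {G : E.carrier}
    {B : List E.carrier} (h : IsComponent E Γ G B) (hΓ : Γ.IsReduced) {a : E.carrier}
    (ha : IsAtom a) (haG : a ≤ G) : a ≤ E.flat ∨ a ∈ B := by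
  obtain ⟨φ, hφ, hr, rfl⟩ := h
  obtain ⟨x, rfl⟩ : a ∈ Set.range φ := hr ▸ haG
  exact (hΓ x (hφ.isAtom_iff.1 ha)).imp hφ.le_flat_iff.2 fun h => List.mem_map_of_mem h

theorem IsFamily.mem_word {I : Type v} {f : I → ModDiag L} {E : ModExt L} {J : List E.carrier}
    {ps : List (I × E.carrier × List E.carrier)} (h : IsFamily f E J ps) {a : E.carrier} :
    a ∈ J ↔ ∃ p ∈ ps, a ∈ p.2.2 := by
  rw [h.word, List.mem_flatten]
  constructor
  · rintro ⟨b, hb, hab⟩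
    obtain ⟨p, hp, rfl⟩ := List.mem_map.1 hb
    exact ⟨p, hp, hab⟩
  · rintro ⟨p, hp, hap⟩
    exact ⟨_, List.mem_map_of_mem hp, hap⟩

theorem ModExt.bot_ne_flat [Nontrivial L] (E : ModExt L) : (⊥ : E.carrier) ≠ E.flat := by
  rw [← E.incl_bot]
  exact fun h => bot_ne_top (E.isEmbedding.injective h)

end Reduced

section Generators

variable {L : Type u} [Lattice L] [BoundedOrder L] [IsGeometric L]

open MD

theorem ModDiag.IsGenerator.isReduced {Γ : ModDiag L} (h : Γ.IsGenerator) : Γ.IsReduced := by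
  rcases h with ⟨ht, -⟩ | ⟨-, -, h⟩
  · exact fun a _ => Or.inl (ht.le_flat a)
  · exact h

theorem ModDiag.isReduced_mulList {I : Type v} (f : I → ModDiag L) (l : List I)
    (hl : ∀ i ∈ l, (f i).IsReduced) : (ModDiag.mulList (l.map f)).IsReduced := by
  obtain ⟨ps, hps, h⟩ := exists_family f l
  intro a ha
  by_contra! hn
  obtain ⟨p, hp, hap⟩ := (h.cover a ha).resolve_left hn.1
  have hpl : p.1 ∈ ps.map Prod.fst := List.mem_map_of_mem hp
  rw [hps] at hpl
  rcases (h.isComponent p hp).mem_of_isReduced (hl _ hpl) ha hap with h' | h'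
  · exact hn.1 h'
  · exact hn.2 (h.mem_word.2 ⟨p, hp, h'⟩)

/-- The letters of a matched diagram are distributed among the factors. -/
theorem Match.exists_blocks {I : Type v} {f : I → ModDiag L} {l : List I} {ε : ℤˣ} {Γ : ModDiag L}
    (h : Match ε (ModDiag.mulList (l.map f)) Γ) :
    ∃ Bs : List (I × List Γ.carrier), Γ.word.Perm (Bs.map Prod.snd).flatten ∧ ∀ B ∈ Bs, B.1 ∈ l ∧
      ∃ χ, ModExt.IsHom (f B.1).toModExt Γ.toModExt χ ∧ B.2 = (f B.1).word.map χ := by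
  obtain ⟨ps, hps, hf⟩ := exists_family f l
  obtain ⟨ψ, hψ, -, hs⟩ := h
  refine ⟨ps.map fun p => (p.1, p.2.2.map ψ), ?_, fun B hB => ?_⟩
  · refine hs.perm.symm.trans (.of_eq ?_)
    rw [hf.word, List.map_flatten, List.map_map, List.map_map]
    rfl
  · obtain ⟨p, hp, rfl⟩ := List.mem_map.1 hB
    obtain ⟨φ, hφ, -, hB⟩ := hf.isComponent p hp
    have hpl : p.1 ∈ ps.map Prod.fst := List.mem_map_of_mem hp
    rw [hps] at hpl
    refine ⟨hpl, ψ ∘ φ, hψ.comp hφ, ?_⟩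
    rw [← List.map_map, ← hB]

variable [Nontrivial L]

/-- Intervals of products with `L` in one factor. -/
theorem cls_image_prod {Γ : ModDiag L} {E : ModExt L} {χ : Γ.carrier → E.carrier}
    (hχ : ModExt.IsHom Γ.toModExt E χ) (A B : Type u) [PartialOrder A] [PartialOrder B]
    [OrderBot B] (e : E.carrier ≃o A × B) (h : (e E.flat).2 = ⊥) (hne : (e (χ ⊤)).2 ≠ ⊥) :
    cls Γ = 0 := by
  have hle : ∀ x, χ x ≤ χ ⊤ := hχ.le_top
  rw [← cls_image Γ hχ (χ ⊤) hχ.flat_le hle rfl]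
  have hF := e.le_iff_le.2 hχ.flat_le
  let e' : Set.Iic (χ ⊤) ≃o Set.Iic (e (χ ⊤)).1 × Set.Iic (e (χ ⊤)).2 :=
    { toFun := fun x => (⟨(e x.1).1, (e.le_iff_le.2 x.2).1⟩, ⟨(e x.1).2, (e.le_iff_le.2 x.2).2⟩)
      invFun := fun p => ⟨e.symm (p.1.1, p.2.1), by
        rw [Set.mem_Iic, OrderIso.symm_apply_le]
        exact ⟨p.1.2, p.2.2⟩⟩
      left_inv := fun x => Subtype.ext (e.symm_apply_apply _)
      right_inv := fun p => Prod.ext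
        (Subtype.ext (congrArg Prod.fst (e.apply_symm_apply (p.1.1, p.2.1)) :))
        (Subtype.ext (congrArg Prod.snd (e.apply_symm_apply (p.1.1, p.2.1)) :))
      map_rel_iff' := by
        intro x y
        show (e x.1).1 ≤ (e y.1).1 ∧ (e x.1).2 ≤ (e y.1).2 ↔ x.1 ≤ y.1
        rw [← e.le_iff_le, Prod.le_def] }
  -- Here L has to be non-trivial: ⊥ and F differ but both have second coordinate ⊥, so their first
  -- coordinates differ.
  have hA : Nontrivial (Set.Iic (e (χ ⊤)).1) := by
    refine ⟨⟨(e ⊥).1, (e.le_iff_le.2 bot_le).1⟩, ⟨(e E.flat).1, hF.1⟩, fun h' => ?_⟩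
    refine E.bot_ne_flat (e.injective (Prod.ext (congrArg Subtype.val h') ?_))
    rw [h]
    exact le_bot_iff.1 ((e.le_iff_le.2 bot_le).2.trans_eq h)
  have hB : Nontrivial (Set.Iic (e (χ ⊤)).2) :=
    ⟨⊥, ⊤, fun h' => hne (congrArg Subtype.val h').symm⟩
  exact proj_rel (.prod (Γ.image hχ (χ ⊤) hχ.flat_le hle) _ _ e' (Subtype.ext h))

/-- A diagram with an atom that is a direct factor vanishes. -/
theorem cls_eq_zero_of_coloop (Γ : ModDiag L) {H h : Γ.carrier} (hh : IsAtom h) (hH : Γ.flat ≤ H)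
    (hhH : ¬ h ≤ H) (ha : ∀ a, IsAtom a → a ≤ H ∨ a = h) : cls Γ = 0 := by
  -- Each atom is below H or equal to h, so the meets with H and h detect the order.
  have hle : ∀ {x y}, x ⊓ H ≤ y → x ⊓ h ≤ y → x ≤ y := by
    intro x y h1 h2
    rw [le_iff_atom_le_imp]
    intro a haa hax
    rcases ha a haa with h' | rfl
    · exact (le_inf hax h').trans h1
    · exact (le_inf hax le_rfl).trans h2
  have hcases : ∀ v : Set.Iic h, v.1 = ⊥ ∨ v.1 = h := fun v => hh.le_iff.1 v.2
  have hbot : h ⊓ H = ⊥ := (hh.le_iff.1 inf_le_left).resolve_right fun e => hhH (e ▸ inf_le_right)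
  -- The element p ∨ h covers p, and its meet with H lies between the two without containing h.
  have e1 : ∀ (p : Set.Iic H) (v : Set.Iic h), (p.1 ⊔ v.1) ⊓ H ≤ p.1 := by
    intro p v
    rcases hcases v with h' | h'
    · rw [h', sup_bot_eq]
      exact inf_le_left
    · rw [h']
      have hp : ¬ h ≤ p.1 := fun h' => hhH (h'.trans p.2)
      rcases (covBy_sup_atom hh hp).eq_or_eq (c := (p.1 ⊔ h) ⊓ H) (le_inf le_sup_left p.2)
        inf_le_left with h2 | h2
      · exact h2.le
      · exact absurd (le_sup_right.trans (h2.ge.trans inf_le_right)) hhH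
  have e2 : ∀ (p : Set.Iic H) (v : Set.Iic h), (p.1 ⊔ v.1) ⊓ h ≤ v.1 := by
    intro p v
    rcases hcases v with h' | h'
    · rw [h', sup_bot_eq, ← hbot, inf_comm h H]
      exact inf_le_inf_right h p.2
    · rw [h']
      exact inf_le_right
  let e : Γ.carrier ≃o Set.Iic H × Set.Iic h :=
    { toFun := fun x => (⟨x ⊓ H, inf_le_right⟩, ⟨x ⊓ h, inf_le_right⟩)
      invFun := fun p => p.1.1 ⊔ p.2.1
      left_inv := fun x => le_antisymm (sup_le inf_le_left inf_le_left) (hle le_sup_left le_sup_right)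
      right_inv := fun p => Prod.ext
        (Subtype.ext (le_antisymm (e1 p.1 p.2) (le_inf le_sup_left p.1.2)))
        (Subtype.ext (le_antisymm (e2 p.1 p.2) (le_inf le_sup_right p.2.2)))
      map_rel_iff' := by
        intro x y
        show x ⊓ H ≤ y ⊓ H ∧ x ⊓ h ≤ y ⊓ h ↔ x ≤ y
        exact ⟨fun h' => hle (h'.1.trans inf_le_left) (h'.2.trans inf_le_left),
          fun h' => ⟨inf_le_inf_right _ h', inf_le_inf_right _ h'⟩⟩ }
  have hA : Nontrivial (Set.Iic H) :=
    ⟨⟨⊥, bot_le⟩, ⟨Γ.flat, hH⟩, fun h' => Γ.bot_ne_flat (congrArg Subtype.val h')⟩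
  have hB : Nontrivial (Set.Iic h) :=
    ⟨⟨⊥, bot_le⟩, ⟨h, le_rfl⟩, fun h' => hh.1 (congrArg Subtype.val h').symm⟩
  refine proj_rel (.prod Γ _ _ e (Subtype.ext ?_))
  show Γ.flat ⊓ h = ⊥
  rw [← le_bot_iff, ← hbot, inf_comm]
  exact inf_le_inf_left h hH

/-- If all letters lay in the factor containing L, they would not span. Otherwise some factor of the
monomial reaches into B; the interval that it occupies is then itself a product, and its class
vanishes. -/
theorem Match.not_prod {I : Type v} {f : I → ModDiag L} {l : List I}
    (hg : ∀ i ∈ l, (f i).IsGenerator) (h0 : ∀ i ∈ l, cls (f i) ≠ 0) {ε : ℤˣ} {Γ : ModDiag L}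
    (h : Match ε (ModDiag.mulList (l.map f)) Γ) (A B : Type u) [PartialOrder A]
    [PartialOrder B] [OrderBot B] [Nontrivial B] (e : Γ.carrier ≃o A × B)
    (hF : (e Γ.flat).2 = ⊥) : False := by
  obtain ⟨Bs, hp, hB⟩ := h.exists_blocks
  have hred := ModDiag.isReduced_mulList f l fun i hi => (hg i hi).isReduced
  have hT : ∀ y : Γ.carrier, y ≤ e.symm ((e ⊤).1, ⊥) ↔ (e y).2 = ⊥ := fun y => by
    rw [← e.le_iff_le, e.apply_symm_apply, Prod.le_def, le_bot_iff, and_iff_right]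
    exact (e.le_iff_le.2 le_top).1
  by_cases hJ : ∀ x ∈ Γ.word, x ≤ e.symm ((e ⊤).1, ⊥)
  · have h1 := h.spanning hred ((hT _).2 hF) hJ
    have h2 := (hT ⊤).1 h1.ge
    obtain ⟨b, hb⟩ := exists_ne (⊥ : B)
    have h3 := e.le_iff_le.2 (le_top : e.symm ((e ⊤).1, b) ≤ ⊤)
    rw [e.apply_symm_apply] at h3
    exact hb (le_bot_iff.1 (h3.2.trans_eq h2))
  · push Not at hJ
    obtain ⟨x, hx, hxT⟩ := hJ
    rw [hp.mem_iff, List.mem_flatten] at hx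
    obtain ⟨b, hb, hxb⟩ := hx
    obtain ⟨q, hq, rfl⟩ := List.mem_map.1 hb
    obtain ⟨hql, χ, hχ, hqB⟩ := hB q hq
    refine h0 q.1 hql (cls_image_prod hχ A B e hF fun h' => hxT ?_)
    rw [hqB] at hxb
    obtain ⟨y, -, rfl⟩ := List.mem_map.1 hxb
    exact (hχ.le_top y).trans ((hT _).2 h')

-- The two letters outside F are distributed among the blocks. If one block has both, relation (5)
-- kills it on its own interval. If a block has only one, that letter is a direct factor and
-- relation (4) kills it. Both contradict the non-zero classes.
open Classical in
theorem Match.not_two {I : Type v} {f : I → ModDiag L} {l : List I}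
    (hg : ∀ i ∈ l, (f i).IsGenerator) (h0 : ∀ i ∈ l, cls (f i) ≠ 0) {ε : ℤˣ} {Γ : ModDiag L}
    (h : Match ε (ModDiag.mulList (l.map f)) Γ) (F : Γ.carrier)
    (hF : IsModularFlat F) (hle : Γ.flat ≤ F)
    (h2 : (Γ.word.filter fun x => ¬ x ≤ F).length = 2) : False := by
  obtain ⟨Bs, hp, hB⟩ := h.exists_blocks
  rw [(hp.filter _).length_eq, List.filter_flatten, List.length_flatten, List.map_map,
    List.map_map] at h2
  have key : ∀ s : List ℕ, s.sum = 2 → 1 ∈ s ∨ 2 ∈ s := by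
    intro s
    induction s with
    | nil => simp
    | cons n s ih =>
      intro hs
      rw [List.sum_cons] at hs
      rcases (by omega : n = 0 ∨ n = 1 ∨ n = 2) with rfl | rfl | rfl
      · rw [zero_add] at hs
        exact (ih hs).imp (List.mem_cons_of_mem _) (List.mem_cons_of_mem _)
      · simp
      · simp
  rcases key _ h2 with h3 | h3
  · obtain ⟨q, hq, hlen⟩ := List.mem_map.1 h3
    obtain ⟨hql, χ, hχ, hqB⟩ := hB q hq
    simp only [Function.comp, hqB, List.filter_map, List.length_map] at hlen
    obtain ⟨x, hx⟩ := List.length_eq_one_iff.1 hlen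
    have hxm : x ∈ (f q.1).word ∧ ¬ χ x ≤ F := by
      have : x ∈ [x] := List.mem_singleton_self x
      rw [← hx, List.mem_filter] at this
      simpa using this
    -- H is the join of F and all letters of this block except x. As x is not below the modular
    -- element, it is not below H, and reducedness leaves no further atoms.
    refine h0 q.1 hql (cls_eq_zero_of_coloop (f q.1) (h := x)
      (H := (f q.1).flat ⊔ listJoin ((f q.1).word.filter fun y => χ y ≤ F))
      ((f q.1).word_atom x hxm.1) le_sup_left (fun hxH => hxm.2 ?_) fun a ha => ?_)
    · refine (hχ.le_iff.2 hxH).trans ?_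
      rw [hχ.1.map_sup, hχ.map_flat, hχ.1.map_listJoin hχ.map_bot]
      refine sup_le hle (listJoin_le fun z hz => ?_)
      obtain ⟨y, hy, rfl⟩ := List.mem_map.1 hz
      simpa using (List.mem_filter.1 hy).2
    · rcases (hg q.1 hql).isReduced a ha with h' | h'
      · exact Or.inl (h'.trans le_sup_left)
      · by_cases haF : χ a ≤ F
        · refine Or.inl (le_trans (le_listJoin ?_) le_sup_right)
          rw [List.mem_filter]
          exact ⟨h', by simpa using haF⟩
        · right
          have : a ∈ [x] := by
            rw [← hx, List.mem_filter]
            exact ⟨h', by simpa using haF⟩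
          simpa using this
  · obtain ⟨q, hq, hlen⟩ := List.mem_map.1 h3
    obtain ⟨hql, χ, hχ, hqB⟩ := hB q hq
    simp only [Function.comp, hqB, List.filter_map, List.length_map] at hlen
    refine h0 q.1 hql ?_
    rw [← cls_image (f q.1) hχ (χ ⊤) hχ.flat_le hχ.le_top rfl]
    -- Modularity of F passes to its trace on a lower interval.
    let F' : Set.Iic (χ ⊤) := ⟨F ⊓ χ ⊤, inf_le_right⟩
    refine proj_rel (.two _ F' ?_ (le_inf hle hχ.flat_le) ?_)
    · intro A B hA
      refine Subtype.ext ?_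
      have hAF : A.1 ≤ F := le_trans (show A.1 ≤ F ⊓ χ ⊤ from hA) inf_le_left
      show F ⊓ χ ⊤ ⊓ (A.1 ⊔ B.1) = A.1 ⊔ F ⊓ χ ⊤ ⊓ B.1
      rw [inf_assoc, inf_eq_right.2 (sup_le A.2 B.2), hF _ _ hAF, inf_assoc, inf_eq_right.2 B.2]
    · rw [List.filter_map, List.length_map, ← hlen]
      congr 2
      funext y
      simp only [Function.comp, decide_not, Bool.not_eq_eq_eq_not, Bool.not_not, decide_eq_decide]
      exact ⟨fun h => le_trans h inf_le_left, fun h => le_inf h (hχ.le_top y)⟩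

end Generators

/-- Degrees matter for signs only through their parity, which for diagrams is that of the word
length; this converts the Koszul sign into the sign of a block exchange. -/
theorem negOnePow_mul_eq {m n : ℤ} {a b : ℕ} (ha : (-1 : ℤˣ) ^ a = m.negOnePow)
    (hb : (-1 : ℤˣ) ^ b = n.negOnePow) : (m * n).negOnePow = (-1) ^ (a * b) := by
  rw [Int.negOnePow_def, zpow_mul, ← Int.negOnePow_def, ← ha, ← zpow_natCast, ← zpow_mul, mul_comm,
    zpow_mul, ← Int.negOnePow_def, ← hb, zpow_natCast, ← pow_mul, mul_comm]

/-! ### Monomials in the free graded commutative algebra -/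

namespace FreeGradedComm

variable {X : Type w} {deg : X → ℤ}

/-- Monomials. -/
noncomputable def mono (deg : X → ℤ) (l : List X) : FreeGradedComm deg := (l.map (gen deg)).prod

theorem mono_cons (x : X) (l : List X) : mono deg (x :: l) = gen deg x * mono deg l := by
  rw [mono, List.map_cons, List.prod_cons, mono]

theorem mono_append (l l' : List X) : mono deg (l ++ l') = mono deg l * mono deg l' := by
  rw [mono, List.map_append, List.prod_append, mono, mono]

theorem gen_mul_gen (x y : X) :
    gen deg x * gen deg y = (deg x * deg y).negOnePow • (gen deg y * gen deg x) := by
  have := RingQuot.mkAlgHom_rel ℚ (GCRel.comm (deg := deg) x y)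
  rw [map_mul, map_zsmul, map_mul] at this
  exact this

theorem gen_mul_mono (x : X) (l : List X) : gen deg x * mono deg l =
    (deg x * (l.map deg).sum).negOnePow • (mono deg l * gen deg x) := by
  induction l with
  | nil => simp [mono]
  | cons y l ih =>
    rw [mono_cons, ← mul_assoc, gen_mul_gen, smul_mul_assoc, mul_assoc, ih, mul_smul_comm,
      smul_smul, ← mul_assoc, List.map_cons, List.sum_cons, mul_add, Int.negOnePow_add]

/-- An odd generator squares to zero because 2 is invertible, and two occurrences can be brought
together up to sign. -/
theorem mono_eq_zero {x : X} (hx : (deg x).negOnePow = -1) {l : List X}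
    (h : List.Sublist [x, x] l) : mono deg l = 0 := by
  have hsq : gen deg x * gen deg x = 0 := by
    apply eq_zero_of_eq_neg_self
    have := gen_mul_gen (deg := deg) x x
    rwa [negOnePow_mul_eq (a := 1) (b := 1) (by rw [hx, pow_one]) (by rw [hx, pow_one]), mul_one,
      pow_one, Units.neg_smul, one_smul] at this
  induction l with
  | nil => cases h
  | cons y l ih =>
    rw [mono_cons]
    cases h with
    | cons _ h => rw [ih h, mul_zero]
    | cons_cons _ h =>
      obtain ⟨l₁, l₂, rfl⟩ := List.append_of_mem (List.singleton_sublist.1 h)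
      rw [mono_append, mono_cons, ← mul_assoc, gen_mul_mono, smul_mul_assoc, ← mul_assoc,
        mul_assoc _ (gen deg x) (gen deg x), hsq, mul_zero, zero_mul, smul_zero]

/-- Permuting the blocks of a word changes the word and the corresponding monomial by the same
sign. -/
theorem exists_sign {α : Type v} : ∀ (P P' : List (X × List α)),
    (∀ p ∈ P', p.2 ≠ []) → (∀ p ∈ P', (-1 : ℤˣ) ^ p.2.length = (deg p.1).negOnePow) →
    (P.map Prod.snd).flatten.Nodup → (P.map Prod.snd).flatten.Perm (P'.map Prod.snd).flatten →
    (∀ p ∈ P, ∃ p' ∈ P', p'.1 = p.1 ∧ SPerm 1 p.2 p'.2) →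
    ∃ δ, SPerm δ (P.map Prod.snd).flatten (P'.map Prod.snd).flatten ∧
      mono deg (P'.map Prod.fst) = δ • mono deg (P.map Prod.fst) := by
  intro P
  induction P with
  | nil =>
    intro P' h0 _ _ hp _
    have : P' = [] := by
      rw [List.eq_nil_iff_forall_not_mem]
      intro p hpP
      refine h0 p hpP (List.eq_nil_iff_forall_not_mem.2 fun x hx => ?_)
      have := hp.mem_iff.2 (List.mem_flatten.2 ⟨p.2, List.mem_map_of_mem hpP, hx⟩)
      simp at this
    subst this
    exact ⟨1, .nil, (one_smul _ _).symm⟩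
  | cons p P ih =>
    intro P' h0 hd hn hp hm
    -- The first block of P is found in P' behind some blocks A. Moving it to the front changes the
    -- word by a sign given by the lengths and the monomial by one given by the degrees; the
    -- parities agree.
    obtain ⟨p', hp', hx, hs⟩ := hm p List.mem_cons_self
    obtain ⟨A, B, rfl⟩ := List.append_of_mem hp'
    simp only [List.map_cons, List.flatten_cons, List.map_append, List.flatten_append] at hn hp ⊢
    have hsub : ∀ q ∈ A ++ B, q ∈ A ++ p' :: B := fun q hq => by
      simp only [List.mem_append, List.mem_cons] at hq ⊢
      tauto
    have hp2 : (P.map Prod.snd).flatten.Perm ((A ++ B).map Prod.snd).flatten := by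
      rw [List.map_append, List.flatten_append]
      rw [← List.perm_append_left_iff p.2]
      refine (hp.trans (List.perm_append_comm_assoc _ _ _)).trans ?_
      exact hs.symm.perm.append_right _
    obtain ⟨δ, h1, h2⟩ := ih (A ++ B) (fun q hq => h0 q (hsub q hq)) (fun q hq => hd q (hsub q hq))
      (List.nodup_append.1 hn).2.1 hp2 (by
        intro q hq
        obtain ⟨q', hq', hxq, hsq⟩ := hm q (List.mem_cons_of_mem _ hq)
        refine ⟨q', ?_, hxq, hsq⟩
        simp only [List.mem_append, List.mem_cons] at hq' ⊢
        rcases hq' with h | rfl | h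
        · exact Or.inl h
        -- A later block of P cannot correspond to the block just removed: that block is non-empty,
        -- so a letter would occur twice.
        · obtain ⟨a, ha⟩ := List.exists_mem_of_ne_nil _ (h0 q' hp')
          exact absurd rfl ((List.nodup_append.1 hn).2.2 a (hs.perm.mem_iff.2 ha) a
            (List.mem_flatten.2 ⟨_, List.mem_map_of_mem hq, hsq.perm.mem_iff.2 ha⟩))
        · exact Or.inr h)
    have hA : ∀ A' : List (X × List α), (∀ q ∈ A', (-1 : ℤˣ) ^ q.2.length = (deg q.1).negOnePow) →
        (-1 : ℤˣ) ^ (A'.map Prod.snd).flatten.length = ((A'.map Prod.fst).map deg).sum.negOnePow := by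
      intro A'
      induction A' with
      | nil => simp
      | cons q A' ih' =>
        intro h
        rw [List.map_cons, List.flatten_cons, List.length_append, pow_add, h q List.mem_cons_self,
          ih' fun r hr => h r (List.mem_cons_of_mem _ hr), List.map_cons, List.map_cons,
          List.sum_cons, Int.negOnePow_add]
    have hA' := hA A fun q hq => hd q (List.mem_append_left _ hq)
    have hsign := negOnePow_mul_eq (hd p' hp') hA'
    rw [List.map_append, List.flatten_append] at h1
    have h3 := (hs.append_right (P.map Prod.snd).flatten).trans ((h1.append_left p'.2))
    rw [← List.append_assoc] at h3
    have h4 := h3.trans ((SPerm.append_comm (A.map Prod.snd).flatten p'.2).append_right _)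
    rw [List.append_assoc] at h4
    refine ⟨_, h4, ?_⟩
    rw [List.map_append, mono_append] at h2
    rw [mono_append, mono_cons, mono_cons, ← hx, one_mul, mul_comm δ, ← smul_smul, ← mul_smul_comm,
      ← h2, ← mul_assoc, ← mul_assoc, gen_mul_mono, hsign, smul_mul_assoc, smul_smul,
      Int.units_mul_self, one_smul]

theorem span_mono (z : FreeGradedComm deg) : z ∈ Submodule.span ℚ (Set.range (mono deg)) := by
  obtain ⟨z, rfl⟩ := RingQuot.mkAlgHom_surjective ℚ (GCRel deg) z
  induction z using FreeAlgebra.induction with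
  | grade0 r =>
    rw [AlgHom.commutes, Algebra.algebraMap_eq_smul_one]
    exact Submodule.smul_mem _ _ (Submodule.subset_span ⟨[], rfl⟩)
  | grade1 x => exact Submodule.subset_span ⟨[x], List.prod_singleton⟩
  | add a b ha hb => rw [map_add]; exact Submodule.add_mem _ ha hb
  | mul a b ha hb =>
    rw [map_mul]
    have := Submodule.mul_mem_mul ha hb
    rw [Submodule.span_mul_span] at this
    refine Submodule.span_mono ?_ this
    rintro _ ⟨_, ⟨l, rfl⟩, _, ⟨l', rfl⟩, rfl⟩
    exact ⟨l ++ l', mono_append l l'⟩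

theorem mono_mem_homogeneous (l : List X) : mono deg l ∈ homogeneous deg (l.map deg).sum :=
  Submodule.subset_span ⟨l, rfl, rfl⟩

theorem mul_mem_homogeneous {m n : ℤ} {a b : FreeGradedComm deg} (ha : a ∈ homogeneous deg m)
    (hb : b ∈ homogeneous deg n) : a * b ∈ homogeneous deg (m + n) := by
  have := Submodule.mul_mem_mul ha hb
  rw [homogeneous, homogeneous, Submodule.span_mul_span] at this
  refine Submodule.span_mono ?_ this
  rintro _ ⟨_, ⟨l, rfl, rfl⟩, _, ⟨l', rfl, rfl⟩, rfl⟩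
  exact ⟨l ++ l', by simp, by simp⟩

end FreeGradedComm

/-! ### Letters of the components -/

section Letters

variable {L : Type u} [Lattice L] [BoundedOrder L]

theorem IsComponent.trivial_letters {E : ModExt L} {Γ : ModDiag L} {G : E.carrier}
    {B : List E.carrier} (h : IsComponent E Γ G B) (hΓ : Γ.toModExt.IsTrivial)
    (h1 : Γ.word.length = 1) : G = E.flat ∧ ∃ b, B = [b] ∧ b ≤ E.flat := by
  have hG := h.le_of_isTrivial hΓ
  refine ⟨le_antisymm hG h.flat_le, ?_⟩
  have hB : B.length = 1 := by
    obtain ⟨φ, -, -, rfl⟩ := h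
    rw [List.length_map, h1]
  obtain ⟨b, rfl⟩ := List.length_eq_one_iff.1 hB
  exact ⟨b, rfl, (h.le List.mem_cons_self).trans hG⟩

theorem IsComponent.not_le_flat {E : ModExt L} {Γ : ModDiag L} {G : E.carrier}
    {B : List E.carrier} (h : IsComponent E Γ G B) (hΓ : ∀ h ∈ Γ.word, ¬ h ≤ Γ.flat) :
    ∀ b ∈ B, ¬ b ≤ E.flat := by
  obtain ⟨φ, hφ, -, rfl⟩ := h
  intro b hb
  obtain ⟨x, hx, rfl⟩ := List.mem_map.1 hb
  rw [hφ.le_flat_iff]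
  exact hΓ x hx

theorem IsComponent.isAtom {E : ModExt L} {Γ : ModDiag L} {G : E.carrier}
    {B : List E.carrier} (h : IsComponent E Γ G B) : ∀ b ∈ B, IsAtom b := by
  obtain ⟨φ, hφ, -, rfl⟩ := h
  intro b hb
  obtain ⟨x, hx, rfl⟩ := List.mem_map.1 hb
  exact hφ.1.3 x (Γ.word_atom x hx)

/-- The degrees of the elements of a set of modular diagrams. -/
noncomputable abbrev degreeOn (X : Set (ModDiag L)) (Γ : X) : ℤ := Γ.1.degree

theorem IsFamily.length_eq {X : Set (ModDiag L)} {E : ModExt L} {J : List E.carrier}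
    {ps : List (X × E.carrier × List E.carrier)} (h : IsFamily (fun x : X => x.1) E J ps)
    {p : X × E.carrier × List E.carrier} (hp : p ∈ ps) :
    (-1 : ℤˣ) ^ p.2.2.length = (degreeOn X p.1).negOnePow := by
  obtain ⟨φ, -, -, hB⟩ := h.isComponent p hp
  rw [hB, List.length_map, ModDiag.negOnePow_degree]

end Letters

/-! ### The left inverse: the monomial of a diagram -/

section Inverse

variable {L : Type u} [Lattice L] [BoundedOrder L] [IsGeometric L] {X : Set (ModDiag L)}

open MD

/-- X has only one representative up to sign, and a non-zero class is not its own negative. -/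
theorem IsGeneratorSystem.eq_of_cls (hX : IsGeneratorSystem X) {x y : X} {ε : ℤˣ}
    (h : cls x.1 = ε • cls y.1) : x = y ∧ ε = 1 := by
  have hxy : x = y := by
    obtain ⟨z, -, hz⟩ := hX.existsUnique x.1 (hX.isGenerator x.1 x.2) (hX.ne_zero x.1 x.2)
    refine Subtype.ext ((hz x.1 ⟨x.2, Or.inl rfl⟩).trans (hz y.1 ⟨y.2, ?_⟩).symm)
    rcases Int.units_eq_one_or ε with rfl | rfl
    · left; rwa [one_smul] at h
    · right; rwa [Units.neg_smul, one_smul] at h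
  subst hxy
  refine ⟨rfl, (Int.units_eq_one_or ε).resolve_right ?_⟩
  rintro rfl
  rw [Units.neg_smul, one_smul] at h
  exact hX.ne_zero x.1 x.2 (eq_zero_of_eq_neg_self h)

/-- A non-trivial extension has an atom outside L, which must be a letter. Non-empty blocks can be
located through any one of their letters. -/
theorem ModDiag.IsGenerator.word_ne_nil {Γ : ModDiag L} (h : Γ.IsGenerator) : Γ.word ≠ [] := by
  rcases h with ⟨-, h⟩ | ⟨hi, -, h⟩
  · rintro e
    simp [e] at h
  · intro e
    have hG : ¬ (⊤ : Γ.carrier) ≤ Γ.flat := fun hle => hi.1 (ModExt.isTrivial_of_flat_eq_top hle)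
    rw [le_iff_atom_le_imp] at hG
    push Not at hG
    obtain ⟨a, ha, -, haF⟩ := hG
    simpa [e] using (h a ha).resolve_left haF

/-- The factors of a product of generators are determined, with their words up to even
permutations. -/
theorem IsGeneratorSystem.exists_block (hX : IsGeneratorSystem X) {E : ModExt L}
    {J J' : List E.carrier} {ps ps' : List (X × E.carrier × List E.carrier)}
    (h : IsFamily (fun x : X => x.1) E J ps) (h' : IsFamily (fun x : X => x.1) E J' ps')
    (hJ : J.Perm J') (hn : J.Nodup) {p : X × E.carrier × List E.carrier} (hp : p ∈ ps) :
    ∃ p' ∈ ps', p'.1 = p.1 ∧ SPerm 1 p.2.2 p'.2.2 := by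
  have hc := h.isComponent p hp
  have hne : p.2.2 ≠ [] := by
    obtain ⟨φ, -, -, hB⟩ := hc
    rw [hB]
    simpa using (hX.isGenerator _ p.1.2).word_ne_nil
  obtain ⟨b, hb⟩ := List.exists_mem_of_ne_nil _ hne
  obtain ⟨p', hp', hb'⟩ := h'.mem_word.1 (hJ.mem_iff.1 (h.mem_word.2 ⟨p, hp, hb⟩))
  have hc' := h'.isComponent p' hp'
  -- Same interval and same letters already give equal classes up to the sign of the rearrangement;
  -- the choice of X then forces the same generator and the sign 1.
  suffices hs : p.2.1 = p'.2.1 ∧ p.2.2.Perm p'.2.2 by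
    obtain ⟨δ, hδ⟩ := SPerm.exists_of_perm hs.2
    rw [hs.1] at hc
    obtain ⟨e, rfl⟩ := hX.eq_of_cls (hc.cls_eq hc' hδ)
    exact ⟨p', hp', e.symm, hδ⟩
  have hBn : p.2.2.Nodup := by
    rw [h.word] at hn
    exact (List.nodup_flatten.1 hn).1 _ (List.mem_map_of_mem hp)
  have hBn' : p'.2.2.Nodup := by
    rw [hJ.nodup_iff, h'.word] at hn
    exact (List.nodup_flatten.1 hn).1 _ (List.mem_map_of_mem hp')
  rcases hX.isGenerator _ p.1.2 with ⟨ht, h1⟩ | ⟨hi, hw, ha⟩ <;>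
  rcases hX.isGenerator _ p'.1.2 with ⟨ht', h1'⟩ | ⟨hi', hw', ha'⟩
  · obtain ⟨hG, c, hc1, -⟩ := hc.trivial_letters ht h1
    obtain ⟨hG', c', hc1', -⟩ := hc'.trivial_letters ht' h1'
    rw [hc1, List.mem_singleton] at hb
    rw [hc1', List.mem_singleton] at hb'
    rw [hc1, hc1', ← hb, ← hb']
    exact ⟨hG.trans hG'.symm, .refl _⟩
  · obtain ⟨-, c, hc1, hcF⟩ := hc.trivial_letters ht h1
    rw [hc1, List.mem_singleton] at hb
    exact absurd (hb ▸ hcF) (hc'.not_le_flat hw' b hb')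
  · obtain ⟨-, c, hc1, hcF⟩ := hc'.trivial_letters ht' h1'
    rw [hc1, List.mem_singleton] at hb'
    exact absurd (hb' ▸ hcF) (hc.not_le_flat hw b hb)
  · have hG : p.2.1 = p'.2.1 := by
      obtain ⟨φ, hφ, hr, -⟩ := hc
      obtain ⟨φ', hφ', hr', -⟩ := hc'
      obtain ⟨H, hH⟩ := h.isSplit p hp
      obtain ⟨H', hH'⟩ := h'.isSplit p' hp'
      exact ModExt.IsSplit.eq_of_common hφ hφ' hr hr' hi hi' hH hH'
        ((h.isComponent p hp).not_le_flat hw b hb) ((h.isComponent p hp).le hb)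
        ((h'.isComponent p' hp').le hb')
    -- Both blocks list, once each, the atoms of the interval that are not in L.
    refine ⟨hG, (List.perm_ext_iff_of_nodup hBn hBn').2 fun a => ⟨fun haB => ?_, fun haB => ?_⟩⟩
    · exact (hc'.mem_of_isReduced ha' (hc.isAtom a haB) (hG ▸ hc.le haB)).resolve_left
        (hc.not_le_flat hw a haB)
    · exact (hc.mem_of_isReduced ha (hc'.isAtom a haB) (hG ▸ hc'.le haB)).resolve_left
        (hc'.not_le_flat hw' a haB)

/-- The product of a list of elements of a set of modular diagrams. -/
noncomputable abbrev mulOn (X : Set (ModDiag L)) (l : List X) : ModDiag L :=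
  ModDiag.mulList (l.map fun x : X => x.1)

theorem IsGeneratorSystem.isReduced_mulOn (hX : IsGeneratorSystem X) (l : List X) :
    (mulOn X l).IsReduced :=
  ModDiag.isReduced_mulList _ l fun i _ => (hX.isGenerator i.1 i.2).isReduced

/-- A diagram determines the monomial that it matches. -/
theorem IsGeneratorSystem.smul_mono_eq (hX : IsGeneratorSystem X) {Γ : ModDiag L}
    (hn : Γ.word.Nodup) {ε ε' : ℤˣ} {l l' : List X} (h : Match ε (mulOn X l) Γ)
    (h' : Match ε' (mulOn X l') Γ) : ε • FreeGradedComm.mono (degreeOn X) l =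
      ε' • FreeGradedComm.mono (degreeOn X) l' := by
  have hred := hX.isReduced_mulOn l
  -- Two reduced products matching the same diagram are isomorphic, so both families of factors can
  -- be placed on one lattice.
  obtain ⟨θ, hθ, hs⟩ := (h.lift (hX.isReduced_mulOn l') h').exists_orderIso hred
  have hnM : (mulOn X l).word.Nodup := by
    obtain ⟨ψ, -, -, hψ⟩ := h
    exact List.Nodup.of_map ψ (hψ.perm.nodup_iff.2 hn)
  obtain ⟨ps, hps, hf⟩ := exists_family (fun x : X => x.1) l
  obtain ⟨ps', hps', hf'⟩ := exists_family (fun x : X => x.1) l'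
  replace hf' := hf'.map θ hθ
  generalize hqs : (ps'.map fun p => (p.1, θ p.2.1, p.2.2.map θ)) = qs at hf'
  have hqs' : qs.map Prod.fst = l' := by
    rw [← hqs, List.map_map]
    exact hps'
  have hw : ∀ rs : List (X × (mulOn X l).carrier × List (mulOn X l).carrier),
      ((rs.map fun p => (p.1, p.2.2)).map Prod.snd).flatten = (rs.map fun p => p.2.2).flatten :=
    fun rs => by rw [List.map_map]; rfl
  have hw' : ∀ rs : List (X × (mulOn X l).carrier × List (mulOn X l).carrier),
      (rs.map fun p => (p.1, p.2.2)).map Prod.fst = rs.map Prod.fst :=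
    fun rs => by rw [List.map_map]; rfl
  obtain ⟨δ, h1, h2⟩ := FreeGradedComm.exists_sign (deg := degreeOn X)
    (ps.map fun p => (p.1, p.2.2)) (qs.map fun p => (p.1, p.2.2)) (by
      intro p hp
      obtain ⟨q, hq, rfl⟩ := List.mem_map.1 hp
      obtain ⟨φ, -, -, hB⟩ := hf'.isComponent q hq
      show q.2.2 ≠ []
      rw [hB]
      simpa using (hX.isGenerator _ q.1.2).word_ne_nil) (by
      intro p hp
      obtain ⟨q, hq, rfl⟩ := List.mem_map.1 hp
      exact hf'.length_eq hq) (by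
      rw [hw, ← hf.word]
      exact hnM) (by
      rw [hw, hw, ← hf.word, ← hf'.word]
      exact hs.symm.perm) (by
      intro p hp
      obtain ⟨q, hq, rfl⟩ := List.mem_map.1 hp
      obtain ⟨q', hq', h3⟩ := hX.exists_block hf hf' hs.symm.perm hnM hq
      exact ⟨_, List.mem_map_of_mem hq', h3⟩)
  rw [hw, hw, ← hf.word, ← hf'.word] at h1
  rw [hw', hw', hps, hqs'] at h2
  -- The sign obtained from the blocks and the sign of the isomorphism belong to one rearrangement
  -- of a word without repetitions, so they agree.
  rw [h2, SPerm.sign_unique hnM h1 hs.symm, smul_smul, ← mul_assoc, Int.units_mul_self, one_mul]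

open Classical in
/-- The monomial of a diagram. -/
noncomputable def monoOf (X : Set (ModDiag L)) (Γ : ModDiag L) : FreeGradedComm (degreeOn X) :=
  if h : Γ.word.Nodup ∧ ∃ q : ℤˣ × List X, Match q.1 (mulOn X q.2) Γ then
    h.2.choose.1 • FreeGradedComm.mono (degreeOn X) h.2.choose.2 else 0

theorem IsGeneratorSystem.monoOf_eq (hX : IsGeneratorSystem X) {Γ : ModDiag L}
    (hn : Γ.word.Nodup) {ε : ℤˣ} {l : List X} (h : Match ε (mulOn X l) Γ) :
    monoOf X Γ = ε • FreeGradedComm.mono (degreeOn X) l := by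
  have hh : Γ.word.Nodup ∧ ∃ q : ℤˣ × List X, Match q.1 (mulOn X q.2) Γ := ⟨hn, (ε, l), h⟩
  rw [monoOf, dif_pos hh]
  exact hX.smul_mono_eq hn hh.2.choose_spec h

theorem monoOf_eq_zero {Γ : ModDiag L}
    (h : Γ.word.Nodup → ∀ (ε : ℤˣ) (l : List X), ¬ Match ε (mulOn X l) Γ) : monoOf X Γ = 0 := by
  rw [monoOf, dif_neg]
  rintro ⟨hn, ⟨ε, l⟩, hm⟩
  exact h hn ε l hm

theorem IsGeneratorSystem.monoOf_sperm (hX : IsGeneratorSystem X) (E : ModExt L) {ε : ℤˣ}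
    {J J' : List E.carrier} (h : SPerm ε J J') (hJ : ∀ x ∈ J, IsAtom x) (hJ' : ∀ x ∈ J', IsAtom x) :
    monoOf X ⟨E, J, hJ⟩ = ε • monoOf X ⟨E, J', hJ'⟩ := by
  by_cases hm : J.Nodup ∧ ∃ q : ℤˣ × List X, Match q.1 (mulOn X q.2) ⟨E, J, hJ⟩
  · obtain ⟨hn, ⟨ε', l⟩, hm⟩ := hm
    rw [hX.monoOf_eq (Γ := ⟨E, J, hJ⟩) hn hm,
      hX.monoOf_eq (Γ := ⟨E, J', hJ'⟩) (h.perm.nodup_iff.1 hn) (hm.sperm hJ' h), smul_smul,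
      mul_left_comm, Int.units_mul_self, mul_one]
  · rw [monoOf_eq_zero, monoOf_eq_zero, smul_zero]
    · exact fun hn ε' l hm' => hm ⟨h.perm.nodup_iff.2 hn, (_, l), hm'.sperm hJ h.symm⟩
    · exact fun hn ε' l hm' => hm ⟨hn, (_, l), hm'⟩

/-- Matches push forward along rank-preserving embeddings, and pull back because the matching
product is reduced. This is relation (2). -/
theorem IsGeneratorSystem.monoOf_hom (hX : IsGeneratorSystem X) (Γ Γ' : ModDiag L)
    {φ : Γ.carrier → Γ'.carrier} (h : ModExt.IsHom Γ.toModExt Γ'.toModExt φ) (h1 : φ ⊤ = ⊤)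
    (hJ : Γ'.word = Γ.word.map φ) : monoOf X Γ = monoOf X Γ' := by
  have hnn : Γ'.word.Nodup ↔ Γ.word.Nodup := by
    rw [hJ, List.nodup_map_iff h.1.1]
  by_cases hm : Γ.word.Nodup ∧ ∃ q : ℤˣ × List X, Match q.1 (mulOn X q.2) Γ
  · obtain ⟨hn, ⟨ε', l⟩, hm⟩ := hm
    rw [hX.monoOf_eq hn hm, hX.monoOf_eq (hnn.2 hn) (hm.comp h h1 hJ)]
  · rw [monoOf_eq_zero, monoOf_eq_zero]
    · exact fun hn ε' l hm' => hm ⟨hnn.1 hn, (_, l), hm'.of_comp (hX.isReduced_mulOn l) h h1 hJ⟩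
    · exact fun hn ε' l hm' => hm ⟨hn, (_, l), hm'⟩

variable [Nontrivial L]

/-- The map from `MD L` to the free graded commutative algebra. -/
noncomputable def IsGeneratorSystem.toFree (hX : IsGeneratorSystem X) :
    MD L →ₗ[ℚ] FreeGradedComm (degreeOn X) :=
  MD.lift (monoOf X) (by
    intro v hv
    have hg : ∀ l : List X, ∀ i ∈ l, i.1.IsGenerator := fun l i _ => hX.isGenerator i.1 i.2
    have h0 : ∀ l : List X, ∀ i ∈ l, cls i.1 ≠ 0 := fun l i _ => hX.ne_zero i.1 i.2
    cases hv with
    | swap E J₁ J₂ a b h h' =>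
      simp only [map_add, Finsupp.linearCombination_single, one_smul]
      rw [hX.monoOf_sperm E ((SPerm.swap a b J₂).append_left J₁) h h', Units.neg_smul, one_smul,
        neg_add_cancel]
    | embed Γ Γ' φ hφ hr hι hJ =>
      simp only [map_sub, Finsupp.linearCombination_single, one_smul]
      rw [hX.monoOf_hom Γ Γ' ⟨hφ, hι⟩ (hφ.map_top_of_rk hr) hJ, sub_self]
    | span Γ h =>
      simp only [Finsupp.linearCombination_single, one_smul]
      refine monoOf_eq_zero fun _ ε l hm => h.ne ?_
      exact hm.spanning (hX.isReduced_mulOn l) le_sup_left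
        fun x hx => (le_listJoin hx).trans le_sup_right
    | prod Γ A B e h =>
      simp only [Finsupp.linearCombination_single, one_smul]
      exact monoOf_eq_zero fun _ ε l hm => hm.not_prod (hg l) (h0 l) A B e h
    | two Γ F hF hle h =>
      simp only [Finsupp.linearCombination_single, one_smul]
      exact monoOf_eq_zero fun _ ε l hm => hm.not_two (hg l) (h0 l) F hF hle h)

theorem IsGeneratorSystem.toFree_mulOn (hX : IsGeneratorSystem X) (l : List X) :
    hX.toFree (cls (mulOn X l)) = FreeGradedComm.mono (degreeOn X) l := by
  rw [toFree, MD.lift_cls]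
  by_cases hn : (mulOn X l).word.Nodup
  · rw [hX.monoOf_eq hn (Match.refl _), one_smul]
  rw [monoOf_eq_zero fun h => absurd h hn]
  obtain ⟨ps, hps, hf⟩ := exists_family (fun x : X => x.1) l
  -- The value is 0, so the monomial must vanish too. A repeated letter is repeated within one
  -- block, which would kill a generator, or shared by two blocks.
  rw [hf.word, List.nodup_flatten, not_and_or] at hn
  rcases hn with hn | hn
  · push Not at hn
    obtain ⟨B, hB, hn⟩ := hn
    obtain ⟨p, hp, rfl⟩ := List.mem_map.1 hB
    obtain ⟨φ, hφ, -, hB⟩ := hf.isComponent p hp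
    rw [hB, List.nodup_map_iff hφ.1.1] at hn
    exact absurd (cls_eq_zero_of_not_nodup p.1.1 hn) (hX.ne_zero _ p.1.2)
  · rw [List.pairwise_map] at hn
    have : ∃ p q, List.Sublist [p, q] ps ∧ ¬ List.Disjoint p.2.2 q.2.2 := by
      by_contra! hc
      exact hn (List.pairwise_iff_forall_sublist.2 fun {p q} h => hc p q h)
    obtain ⟨p, q, hpq, hd⟩ := this
    have hle := List.pairwise_iff_forall_sublist.1 hf.pairwise hpq
    have hp : p ∈ ps := hpq.subset (by simp)
    have hq : q ∈ ps := hpq.subset (by simp)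
    obtain ⟨b, hbp, hbq⟩ : ∃ b, b ∈ p.2.2 ∧ b ∈ q.2.2 := by
      by_contra! hc
      exact hd fun b h1 h2 => hc b h1 h2
    have hcp := hf.isComponent p hp
    have hcq := hf.isComponent q hq
    -- Two components meet inside L, so the shared letter is in L, and only the one-letter
    -- generators on the trivial extension have such letters.
    have hbF := (le_inf (hcp.le hbp) (hcq.le hbq)).trans hle
    have htp := (hX.isGenerator _ p.1.2).resolve_right fun h => hcp.not_le_flat h.2.1 b hbp hbF
    have htq := (hX.isGenerator _ q.1.2).resolve_right fun h => hcq.not_le_flat h.2.1 b hbq hbF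
    obtain ⟨hGp, c, hc, -⟩ := hcp.trivial_letters htp.1 htp.2
    obtain ⟨hGq, d, hd, -⟩ := hcq.trivial_letters htq.1 htq.2
    rw [hc, List.mem_singleton] at hbp
    rw [hd, List.mem_singleton] at hbq
    rw [hGp, hc, ← hbp] at hcp
    rw [hGq, hd, ← hbq] at hcq
    -- The same letter gives the same class, so one element of X, of odd degree, occurs twice in the
    -- monomial.
    have e := (hX.eq_of_cls (hcp.cls_eq hcq (SPerm.refl _))).1
    symm
    refine FreeGradedComm.mono_eq_zero (x := p.1) ?_ ?_
    · rw [degreeOn, ModDiag.negOnePow_degree, htp.2, pow_one]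
    · have := hpq.map Prod.fst
      rw [hps, List.map_cons, List.map_cons, ← e] at this
      exact this

end Inverse

/-! ### The extension generated by the letters of a word -/

section Generated

variable {L : Type u} [Lattice L] [BoundedOrder L]

/-- Sorting the letters of a word in a pushout. -/
theorem exists_words {E₁ E₂ : ModExt L} : ∀ J : List (Pushout E₁ E₂), (∀ x ∈ J, IsAtom x) →
    ∃ (J₁ : List E₁.carrier) (J₂ : List E₂.carrier), (∀ x ∈ J₁, IsAtom x) ∧ (∀ x ∈ J₂, IsAtom x) ∧
      J.Perm (J₁.map Pushout.inl ++ J₂.map Pushout.inr)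
  | [], _ => ⟨[], [], by simp, by simp, .nil⟩
  | a :: J, h => by
    obtain ⟨J₁, J₂, h₁, h₂, hp⟩ := exists_words J fun x hx => h x (List.mem_cons_of_mem _ hx)
    rcases Pushout.atom_cases (h a List.mem_cons_self) with ⟨x, hx, rfl⟩ | ⟨x, hx, rfl⟩
    · exact ⟨x :: J₁, J₂, List.forall_mem_cons.2 ⟨hx, h₁⟩, h₂, hp.cons _⟩
    · exact ⟨J₁, x :: J₂, h₁, List.forall_mem_cons.2 ⟨hx, h₂⟩,
        (hp.cons _).trans List.perm_middle.symm⟩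

variable (E : ModExt L) (J : List E.carrier)

/-- The elements that are joins of atoms below `F` and of letters of a word. -/
def IsGenerated (x : E.carrier) : Prop :=
  ∀ y, (∀ a, IsAtom a → (a ≤ E.flat ∨ a ∈ J) → a ≤ x → a ≤ y) → x ≤ y

variable {E J}

theorem IsGenerated.sup {x y : E.carrier} (hx : IsGenerated E J x) (hy : IsGenerated E J y) :
    IsGenerated E J (x ⊔ y) := fun z h =>
  sup_le (hx z fun a ha hJ hax => h a ha hJ (hax.trans le_sup_left))
    (hy z fun a ha hJ hax => h a ha hJ (hax.trans le_sup_right))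

theorem isGenerated_bot : IsGenerated E J ⊥ := fun _ _ => bot_le

theorem isGenerated_atom {a : E.carrier} (ha : IsAtom a) (h : a ≤ E.flat ∨ a ∈ J) :
    IsGenerated E J a := fun _ hy => hy a ha h le_rfl

theorem isGenerated_of_le_flat {x : E.carrier} (h : x ≤ E.flat) : IsGenerated E J x := by
  intro y hy
  rw [le_iff_atom_le_imp]
  exact fun a ha hax => hy a ha (Or.inl (hax.trans h)) hax

variable (J)

/-- Generated elements are closed under joins, so a maximal one below x is the largest. -/
theorem exists_core (x : E.carrier) :
    ∃ z, IsGenerated E J z ∧ z ≤ x ∧ ∀ w, IsGenerated E J w → w ≤ x → w ≤ z := by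
  obtain ⟨z, ⟨hz, hzx⟩, hmax⟩ := (Set.toFinite {z | IsGenerated E J z ∧ z ≤ x}).exists_maximal
    ⟨⊥, isGenerated_bot, bot_le⟩
  exact ⟨z, hz, hzx, fun w hw hwx =>
    le_sup_right.trans (hmax ⟨hz.sup hw, sup_le hzx hwx⟩ le_sup_left)⟩

/-- The largest generated element below a given one. -/
noncomputable def core (x : E.carrier) : E.carrier := (exists_core J x).choose

theorem isGenerated_core (x : E.carrier) : IsGenerated E J (core J x) :=
  (exists_core J x).choose_spec.1

theorem core_le (x : E.carrier) : core J x ≤ x := (exists_core J x).choose_spec.2.1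

variable {J}

theorem le_core {x w : E.carrier} (hw : IsGenerated E J w) (h : w ≤ x) : w ≤ core J x :=
  (exists_core J x).choose_spec.2.2 w hw h

theorem core_eq {x : E.carrier} (hx : IsGenerated E J x) : core J x = x :=
  le_antisymm (core_le J x) (le_core hx le_rfl)

variable (E J)

/-- The lattice of elements generated by `L` and by the letters of a word. -/
def Generated : Type u := {x : E.carrier // IsGenerated E J x}

variable {E J}

namespace Generated

instance : PartialOrder (Generated E J) := inferInstanceAs (PartialOrder (Subtype _))

instance : Finite (Generated E J) := inferInstanceAs (Finite (Subtype _))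

noncomputable instance : Lattice (Generated E J) where
  sup p q := ⟨p.1 ⊔ q.1, p.2.sup q.2⟩
  -- The meet taken in E need not be generated, so its core is used; the inclusion in E is only
  -- required to preserve joins.
  inf p q := ⟨core J (p.1 ⊓ q.1), isGenerated_core J _⟩
  le_sup_left _ _ := le_sup_left (α := E.carrier)
  le_sup_right _ _ := le_sup_right (α := E.carrier)
  sup_le _ _ _ h1 h2 := sup_le (α := E.carrier) h1 h2
  inf_le_left _ _ := (core_le J _).trans inf_le_left
  inf_le_right _ _ := (core_le J _).trans inf_le_right
  le_inf p _ _ h1 h2 := le_core p.2 (le_inf (α := E.carrier) h1 h2)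

noncomputable instance : BoundedOrder (Generated E J) where
  top := ⟨core J ⊤, isGenerated_core J ⊤⟩
  le_top p := le_core p.2 le_top
  bot := ⟨⊥, isGenerated_bot⟩
  bot_le _ := bot_le (α := E.carrier)

theorem isAtom_of {p : Generated E J} (h : IsAtom p.1) : IsAtom p :=
  ⟨fun e => h.1 (congrArg Subtype.val e), fun q hq => Subtype.ext (h.2 q.1 hq)⟩

theorem isAtom_iff {p : Generated E J} :
    IsAtom p ↔ IsAtom p.1 ∧ (p.1 ≤ E.flat ∨ p.1 ∈ J) := by
  constructor
  · intro h
    obtain ⟨a, ha, haJ, hap⟩ : ∃ a, IsAtom a ∧ (a ≤ E.flat ∨ a ∈ J) ∧ a ≤ p.1 := by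
      by_contra! hn
      exact h.1 (le_bot_iff.1 (p.2 ⊥ fun a ha haJ hap => absurd hap (hn a ha haJ)))
    let a' : Generated E J := ⟨a, isGenerated_atom ha haJ⟩
    have ha' : IsAtom a' := isAtom_of (p := a') ha
    rcases h.le_iff.1 (show a' ≤ p from hap) with e | e
    · exact absurd e ha'.1
    · rw [← e]
      exact ⟨ha, haJ⟩
  · exact fun h => isAtom_of h.1

instance : IsAtomistic (Generated E J) := by
  refine ⟨fun p => ⟨{a | IsAtom a ∧ a ≤ p}, ⟨fun a ha => ha.2, fun r hr => ?_⟩, fun a ha => ha.1⟩⟩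
  exact p.2 r.1 fun a ha haJ hap =>
    hr (a := ⟨a, isGenerated_atom ha haJ⟩) ⟨isAtom_iff.2 ⟨ha, haJ⟩, hap⟩

instance : IsGeometric (Generated E J) := by
  apply isGeometric_of_covering
  intro x h hh hx
  have := covBy_sup_atom (isAtom_iff.1 hh).1 hx
  exact ⟨this.lt, fun c h1 h2 => this.2 (c := c.1) h1 h2⟩

end Generated

variable (E J) in
/-- The modular extension generated by the letters of a word. -/
@[reducible] noncomputable def ModExt.generated : ModExt L where
  carrier := Generated E J
  incl l := ⟨E.incl l, isGenerated_of_le_flat (E.incl_le_flat l)⟩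
  isEmbedding :=
    { injective := fun _ _ h => E.isEmbedding.injective (congrArg Subtype.val h)
      map_sup := fun a b => Subtype.ext (E.isEmbedding.map_sup a b)
      map_atom := fun a ha => Generated.isAtom_of (E.isEmbedding.map_atom a ha) }
  range_incl := by
    ext p
    constructor
    · rintro ⟨l, rfl⟩
      exact E.incl_le_flat l
    · intro h
      exact ⟨_, Subtype.ext (E.incl_restr_of_le h)⟩
  modular A B hA := by
    -- Everything below F is generated, so meets with F are those of E and modularity is inherited.
    have h1 : ∀ x, core J (E.flat ⊓ x) = E.flat ⊓ x := fun x =>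
      core_eq (isGenerated_of_le_flat inf_le_left)
    refine Subtype.ext ?_
    show core J (E.flat ⊓ (A.1 ⊔ B.1)) = A.1 ⊔ core J (E.flat ⊓ B.1)
    rw [h1, h1]
    exact E.modular A.1 B.1 hA

theorem ModExt.isHom_generated : IsHom (E.generated J) E Subtype.val :=
  ⟨⟨Subtype.val_injective, fun _ _ => rfl, fun _ ha => (Generated.isAtom_iff.1 ha).1⟩, fun _ => rfl⟩

/-- A spanning diagram is represented by the extension generated by its letters. -/
theorem exists_generated (Γ : ModDiag L) (hs : Γ.flat ⊔ listJoin Γ.word = ⊤)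
    (hr : ¬ Γ.IsReduced) : ∃ Γ' : ModDiag L, MD.cls Γ = MD.cls Γ' ∧ Γ.degree = Γ'.degree ∧
      Γ.word.length = Γ'.word.length ∧ Nat.card Γ'.carrier < Nat.card Γ.carrier := by
  have hw : ∀ J : List Γ.carrier, (∀ x ∈ J, x ∈ Γ.word) →
      ∃ W : List (Generated Γ.toModExt Γ.word), J = W.map fun p => p.1 := by
    intro J
    induction J with
    | nil => exact fun _ => ⟨[], rfl⟩
    | cons a J ih =>
      intro h
      obtain ⟨W, hW⟩ := ih fun x hx => h x (List.mem_cons_of_mem _ hx)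
      have ha := h a List.mem_cons_self
      exact ⟨⟨a, isGenerated_atom (Γ.word_atom a ha) (Or.inr ha)⟩ :: W,
        congrArg (a :: ·) hW⟩
  obtain ⟨W, hW⟩ := hw Γ.word fun _ h => h
  have hh := ModExt.isHom_generated (E := Γ.toModExt) (J := Γ.word)
  let Γ' : ModDiag L :=
    { toModExt := Γ.toModExt.generated Γ.word
      word := W
      word_atom := fun x hx => hh.isAtom_iff.1
        (Γ.word_atom x.1 ((iff_of_eq (congrArg (x.1 ∈ ·) hW)).2
          (List.mem_map_of_mem (f := fun p : Generated Γ.toModExt Γ.word => p.1) hx))) }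
  -- Spanning makes the top of E generated, so the rank does not drop and relation (2) applies.
  have htop : ((⊤ : Generated Γ.toModExt Γ.word)).1 = ⊤ := by
    rw [eq_top_iff, ← hs]
    refine sup_le (le_core (isGenerated_of_le_flat le_rfl) le_top) (listJoin_le fun x hx => ?_)
    exact le_core (isGenerated_atom (Γ.word_atom x hx) (Or.inr hx)) le_top
  refine ⟨Γ', (cls_hom Γ' Γ hh htop hW).symm, Γ'.degree_hom Γ hh (.of_eq hW),
    (congrArg List.length hW).trans (List.length_map _), ?_⟩
  have := Fintype.ofFinite Γ.carrier
  have := Fintype.ofFinite (Generated Γ.toModExt Γ.word)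
  show Nat.card (Generated Γ.toModExt Γ.word) < _
  rw [Nat.card_eq_fintype_card, Nat.card_eq_fintype_card]
  -- If nothing were lost, every atom would be in L or a letter, which is reducedness.
  refine Fintype.card_lt_of_injective_not_surjective _ hh.1.1 fun hsurj => hr fun a ha => ?_
  obtain ⟨p, rfl⟩ := hsurj a
  exact (Generated.isAtom_iff.1 (hh.isAtom_iff.1 ha)).2

end Generated

/-! ### The algebra isomorphism -/

section Isomorphism

variable {L : Type u} [Lattice L] [BoundedOrder L] [IsGeometric L]

open MD

/-- Equality of classes up to sign is an equivalence relation on the generators with non-zero class;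
X is obtained by choosing one from each equivalence class. -/
theorem exists_isGeneratorSystem : ∃ X : Set (ModDiag L), IsGeneratorSystem X := by
  let s : Setoid {Γ : ModDiag L // Γ.IsGenerator ∧ cls Γ ≠ 0} :=
    { r := fun Γ Γ' => ∃ ε : ℤˣ, cls Γ.1 = ε • cls Γ'.1
      iseqv :=
        { refl := fun Γ => ⟨1, (one_smul _ _).symm⟩
          symm := fun {Γ Γ'} ⟨ε, h⟩ => ⟨ε, by rw [h, smul_smul, Int.units_mul_self, one_smul]⟩
          trans := fun {Γ Γ' Γ''} ⟨ε, h⟩ ⟨ε', h'⟩ => ⟨ε * ε', by rw [h, h', smul_smul]⟩ } }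
  have hsign : ∀ Γ Γ' : ModDiag L, (∃ ε : ℤˣ, cls Γ = ε • cls Γ') ↔
      (cls Γ = cls Γ' ∨ cls Γ = -cls Γ') := by
    intro Γ Γ'
    constructor
    · rintro ⟨ε, h⟩
      rcases Int.units_eq_one_or ε with rfl | rfl
      · left; rwa [one_smul] at h
      · right; rwa [Units.neg_smul, one_smul] at h
    · rintro (h | h)
      · exact ⟨1, by rwa [one_smul]⟩
      · exact ⟨-1, by rwa [Units.neg_smul, one_smul]⟩
  refine ⟨Set.range fun q : Quotient s => q.out.1, ?_, ?_, ?_⟩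
  · rintro _ ⟨q, rfl⟩
    exact q.out.2.1
  · rintro _ ⟨q, rfl⟩
    exact q.out.2.2
  · intro Γ hg h0
    let q : Quotient s := Quotient.mk s ⟨Γ, hg, h0⟩
    have hq : s.r ⟨Γ, hg, h0⟩ q.out := Setoid.symm (Quotient.mk_out (s := s) ⟨Γ, hg, h0⟩)
    refine ⟨q.out.1, ⟨⟨q, rfl⟩, (hsign _ _).1 hq⟩, ?_⟩
    rintro _ ⟨⟨q', rfl⟩, h'⟩
    have h2 : s.r ⟨Γ, hg, h0⟩ q'.out := (hsign _ _).2 h'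
    have h3 : q = q' := by
      rw [← Quotient.out_eq q']
      exact Quotient.sound h2
    show q'.out.1 = q.out.1
    rw [h3]

/-- The map from the free graded commutative algebra to `MD L`. -/
noncomputable def ofFree (X : Set (ModDiag L)) : FreeGradedComm (degreeOn X) →ₐ[ℚ] MD L :=
  RingQuot.liftAlgHom ℚ ⟨FreeAlgebra.lift ℚ fun x : X => cls x.1, by
    intro a b h
    obtain ⟨x, y⟩ := h
    rw [map_mul, map_zsmul, map_mul, FreeAlgebra.lift_ι_apply, FreeAlgebra.lift_ι_apply,
      MD.cls_mul_cls, MD.cls_mul_cls, cls_mul_comm,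
      negOnePow_mul_eq (ModDiag.negOnePow_degree x.1).symm (ModDiag.negOnePow_degree y.1).symm]
    -- One sign is a unit of ℤ, the other a power of -1 in ℚ; both depend only on this parity.
    rcases Nat.even_or_odd (x.1.word.length * y.1.word.length) with h | h
    · simp [h.neg_one_pow]
    · simp [h.neg_one_pow]⟩

theorem ofFree_gen (X : Set (ModDiag L)) (x : X) :
    ofFree X (FreeGradedComm.gen (degreeOn X) x) = cls x.1 := by
  rw [ofFree, FreeGradedComm.gen]
  exact (RingQuot.liftAlgHom_mkAlgHom_apply _ _ _ _).trans (FreeAlgebra.lift_ι_apply _ _)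

theorem ofFree_mono (X : Set (ModDiag L)) (l : List X) :
    ofFree X (FreeGradedComm.mono (degreeOn X) l) = cls (mulOn X l) := by
  rw [FreeGradedComm.mono, map_list_prod, List.map_map, mulOn, cls_mulList, List.map_map]
  congr 1
  exact List.map_congr_left fun x _ => ofFree_gen X x

theorem ModDiag.degree_mulOn (X : Set (ModDiag L)) (l : List X) :
    (mulOn X l).degree = (l.map (degreeOn X)).sum := by
  induction l with
  | nil => exact ModDiag.degree_one
  | cons x l ih =>
    rw [List.map_cons, List.sum_cons, ← ih]
    exact ModDiag.degree_mul _ _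

/-- The image of the homogeneous part of degree `n`. -/
noncomputable def imageHomogeneous (X : Set (ModDiag L)) (n : ℤ) : Submodule ℚ (MD L) :=
  (FreeGradedComm.homogeneous (degreeOn X) n).map (ofFree X).toLinearMap

theorem mul_mem_imageHomogeneous {X : Set (ModDiag L)} {m n : ℤ} {a b : MD L}
    (ha : a ∈ imageHomogeneous X m) (hb : b ∈ imageHomogeneous X n) :
    a * b ∈ imageHomogeneous X (m + n) := by
  obtain ⟨a, ha, rfl⟩ := ha
  obtain ⟨b, hb, rfl⟩ := hb
  exact ⟨a * b, FreeGradedComm.mul_mem_homogeneous ha hb, map_mul (ofFree X) a b⟩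

theorem units_smul_mem {M : Type u} [AddCommGroup M] [Module ℚ M] (S : Submodule ℚ M) {x : M}
    (hx : x ∈ S) (ε : ℤˣ) : ε • x ∈ S := by
  rcases Int.units_eq_one_or ε with rfl | rfl
  · rwa [one_smul]
  · rw [Units.neg_smul, one_smul]
    exact S.neg_mem hx

theorem IsGeneratorSystem.generator_mem {X : Set (ModDiag L)} (hX : IsGeneratorSystem X)
    {Γ : ModDiag L} (hΓ : Γ.IsGenerator) : cls Γ ∈ imageHomogeneous X Γ.degree := by
  by_cases h0 : cls Γ = 0
  · rw [h0]
    exact Submodule.zero_mem _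
  obtain ⟨Γ', ⟨hΓ', h⟩, -⟩ := hX.existsUnique Γ hΓ h0
  have hm : cls Γ' ∈ imageHomogeneous X Γ.degree := by
    rw [MD.degree_eq_of_cls_eq h0 h]
    refine ⟨FreeGradedComm.mono (degreeOn X) [⟨Γ', hΓ'⟩], ?_, ?_⟩
    · have := FreeGradedComm.mono_mem_homogeneous (deg := degreeOn X) [⟨Γ', hΓ'⟩]
      rwa [List.map_singleton, List.sum_singleton] at this
    · exact (congrArg (ofFree X) List.prod_singleton).trans (ofFree_gen X ⟨Γ', hΓ'⟩)
  rcases h with h | h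
  · rwa [h]
  · rw [h]
    exact Submodule.neg_mem _ hm

/-- A diagram on a pushout is a product up to sign. -/
theorem mem_of_iso_pushout {X : Set (ModDiag L)} (Γ Γ₁ Γ₂ : ModDiag L)
    (e : Γ.carrier ≃o (Γ₁.mul Γ₂).carrier) (he : ∀ l, e (Γ.incl l) = (Γ₁.mul Γ₂).incl l)
    (hw : (Γ.word.map e).Perm (Γ₁.word.map Pushout.inl ++ Γ₂.word.map Pushout.inr))
    (h₁ : cls Γ₁ ∈ imageHomogeneous X Γ₁.degree) (h₂ : cls Γ₂ ∈ imageHomogeneous X Γ₂.degree) :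
    cls Γ ∈ imageHomogeneous X Γ.degree := by
  have hh : ModExt.IsHom Γ.toModExt (Γ₁.mul Γ₂).toModExt e := .of_orderIso e he
  have hd : Γ.degree = Γ₁.degree + Γ₂.degree := by
    rw [← ModDiag.degree_mul]
    exact (Γ.degree_hom (Γ₁.mul Γ₂) hh hw.symm).symm
  have ha : ∀ x ∈ Γ.word.map e, IsAtom x := by
    intro x hx
    obtain ⟨y, hy, rfl⟩ := List.mem_map.1 hx
    exact hh.1.3 y (Γ.word_atom y hy)
  obtain ⟨ε, hε⟩ := SPerm.exists_of_perm hw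
  have h1 : cls Γ = cls ⟨(Γ₁.mul Γ₂).toModExt, Γ.word.map e, ha⟩ :=
    cls_hom Γ ⟨(Γ₁.mul Γ₂).toModExt, Γ.word.map e, ha⟩ hh (map_top e) rfl
  have h2 := cls_sperm (Γ₁.mul Γ₂).toModExt hε ha (Γ₁.mul Γ₂).word_atom
  rw [h1, h2, hd]
  refine units_smul_mem _ ?_ ε
  have := mul_mem_imageHomogeneous h₁ h₂
  rwa [MD.cls_mul_cls] at this

theorem IsGeneratorSystem.cls_mem {X : Set (ModDiag L)} (hX : IsGeneratorSystem X)
    (Γ : ModDiag L) : cls Γ ∈ imageHomogeneous X Γ.degree := by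
  -- Removing a letter of L shortens the word on the same lattice; splitting a pushout or passing to
  -- the generated extension shrinks the lattice without lengthening the word.
  induction hn : Nat.card Γ.carrier + Γ.word.length using Nat.strong_induction_on generalizing Γ with
  | _ n ih =>
  by_cases h0 : cls Γ = 0
  · rw [h0]
    exact Submodule.zero_mem _
  by_cases hF : ∃ a ∈ Γ.word, a ≤ Γ.flat
  · obtain ⟨a, ha, haF⟩ := hF
    obtain ⟨l, rfl⟩ := Γ.exists_incl_of_le haF
    obtain ⟨J₁, J₂, hJ⟩ := List.append_of_mem ha
    have hla : IsAtom l := by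
      have : ModExt.IsHom (ModExt.self L) Γ.toModExt Γ.incl := ⟨Γ.isEmbedding, fun _ => rfl⟩
      exact this.isAtom_iff.1 (Γ.word_atom _ ha)
    -- The pushout with the trivial extension is Γ again, so the letter l becomes a factor of its
    -- own.
    let Γ₁ : ModDiag L := ⟨ModExt.self L, [l], by
      intro x hx
      rw [List.mem_singleton.1 hx]
      exact hla⟩
    let Γ₂ : ModDiag L := ⟨Γ.toModExt, J₁ ++ J₂, fun x hx => Γ.word_atom x (by
      rw [hJ, List.mem_append, List.mem_cons]
      rcases List.mem_append.1 hx with h | h <;> simp [h])⟩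
    have hg : Γ₁.IsGenerator := Or.inl ⟨fun x => ⟨x, rfl⟩, rfl⟩
    have h₂ := ih (Nat.card Γ.carrier + (J₁ ++ J₂).length) (by
      rw [← hn, hJ]
      simp) Γ₂ rfl
    let e : Γ.carrier ≃o Pushout (ModExt.self L) Γ.toModExt :=
      { toFun := fun x => Pushout.inr x
        invFun := fun p => p.1.2
        left_inv := fun _ => rfl
        right_inv := fun p => Pushout.ext (p.2.symm.trans (self_restr _)) rfl
        map_rel_iff' := Pushout.inr_le }
    refine mem_of_iso_pushout Γ Γ₁ Γ₂ e (fun l => (Pushout.base_eq_inr l).symm) ?_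
      (hX.generator_mem hg) h₂
    have h3 : e (Γ.incl l) = Pushout.inl (E₁ := ModExt.self L) l :=
      (Pushout.base_eq_inr l).symm.trans (Pushout.base_eq_inl l)
    have h4 : (Γ.word.map e).Perm (((Γ.incl l) :: (J₁ ++ J₂)).map e) :=
      (hJ ▸ List.perm_middle : Γ.word.Perm _).map e
    rw [List.map_cons, h3] at h4
    exact h4
  push Not at hF
  by_cases hr : Γ.IsReduced
  · by_cases ht : Γ.toModExt.IsTrivial
    · have hJ : Γ.word = [] := List.eq_nil_iff_forall_not_mem.2 fun x hx => hF x hx (ht.le_flat x)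
      have hh : ModExt.IsHom (ModDiag.one L).toModExt Γ.toModExt Γ.incl :=
        ⟨Γ.isEmbedding, fun _ => rfl⟩
      have htop : Γ.incl ⊤ = ⊤ := top_le_iff.1 (ht.le_flat ⊤)
      rw [← cls_hom (ModDiag.one L) Γ hh htop hJ,
        (ModDiag.one L).degree_hom Γ hh (hJ ▸ .nil), ModDiag.degree_one, ← MD.one_def]
      exact ⟨1, FreeGradedComm.mono_mem_homogeneous [], map_one (ofFree X)⟩
    by_cases hi : Γ.toModExt.IsIrreducible
    · exact hX.generator_mem (Or.inr ⟨hi, hF, hr⟩)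
    obtain ⟨E₁, E₂, h₁, h₂, e, he⟩ := not_not.1 fun h => hi ⟨ht, h⟩
    have hc : Nat.card Γ.carrier = Nat.card (Pushout E₁ E₂) := Nat.card_congr e.toEquiv
    have hh : ModExt.IsHom Γ.toModExt (E₁.pushout E₂) e := .of_orderIso e he
    obtain ⟨J₁, J₂, ha₁, ha₂, hp⟩ := exists_words (Γ.word.map e) (by
      intro x hx
      obtain ⟨y, hy, rfl⟩ := List.mem_map.1 hx
      exact hh.1.3 y (Γ.word_atom y hy))
    have hl := hp.length_eq
    rw [List.length_map, List.length_append, List.length_map, List.length_map] at hl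
    have hc₁ := ModExt.card_lt_pushout_left (E₁ := E₁) h₂
    have hc₂ := ModExt.card_lt_pushout_right (E₂ := E₂) h₁
    exact mem_of_iso_pushout Γ ⟨E₁, J₁, ha₁⟩ ⟨E₂, J₂, ha₂⟩ e he hp
      (ih _ (by show Nat.card E₁.carrier + J₁.length < n; omega) ⟨E₁, J₁, ha₁⟩ rfl)
      (ih _ (by show Nat.card E₂.carrier + J₂.length < n; omega) ⟨E₂, J₂, ha₂⟩ rfl)
  · obtain ⟨Γ', h1, h2, h3, h4⟩ := exists_generated Γ (ModDiag.spanning_of_ne_zero h0) hr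
    rw [h1, h2]
    exact ih _ (by omega) Γ' rfl

theorem imageHomogeneous_eq {X : Set (ModDiag L)} (hX : IsGeneratorSystem X) (n : ℤ) :
    imageHomogeneous X n = MD.homogeneous L n := by
  apply le_antisymm
  · rw [imageHomogeneous, Submodule.map_le_iff_le_comap, FreeGradedComm.homogeneous,
      Submodule.span_le]
    rintro _ ⟨l, rfl, rfl⟩
    refine Submodule.subset_span ⟨mulOn X l, ModDiag.degree_mulOn X l, (ofFree_mono X l).symm⟩
  · rw [MD.homogeneous, Submodule.span_le]
    rintro _ ⟨Γ, rfl, rfl⟩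
    exact hX.cls_mem Γ

theorem ofFree_surjective {X : Set (ModDiag L)} (hX : IsGeneratorSystem X) :
    Function.Surjective (ofFree X) := by
  intro x
  induction x using MD.ind with
  | h0 => exact ⟨0, map_zero _⟩
  | hadd x y hx hy =>
    obtain ⟨a, rfl⟩ := hx
    obtain ⟨b, rfl⟩ := hy
    exact ⟨a + b, map_add _ a b⟩
  | hc c Γ =>
    obtain ⟨a, -, ha⟩ := hX.cls_mem Γ
    exact ⟨c • a, by rw [map_smul]; exact congrArg (c • ·) ha⟩

/-- The map `toFree` inverts `ofFree` on monomials, and these span the free algebra;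
multiplicativity of `toFree` is not needed. -/
theorem ofFree_injective [Nontrivial L] {X : Set (ModDiag L)} (hX : IsGeneratorSystem X) :
    Function.Injective (ofFree X) := by
  have : ∀ z, hX.toFree (ofFree X z) = z := by
    intro z
    induction FreeGradedComm.span_mono z using Submodule.span_induction with
    | mem x hx =>
      obtain ⟨l, rfl⟩ := hx
      rw [ofFree_mono, hX.toFree_mulOn]
    | zero => rw [map_zero, map_zero]
    | add x y _ _ hx hy => rw [map_add, map_add, hx, hy]
    | smul c x _ hx => rw [map_smul, map_smul, hx]
  exact Function.LeftInverse.injective this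

end Isomorphism

end GeomLattice

theorem mainTheorem3 (L : Type u) [Lattice L] [BoundedOrder L] [IsGeometric L] [Nontrivial L] :
    (∃ X : Set (ModDiag L), IsGeneratorSystem X) ∧
    (∀ X : Set (ModDiag L), IsGeneratorSystem X →
      ∃ φ : FreeGradedComm (fun Γ : X => Γ.1.degree) ≃ₐ[ℚ] MD L,
        (∀ Γ : X, φ (FreeGradedComm.gen _ Γ) = MD.cls Γ.1) ∧
        ∀ n : ℤ, (FreeGradedComm.homogeneous (fun Γ : X => Γ.1.degree) n).map φ.toLinearMap =
          MD.homogeneous L n) ∧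
    (∀ E : ModExt L,
      (∃ l : List (ModExt L), (∀ E' ∈ l, E'.IsIrreducible) ∧ E.Iso (ModExt.pushoutList l)) ∧
      ∀ l l' : List (ModExt L), (∀ E' ∈ l, E'.IsIrreducible) → (∀ E' ∈ l', E'.IsIrreducible) →
        E.Iso (ModExt.pushoutList l) → E.Iso (ModExt.pushoutList l') →
        ∃ l'' : List (ModExt L), l''.Perm l' ∧ List.Forall₂ ModExt.Iso l l'') := by
  refine ⟨exists_isGeneratorSystem, fun X hX => ?_, fun E => ⟨E.exists_iso_pushoutList,
    fun l l' hl hl' h h' => ModExt.pushoutList_unique hl hl' h h'⟩⟩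
  exact ⟨AlgEquiv.ofBijective (ofFree X) ⟨ofFree_injective hX, ofFree_surjective hX⟩,
    ofFree_gen X, imageHomogeneous_eq hX⟩
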